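/- Let $0<\tau\le 1$, and on $\mathbb R^3$ with coordinates $(x,y,z)$ put $E_s=x\partial_x+s\,y\partial_y$ $(s\in\mathbb R)$, $E=E_1$, and $\pi_\tau=E_\tau\wedge\partial_z$, a Poisson structure. Let $\mathfrak X^k$ be the smooth $k$-vector fields on $\mathbb R^3$, $[\cdot,\cdot]$ the Schouten–Nijenhuis bracket, and $H^k=H^k(\mathbb R^3,\pi_\tau)$ the Poisson cohomology, i.e. the cohomology of $(\mathfrak X^\bullet,\,d=[\pi_\tau,\cdot\,])$, with the operations $H^i\times H^j\to H^{i+j}$ and $H^i\times H^j\to H^{i+j-1}$ induced by $\wedge$ and $[\cdot,\cdot]$. Then: * the Casimir functions (the $f\in C^\infty(\mathbb R^3)$ with $[\pi_\tau,f]=0$) are exactly the constants, and $H^3=0$; * $H^1$ and $H^2$ are free modules over the Casimir functions. The following multivector fields are cocycles, and their classes form a basis: * for $\tau=1$: $\;y\partial_x,\ x\partial_y,\ E_{-1},\ \partial_z$ for $H^1$, and $y\partial_x\wedge\partial_z,\ x\partial_y\wedge\partial_z,\ E_{-1}\wedge\partial_z$ for $H^2$; * for $\tau=\frac1n$ with an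 integer $n\ge2$: $\;y^n\partial_x,\ E_{-1},\ \partial_z$ for $H^1$, and $y^n\partial_x\wedge\partial_z,\ E_{-1}\wedge\partial_z$ for $H^2$; * for all other $\tau$, i.e. $\tau\in(0,1]\setminus\{\frac1n: n\ge 1\}$: $\;E_{-1},\ \partial_z$ for $H^1$, and $E_{-1}\wedge\partial_z$ for $H^2$; * the following relations hold in $H^2$: for $\tau=1$, $[E\wedge\partial_z]=0$ and $[p(x,y)\,\partial_x\wedge\partial_y]=0$ for every homogeneous polynomial $p$ of degree $2$; for $\tau=\frac1n$ with $n\ge 2$, $[y^{n+1}\partial_x\wedge\partial_y]=0$; * these relations determine the algebraic structure, in the following sense. Let $V^0=\mathbb R$, let $V^1,V^2\subset\mathfrak X^\bullet$ be the real spans of the generators listed above, and let $V^k=0$ for $k\ge3$. For $\tau=1$ and $\tau=\frac1n$ let $R^2$ be the real span of the bivector fields that the relations for this $\tau$ declare to have trivial class, $R^3=\mathfrak X^3$, and $R^k=0$ for $k\neq 2,3$; for all other $\tau$ let $R^k=0$ for all $k$. Then every element of $R^k$ is a cocycle with trivial class, and for $P\in V^i$, $Q\in V^j$ there are $S\in V^{i+j}$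 and $S'\in V^{i+j-1}$ (where $V^{-1}$ is read as $V^0$; the bracket $[P,Q]$ vanishes for $i=j=0$) with $P\wedge Q-S\in R^{i+j}$ and $[P,Q]-S'\in R^{i+j-1}$ (likewise $R^{-1}$ is read as $R^0$); the class of $S$ is the product, and the class of $S'$ is the bracket, of the classes of $P$ and $Q$. In particular, for $\tau\notin\{\frac1n: n\ge 1\}$ the wedge product and the bracket preserve the representatives; * as real Lie algebras, $H^1\cong\mathfrak{sl}_2(\mathbb R)\oplus\mathbb R$ for $\tau=1$, $H^1\cong\mathfrak{aff}_1(\mathbb R)\oplus\mathbb R$ for $\tau=\frac1n$ with $n\ge2$, and $H^1\cong\mathbb R\oplus\mathbb R$ (abelian) for all other $\tau$. -/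

import Mathlib

noncomputable section
namespace PoissonR3
open scoped ContDiff

/-! ### Smooth functions on `ℝ³`, with coordinates `x = x₀`, `y = x₁`, `z = x₂` -/

/-- Functions `ℝ³ → ℝ` of class `C^∞`. -/
def smoothSubalgebra : Subalgebra ℝ ((Fin 3 → ℝ) → ℝ) where
  carrier := {f | ContDiff ℝ ∞ f}
  mul_mem' := by intro f g hf hg; exact (show ContDiff ℝ ∞ f from hf).mul hg
  add_mem' := by intro f g hf hg; exact (show ContDiff ℝ ∞ f from hf).add hg
  algebraMap_mem' := fun c => (contDiff_const : ContDiff ℝ ∞ fun _ : Fin 3 → ℝ => c)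

/-- The algebra `C^∞(ℝ³)`. -/
def SmoothFun : Type := smoothSubalgebra

namespace SmoothFun

instance : CommRing SmoothFun := inferInstanceAs (CommRing smoothSubalgebra)

instance : Algebra ℝ SmoothFun := inferInstanceAs (Algebra ℝ smoothSubalgebra)

instance : Nontrivial SmoothFun := inferInstanceAs (Nontrivial smoothSubalgebra)

instance : CharZero SmoothFun :=
  charZero_of_injective_algebraMap (algebraMap ℝ SmoothFun).injective

instance : CoeFun SmoothFun fun _ => (Fin 3 → ℝ) → ℝ := ⟨fun f => Subtype.val f⟩

theorem contDiff (f : SmoothFun) : ContDiff ℝ ∞ (f : (Fin 3 → ℝ) → ℝ) := Subtype.property f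

theorem differentiable (f : SmoothFun) : Differentiable ℝ (f : (Fin 3 → ℝ) → ℝ) :=
  f.contDiff.differentiable (by decide)

theorem ext {f g : SmoothFun} (h : ∀ x, f x = g x) : f = g := Subtype.ext (funext h)

/-- A smooth function, bundled with its smoothness. -/
def of (f : (Fin 3 → ℝ) → ℝ) (hf : ContDiff ℝ ∞ f) : SmoothFun := ⟨f, hf⟩

end SmoothFun

/-- The coordinate functions `x`, `y`, `z`. -/
def coord (i : Fin 3) : SmoothFun := .of (fun x => x i) (contDiff_apply ℝ ℝ i)

/-- The partial derivative `∂/∂xᵢ`, as a derivation of `C^∞(ℝ³)`. -/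
def pderiv (i : Fin 3) : Derivation ℝ SmoothFun SmoothFun :=
  Derivation.mk'
    { toFun := fun f => .of (fun x => fderiv ℝ f x (Pi.single i 1))
        ((f.contDiff.fderiv_right (m := ∞) (by simp)).clm_apply contDiff_const)
      map_add' := fun f g => SmoothFun.ext fun x =>
        congrArg (fun L => L (Pi.single i 1)) (fderiv_add (f.differentiable x) (g.differentiable x))
      map_smul' := fun c f => SmoothFun.ext fun x =>
        congrArg (fun L => L (Pi.single i 1)) (fderiv_const_smul (f.differentiable x) c) }
    (fun f g => SmoothFun.ext fun x =>
      congrArg (fun L => L (Pi.single i 1)) (fderiv_mul (f.differentiable x) (g.differentiable x)))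

theorem pderiv_comm (i j : Fin 3) (f : SmoothFun) :
    pderiv i (pderiv j f) = pderiv j (pderiv i f) := by
  refine SmoothFun.ext fun x => ?_
  have h := f.contDiff
  have hd : DifferentiableAt ℝ (fderiv ℝ (f : (Fin 3 → ℝ) → ℝ)) x :=
    ((h.fderiv_right (m := ∞) (by simp)).differentiable (by decide)) x
  have key : ∀ a b : Fin 3, (pderiv a (pderiv b f)) x
      = fderiv ℝ (fderiv ℝ (f : (Fin 3 → ℝ) → ℝ)) x (Pi.single a 1) (Pi.single b 1) := by
    intro a b
    change fderiv ℝ (fun y => fderiv ℝ f y (Pi.single b 1)) x _ = _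
    rw [fderiv_clm_apply hd (differentiableAt_const _)]
    simp
  rw [key, key]
  exact (h.contDiffAt.isSymmSndFDerivAt (by simp; exact WithTop.coe_le_coe.2 le_top)) _ _

/-! ### Multivector fields on `ℝ³` -/

/-- The sign relating `∂_I ∧ ∂_J` to `∂_{I ∪ J}` for disjoint sets `I`, `J` of indices. -/
def koszulSign (I J : Finset (Fin 3)) : ℤ :=
  (-1) ^ ((I ×ˢ J).filter fun p => p.2 < p.1).card

/-- Multivector fields on `ℝ³` (of arbitrary, possibly mixed, degree): the function `P` stands for
`∑_I P_I ∂_I`, where `∂_I = ∂_{i₁} ∧ ⋯ ∧ ∂_{iₖ}` for `I = {i₁ < ⋯ < iₖ}`. -/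
abbrev Multivector := Finset (Fin 3) → SmoothFun

/-- The wedge product of multivector fields. -/
def wedge (P Q : Multivector) : Multivector := fun K =>
  ∑ I ∈ K.powerset, koszulSign I (K \ I) • (P I * Q (K \ I))

infixl:70 " ⋏ " => wedge

/-- Contraction with `dxᵢ` from the left, i.e. the left derivative by the odd variable `∂ᵢ`. -/
def contractL (i : Fin 3) (P : Multivector) : Multivector := fun I =>
  if i ∈ I then 0 else koszulSign {i} I • P (insert i I)

/-- Contraction with `dxᵢ` from the right, i.e. the right derivative by the odd variable `∂ᵢ`. -/
def contractR (i : Fin 3) (P : Multivector) : Multivector := fun I =>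
  if i ∈ I then 0 else koszulSign I {i} • P (insert i I)

/-- The partial derivative of all coefficients. -/
def coeffDeriv (i : Fin 3) (P : Multivector) : Multivector := fun I => pderiv i (P I)

/-- The Schouten-Nijenhuis bracket, by its coordinate formula. It extends the Lie bracket of vector
fields and satisfies `[X, f] = X f` for a vector field `X` and a function `f`. -/
def schouten (P Q : Multivector) : Multivector :=
  ∑ i, (contractR i P ⋏ coeffDeriv i Q - coeffDeriv i P ⋏ contractL i Q)

/-- The multivector fields of degree `k`. -/
def multivectorFields (k : ℕ) : Submodule SmoothFun Multivector where
  carrier := {P | ∀ I, I.card ≠ k → P I = 0}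
  add_mem' := fun hP hQ I hI => by simp [hP I hI, hQ I hI]
  zero_mem' := fun _ _ => rfl
  smul_mem' := fun f P hP I hI => by simp [hP I hI]

local notation "𝔛" => multivectorFields

/-! ### Componentwise formulas -/

theorem fin3_cases (I : Finset (Fin 3)) : I = ∅ ∨ I = {0} ∨ I = {1} ∨ I = {2} ∨ I = {0, 1} ∨
    I = {0, 2} ∨ I = {1, 2} ∨ I = {0, 1, 2} := by
  revert I; decide

theorem mv_ext {P Q : Multivector} (h0 : P ∅ = Q ∅) (h1 : P {0} = Q {0}) (h2 : P {1} = Q {1})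
    (h3 : P {2} = Q {2}) (h4 : P {0, 1} = Q {0, 1}) (h5 : P {0, 2} = Q {0, 2})
    (h6 : P {1, 2} = Q {1, 2}) (h7 : P {0, 1, 2} = Q {0, 1, 2}) : P = Q := by
  funext I
  rcases fin3_cases I with rfl | rfl | rfl | rfl | rfl | rfl | rfl | rfl <;> assumption

theorem sum_powerset_singleton (i : Fin 3) (F : Finset (Fin 3) → SmoothFun) :
    ∑ I ∈ ({i} : Finset (Fin 3)).powerset, F I = F ∅ + F {i} := by
  rw [show ({i} : Finset (Fin 3)).powerset = {∅, {i}} by revert i; decide,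
    Finset.sum_pair (by revert i; decide)]

theorem wedge_apply (P Q : Multivector) :
    (P ⋏ Q) ∅ = P ∅ * Q ∅ ∧
    (P ⋏ Q) {0} = P ∅ * Q {0} + P {0} * Q ∅ ∧
    (P ⋏ Q) {1} = P ∅ * Q {1} + P {1} * Q ∅ ∧
    (P ⋏ Q) {2} = P ∅ * Q {2} + P {2} * Q ∅ ∧
    (P ⋏ Q) {0, 1} = P ∅ * Q {0, 1} + P {0} * Q {1} - P {1} * Q {0} + P {0, 1} * Q ∅ ∧
    (P ⋏ Q) {0, 2} = P ∅ * Q {0, 2} + P {0} * Q {2} - P {2} * Q {0} + P {0, 2} * Q ∅ ∧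
    (P ⋏ Q) {1, 2} = P ∅ * Q {1, 2} + P {1} * Q {2} - P {2} * Q {1} + P {1, 2} * Q ∅ ∧
    (P ⋏ Q) {0, 1, 2} = P ∅ * Q {0, 1, 2} + P {0} * Q {1, 2} - P {1} * Q {0, 2} +
      P {2} * Q {0, 1} + P {0, 1} * Q {2} - P {0, 2} * Q {1} + P {1, 2} * Q {0} + P {0, 1, 2} * Q ∅ := by
  refine ⟨?_, ?_, ?_, ?_, ?_, ?_, ?_, ?_⟩
  · simp [wedge, koszulSign]
  iterate 3
    · simp +decide [wedge, koszulSign, sum_powerset_singleton]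
  all_goals
    simp only [wedge,
      show ({0, 1} : Finset (Fin 3)).powerset = ([∅, {0}, {1}, {0, 1}] : List _).toFinset by decide,
      show ({0, 2} : Finset (Fin 3)).powerset = ([∅, {0}, {2}, {0, 2}] : List _).toFinset by decide,
      show ({1, 2} : Finset (Fin 3)).powerset = ([∅, {1}, {2}, {1, 2}] : List _).toFinset by decide,
      show ({0, 1, 2} : Finset (Fin 3)).powerset = ([∅, {0}, {1}, {2}, {0, 1},
        {0, 2}, {1, 2}, {0, 1, 2}] : List _).toFinset by decide]
    rw [List.sum_toFinset _ (by decide)]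
    simp only [List.map_cons, List.map_nil, Finset.sdiff_empty, Finset.sdiff_self,
      show ({0, 1} : Finset (Fin 3)) \ {0} = {1} by decide,
      show ({0, 1} : Finset (Fin 3)) \ {1} = {0} by decide,
      show ({0, 2} : Finset (Fin 3)) \ {0} = {2} by decide,
      show ({0, 2} : Finset (Fin 3)) \ {2} = {0} by decide,
      show ({1, 2} : Finset (Fin 3)) \ {1} = {2} by decide,
      show ({1, 2} : Finset (Fin 3)) \ {2} = {1} by decide,
      show ({0, 1, 2} : Finset (Fin 3)) \ {0} = {1, 2} by decide,
      show ({0, 1, 2} : Finset (Fin 3)) \ {1} = {0, 2} by decide,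
      show ({0, 1, 2} : Finset (Fin 3)) \ {2} = {0, 1} by decide,
      show ({0, 1, 2} : Finset (Fin 3)) \ {0, 1} = {2} by decide,
      show ({0, 1, 2} : Finset (Fin 3)) \ {0, 2} = {1} by decide,
      show ({0, 1, 2} : Finset (Fin 3)) \ {1, 2} = {0} by decide]
    simp +decide [koszulSign]
    ring


theorem contractL_apply (P : Multivector) :
    contractL 0 P ∅ = P {0} ∧
    contractL 0 P {0} = 0 ∧
    contractL 0 P {1} = P {0, 1} ∧
    contractL 0 P {2} = P {0, 2} ∧
    contractL 0 P {0, 1} = 0 ∧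
    contractL 0 P {0, 2} = 0 ∧
    contractL 0 P {1, 2} = P {0, 1, 2} ∧
    contractL 0 P {0, 1, 2} = 0 ∧
    contractL 1 P ∅ = P {1} ∧
    contractL 1 P {0} = -P {0, 1} ∧
    contractL 1 P {1} = 0 ∧
    contractL 1 P {2} = P {1, 2} ∧
    contractL 1 P {0, 1} = 0 ∧
    contractL 1 P {0, 2} = -P {0, 1, 2} ∧
    contractL 1 P {1, 2} = 0 ∧
    contractL 1 P {0, 1, 2} = 0 ∧
    contractL 2 P ∅ = P {2} ∧
    contractL 2 P {0} = -P {0, 2} ∧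
    contractL 2 P {1} = -P {1, 2} ∧
    contractL 2 P {2} = 0 ∧
    contractL 2 P {0, 1} = P {0, 1, 2} ∧
    contractL 2 P {0, 2} = 0 ∧
    contractL 2 P {1, 2} = 0 ∧
    contractL 2 P {0, 1, 2} = 0 := by
  refine ⟨?_, ?_, ?_, ?_, ?_, ?_, ?_, ?_, ?_, ?_, ?_, ?_, ?_, ?_, ?_, ?_, ?_, ?_, ?_, ?_, ?_, ?_,
    ?_, ?_⟩
  all_goals
    simp only [contractL,
      show (insert 1 {0} : Finset (Fin 3)) = {0, 1} by decide,
      show (insert 2 {0} : Finset (Fin 3)) = {0, 2} by decide,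
      show (insert 2 {1} : Finset (Fin 3)) = {1, 2} by decide,
      show (insert 2 {0, 1} : Finset (Fin 3)) = {0, 1, 2} by decide,
      show (insert 1 {0, 2} : Finset (Fin 3)) = {0, 1, 2} by decide]
    simp +decide [koszulSign]
theorem contractR_apply (P : Multivector) :
    contractR 0 P ∅ = P {0} ∧
    contractR 0 P {0} = 0 ∧
    contractR 0 P {1} = -P {0, 1} ∧
    contractR 0 P {2} = -P {0, 2} ∧
    contractR 0 P {0, 1} = 0 ∧
    contractR 0 P {0, 2} = 0 ∧
    contractR 0 P {1, 2} = P {0, 1, 2} ∧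
    contractR 0 P {0, 1, 2} = 0 ∧
    contractR 1 P ∅ = P {1} ∧
    contractR 1 P {0} = P {0, 1} ∧
    contractR 1 P {1} = 0 ∧
    contractR 1 P {2} = -P {1, 2} ∧
    contractR 1 P {0, 1} = 0 ∧
    contractR 1 P {0, 2} = -P {0, 1, 2} ∧
    contractR 1 P {1, 2} = 0 ∧
    contractR 1 P {0, 1, 2} = 0 ∧
    contractR 2 P ∅ = P {2} ∧
    contractR 2 P {0} = P {0, 2} ∧
    contractR 2 P {1} = P {1, 2} ∧
    contractR 2 P {2} = 0 ∧
    contractR 2 P {0, 1} = P {0, 1, 2} ∧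
    contractR 2 P {0, 2} = 0 ∧
    contractR 2 P {1, 2} = 0 ∧
    contractR 2 P {0, 1, 2} = 0 := by
  refine ⟨?_, ?_, ?_, ?_, ?_, ?_, ?_, ?_, ?_, ?_, ?_, ?_, ?_, ?_, ?_, ?_, ?_, ?_, ?_, ?_, ?_, ?_,
    ?_, ?_⟩
  all_goals
    simp only [contractR,
      show (insert 1 {0} : Finset (Fin 3)) = {0, 1} by decide,
      show (insert 2 {0} : Finset (Fin 3)) = {0, 2} by decide,
      show (insert 2 {1} : Finset (Fin 3)) = {1, 2} by decide,
      show (insert 2 {0, 1} : Finset (Fin 3)) = {0, 1, 2} by decide,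
      show (insert 1 {0, 2} : Finset (Fin 3)) = {0, 1, 2} by decide]
    simp +decide [koszulSign]

theorem coeffDeriv_apply (i : Fin 3) (P : Multivector) (K : Finset (Fin 3)) :
    coeffDeriv i P K = pderiv i (P K) := rfl

theorem schouten_apply (P Q : Multivector) (K : Finset (Fin 3)) : schouten P Q K =
    ((contractR 0 P ⋏ coeffDeriv 0 Q) K - (coeffDeriv 0 P ⋏ contractL 0 Q) K) +
    ((contractR 1 P ⋏ coeffDeriv 1 Q) K - (coeffDeriv 1 P ⋏ contractL 1 Q) K) +
    ((contractR 2 P ⋏ coeffDeriv 2 Q) K - (coeffDeriv 2 P ⋏ contractL 2 Q) K) := by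
  simp only [schouten, Fin.sum_univ_three]; rfl

theorem add_wedge (P P' Q : Multivector) : (P + P') ⋏ Q = P ⋏ Q + P' ⋏ Q := by
  funext K
  simp only [wedge, Pi.add_apply, add_mul, smul_add, Finset.sum_add_distrib]

theorem wedge_add (P Q Q' : Multivector) : P ⋏ (Q + Q') = P ⋏ Q + P ⋏ Q' := by
  funext K
  simp only [wedge, Pi.add_apply, mul_add, smul_add, Finset.sum_add_distrib]

theorem smul_wedge (c : ℝ) (P Q : Multivector) : (c • P) ⋏ Q = c • (P ⋏ Q) := by
  funext K
  simp only [wedge, Pi.smul_apply, smul_mul_assoc, Finset.smul_sum, smul_comm c]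

theorem wedge_smul (c : ℝ) (P Q : Multivector) : P ⋏ (c • Q) = c • (P ⋏ Q) := by
  funext K
  simp only [wedge, Pi.smul_apply, mul_smul_comm, Finset.smul_sum, smul_comm c]

theorem contractL_add (i : Fin 3) (P Q : Multivector) :
    contractL i (P + Q) = contractL i P + contractL i Q := by
  funext K
  by_cases h : i ∈ K <;> simp [contractL, h]

theorem contractR_add (i : Fin 3) (P Q : Multivector) :
    contractR i (P + Q) = contractR i P + contractR i Q := by
  funext K
  by_cases h : i ∈ K <;> simp [contractR, h]

theorem contractL_smul (i : Fin 3) (c : ℝ) (P : Multivector) :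
    contractL i (c • P) = c • contractL i P := by
  funext K
  by_cases h : i ∈ K <;> simp [contractL, h]

theorem contractR_smul (i : Fin 3) (c : ℝ) (P : Multivector) :
    contractR i (c • P) = c • contractR i P := by
  funext K
  by_cases h : i ∈ K <;> simp [contractR, h]

theorem coeffDeriv_add (i : Fin 3) (P Q : Multivector) :
    coeffDeriv i (P + Q) = coeffDeriv i P + coeffDeriv i Q := by
  funext K
  simp [coeffDeriv]

theorem coeffDeriv_smul (i : Fin 3) (c : ℝ) (P : Multivector) :
    coeffDeriv i (c • P) = c • coeffDeriv i P := by
  funext K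
  simp [coeffDeriv]

theorem add_schouten (P P' Q : Multivector) :
    schouten (P + P') Q = schouten P Q + schouten P' Q := by
  simp only [schouten, contractR_add, coeffDeriv_add, add_wedge, ← Finset.sum_add_distrib]
  exact Finset.sum_congr rfl fun _ _ => by abel

theorem schouten_add (P Q Q' : Multivector) :
    schouten P (Q + Q') = schouten P Q + schouten P Q' := by
  simp only [schouten, contractL_add, coeffDeriv_add, wedge_add, ← Finset.sum_add_distrib]
  exact Finset.sum_congr rfl fun _ _ => by abel

theorem smul_schouten (c : ℝ) (P Q : Multivector) :
    schouten (c • P) Q = c • schouten P Q := by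
  simp only [schouten, contractR_smul, coeffDeriv_smul, smul_wedge, Finset.smul_sum, smul_sub]

theorem schouten_smul (c : ℝ) (P Q : Multivector) :
    schouten P (c • Q) = c • schouten P Q := by
  simp only [schouten, contractL_smul, coeffDeriv_smul, wedge_smul, Finset.smul_sum, smul_sub]

theorem wedge_mem {i j : ℕ} {P Q : Multivector} (hP : P ∈ 𝔛 i) (hQ : Q ∈ 𝔛 j) :
    P ⋏ Q ∈ 𝔛 (i + j) := by
  intro K hK
  refine Finset.sum_eq_zero fun I hI => ?_
  rw [Finset.mem_powerset] at hI
  by_cases h : I.card = i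
  · have : (K \ I).card ≠ j := fun h' => hK (by
      rw [← h, ← h', add_comm, Finset.card_sdiff_add_card_eq_card hI])
    simp [hQ _ this]
  · simp [hP _ h]

theorem coeffDeriv_mem {k : ℕ} (i : Fin 3) {P : Multivector} (hP : P ∈ 𝔛 k) :
    coeffDeriv i P ∈ 𝔛 k := fun I hI => by
  simp [coeffDeriv, hP I hI]

theorem contractL_mem {k : ℕ} (i : Fin 3) {P : Multivector} (hP : P ∈ 𝔛 (k + 1)) :
    contractL i P ∈ 𝔛 k := fun I hI => by
  by_cases h : i ∈ I
  · simp [contractL, h]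
  · have : (insert i I).card ≠ k + 1 := by simpa [Finset.card_insert_of_notMem h] using hI
    simp [contractL, hP _ this]

theorem contractR_mem {k : ℕ} (i : Fin 3) {P : Multivector} (hP : P ∈ 𝔛 (k + 1)) :
    contractR i P ∈ 𝔛 k := fun I hI => by
  by_cases h : i ∈ I
  · simp [contractR, h]
  · have : (insert i I).card ≠ k + 1 := by simpa [Finset.card_insert_of_notMem h] using hI
    simp [contractR, hP _ this]

theorem contractL_zero (i : Fin 3) {P : Multivector} (hP : P ∈ 𝔛 0) : contractL i P = 0 := by
  funext I
  have : P (insert i I) = 0 := hP _ (by simp)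
  simp [contractL, this]

theorem contractR_zero (i : Fin 3) {P : Multivector} (hP : P ∈ 𝔛 0) : contractR i P = 0 := by
  funext I
  have : P (insert i I) = 0 := hP _ (by simp)
  simp [contractR, this]

theorem zero_wedge (P : Multivector) : 0 ⋏ P = 0 := by
  funext K; simp [wedge]

theorem wedge_zero (P : Multivector) : P ⋏ 0 = 0 := by
  funext K; simp [wedge]

theorem schouten_mem {i j : ℕ} {P Q : Multivector} (hP : P ∈ 𝔛 i) (hQ : Q ∈ 𝔛 j) :
    schouten P Q ∈ 𝔛 (i + j - 1) := by
  refine Submodule.sum_mem _ fun a _ => Submodule.sub_mem _ ?_ ?_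
  · cases i with
    | zero => rw [contractR_zero a hP, zero_wedge]; exact Submodule.zero_mem _
    | succ i =>
      rw [show i + 1 + j - 1 = i + j by omega]
      exact wedge_mem (contractR_mem a hP) (coeffDeriv_mem a hQ)
  · cases j with
    | zero => rw [contractL_zero a hQ, wedge_zero]; exact Submodule.zero_mem _
    | succ j =>
      rw [show i + (j + 1) - 1 = i + j by omega]
      exact wedge_mem (coeffDeriv_mem a hP) (contractL_mem a hQ)

/-- The grading involution, `(-1)^k` in degree `k`. -/
def parity (P : Multivector) : Multivector := fun I => (-1 : ℤ) ^ I.card • P I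

theorem parity_apply (P : Multivector) : parity P ∅ = P ∅ ∧ parity P {0} = -P {0} ∧
    parity P {1} = -P {1} ∧ parity P {2} = -P {2} ∧ parity P {0, 1} = P {0, 1} ∧
    parity P {0, 2} = P {0, 2} ∧ parity P {1, 2} = P {1, 2} ∧
    parity P {0, 1, 2} = -P {0, 1, 2} := by
  refine ⟨?_, ?_, ?_, ?_, ?_, ?_, ?_, ?_⟩ <;> simp [parity]

theorem parity_of_mem {k : ℕ} {P : Multivector} (hP : P ∈ 𝔛 k) :
    parity P = (-1 : ℝ) ^ k • P := by
  funext I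
  by_cases h : I.card = k
  · subst h
    rcases Nat.even_or_odd I.card with e | e <;> simp [parity, e.neg_one_pow]
  · simp [parity, hP I h]

theorem mem_two {P : Multivector} (h : P ∈ 𝔛 2) :
    P ∅ = 0 ∧ P {0} = 0 ∧ P {1} = 0 ∧ P {2} = 0 ∧ P {0, 1, 2} = 0 :=
  ⟨h _ (by decide), h _ (by decide), h _ (by decide), h _ (by decide), h _ (by decide)⟩

theorem mem_one {P : Multivector} (h : P ∈ 𝔛 1) : P ∅ = 0 ∧ P {0, 1} = 0 ∧ P {0, 2} = 0 ∧
    P {1, 2} = 0 ∧ P {0, 1, 2} = 0 :=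
  ⟨h _ (by decide), h _ (by decide), h _ (by decide), h _ (by decide), h _ (by decide)⟩

theorem pderiv_comm10 (f : SmoothFun) : pderiv 1 (pderiv 0 f) = pderiv 0 (pderiv 1 f) :=
  pderiv_comm ..
theorem pderiv_comm20 (f : SmoothFun) : pderiv 2 (pderiv 0 f) = pderiv 0 (pderiv 2 f) :=
  pderiv_comm ..
theorem pderiv_comm21 (f : SmoothFun) : pderiv 2 (pderiv 1 f) = pderiv 1 (pderiv 2 f) :=
  pderiv_comm ..

/-- The divergence operator, which generates the Schouten bracket. -/
def divergence (P : Multivector) : Multivector := ∑ i, coeffDeriv i (contractL i P)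

theorem divergence_apply (P : Multivector) (K : Finset (Fin 3)) : divergence P K =
    pderiv 0 (contractL 0 P K) + pderiv 1 (contractL 1 P K) + pderiv 2 (contractL 2 P K) := by
  simp only [divergence, Fin.sum_univ_three]; rfl

theorem divergence_add (P Q : Multivector) :
    divergence (P + Q) = divergence P + divergence Q := by
  simp only [divergence, contractL_add, coeffDeriv_add, Finset.sum_add_distrib]

theorem divergence_divergence (P : Multivector) : divergence (divergence P) = 0 := by
  apply mv_ext <;>
    simp only [divergence_apply, contractL_apply, map_add, map_neg, map_zero, pderiv_comm10,
      pderiv_comm20, pderiv_comm21, Pi.zero_apply] <;> ring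

set_option maxHeartbeats 1000000 in
theorem schouten_parity (P Q : Multivector) : schouten (parity P) Q =
    divergence P ⋏ Q + parity P ⋏ divergence Q - divergence (P ⋏ Q) := by
  apply mv_ext <;>
    simp only [schouten_apply, divergence_apply, wedge_apply, contractL_apply, contractR_apply,
      coeffDeriv_apply, parity_apply, Pi.add_apply, Pi.sub_apply, map_add, map_sub, map_neg,
      map_zero, Derivation.leibniz, smul_eq_mul] <;> ring

set_option maxHeartbeats 1000000 in
theorem schouten_wedge_of_mem_two {B : Multivector} (hB : B ∈ 𝔛 2) (P Q : Multivector) :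
    schouten B (P ⋏ Q) = schouten B P ⋏ Q + parity P ⋏ schouten B Q := by
  obtain ⟨h1, h2, h3, h4, h5⟩ := mem_two hB
  apply mv_ext <;>
    simp only [schouten_apply, wedge_apply, contractL_apply, contractR_apply, coeffDeriv_apply,
      parity_apply, Pi.add_apply, map_add, map_sub, map_zero, Derivation.leibniz,
      smul_eq_mul, h1, h2, h3, h4, h5, mul_zero, zero_mul, add_zero, zero_add, sub_zero,
      zero_sub] <;> ring

set_option maxHeartbeats 1000000 in
theorem schouten_wedge_of_mem_one {B : Multivector} (hB : B ∈ 𝔛 1) (P Q : Multivector) :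
    schouten B (P ⋏ Q) = schouten B P ⋏ Q + P ⋏ schouten B Q := by
  obtain ⟨h1, h2, h3, h4, h5⟩ := mem_one hB
  apply mv_ext <;>
    simp only [schouten_apply, wedge_apply, contractL_apply, contractR_apply, coeffDeriv_apply,
      Pi.add_apply, map_add, map_sub, map_zero, Derivation.leibniz,
      smul_eq_mul, h1, h2, h3, h4, h5, mul_zero, zero_mul, add_zero, zero_add, sub_zero,
      zero_sub] <;> ring


theorem divergence_parity (P : Multivector) : divergence (parity P) = -parity (divergence P) := by
  apply mv_ext <;>
    simp only [divergence_apply, contractL_apply, parity_apply, map_neg, map_zero, Pi.neg_apply,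
      neg_add_rev, neg_zero, neg_neg] <;> ring

theorem parity_parity (P : Multivector) : parity (parity P) = P := by
  funext I
  rcases Nat.even_or_odd I.card with e | e <;> simp [parity, e.neg_one_pow]

theorem parity_neg (P : Multivector) : parity (-P) = -parity P := by
  funext I; simp [parity]

theorem parity_wedge (P Q : Multivector) : parity (P ⋏ Q) = parity P ⋏ parity Q := by
  apply mv_ext <;> simp only [wedge_apply, parity_apply] <;> ring

theorem divergence_mem {k : ℕ} {P : Multivector} (hP : P ∈ 𝔛 (k + 1)) : divergence P ∈ 𝔛 k :=
  Submodule.sum_mem _ fun i _ => coeffDeriv_mem i (contractL_mem i hP)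

theorem schouten_eq (P Q : Multivector) : schouten P Q =
    divergence (parity P) ⋏ Q + P ⋏ divergence Q - divergence (parity P ⋏ Q) := by
  have := schouten_parity (parity P) Q
  rwa [parity_parity] at this

theorem neg_wedge (P Q : Multivector) : (-P) ⋏ Q = -(P ⋏ Q) := by
  have := smul_wedge (-1) P Q
  simpa using this

theorem wedge_neg (P Q : Multivector) : P ⋏ (-Q) = -(P ⋏ Q) := by
  have := wedge_smul (-1) P Q
  simpa using this

theorem schouten_neg (P Q : Multivector) : schouten P (-Q) = -schouten P Q := by
  have := schouten_smul (-1) P Q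
  simpa using this

theorem neg_schouten (P Q : Multivector) : schouten (-P) Q = -schouten P Q := by
  have := smul_schouten (-1) P Q
  simpa using this

theorem divergence_neg (P : Multivector) : divergence (-P) = -divergence P :=
  (AddMonoidHom.mk' divergence divergence_add).map_neg P

theorem divergence_schouten {B : Multivector} (hB : B ∈ 𝔛 2) (P : Multivector) :
    divergence (schouten B P) + schouten B (divergence P) = schouten (divergence B) P := by
  have hp : parity B = B := by rw [parity_of_mem hB]; simp
  have hu : parity (divergence B) = -divergence B := by
    rw [parity_of_mem (divergence_mem hB)]; simp
  rw [schouten_eq B, schouten_eq B, schouten_eq (divergence B), hp, hu, divergence_neg,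
    divergence_divergence, divergence_divergence]
  simp only [sub_eq_add_neg, divergence_add, divergence_neg, divergence_divergence, neg_wedge,
    neg_zero, zero_wedge, wedge_zero, neg_neg]
  abel

theorem parity_schouten {B : Multivector} (hB : B ∈ 𝔛 2) (P : Multivector) :
    parity (schouten B P) = -schouten B (parity P) := by
  have hp : parity B = B := by rw [parity_of_mem hB]; simp
  have ha (A A' : Multivector) : parity (A + A') = parity A + parity A' := by
    funext I; simp [parity]
  have hd (A : Multivector) : parity (divergence A) = -divergence (parity A) := by
    rw [divergence_parity, neg_neg]
  rw [schouten_eq, schouten_eq, hp, sub_eq_add_neg, ha, ha, parity_neg, hd, parity_wedge, parity_wedge,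
    hd, hd, hp, parity_wedge, hp, neg_wedge, wedge_neg]
  abel

/-- The graded Jacobi identity for a bivector field. -/
theorem schouten_schouten_of_mem_two {B : Multivector} (hB : B ∈ 𝔛 2) (P Q : Multivector) :
    schouten B (schouten P Q) =
      schouten (schouten B P) Q - schouten (parity P) (schouten B Q) := by
  have hL : ∀ A, schouten B (divergence A) = schouten (divergence B) A - divergence (schouten B A) :=
    fun A => by rw [← divergence_schouten hB A]; abel
  have hu := divergence_mem hB
  rw [schouten_eq P Q, schouten_eq (schouten B P) Q, schouten_eq (parity P), parity_parity,
    sub_eq_add_neg, schouten_add, schouten_add, schouten_neg, schouten_wedge_of_mem_two hB,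
    schouten_wedge_of_mem_two hB, hL, hL, hL, schouten_wedge_of_mem_one hu,
    schouten_wedge_of_mem_two hB, parity_schouten hB, parity_parity, divergence_parity, parity_neg,
    parity_parity]
  simp only [sub_eq_add_neg, add_wedge, wedge_add, neg_wedge, wedge_neg, divergence_add, divergence_neg]
  abel

set_option maxHeartbeats 1000000 in
/-- The Jacobi identity for vector fields. -/
theorem schouten_schouten_of_mem_one {X Y Z : Multivector} (hX : X ∈ 𝔛 1) (hY : Y ∈ 𝔛 1)
    (hZ : Z ∈ 𝔛 1) :
    schouten X (schouten Y Z) = schouten (schouten X Y) Z + schouten Y (schouten X Z) := by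
  obtain ⟨x1, x2, x3, x4, x5⟩ := mem_one hX
  obtain ⟨y1, y2, y3, y4, y5⟩ := mem_one hY
  obtain ⟨z1, z2, z3, z4, z5⟩ := mem_one hZ
  apply mv_ext <;>
    simp only [schouten_apply, wedge_apply, contractL_apply, contractR_apply, coeffDeriv_apply,
      Pi.add_apply, map_add, map_sub, map_zero, Derivation.leibniz, smul_eq_mul, x1, x2, x3, x4,
      x5, y1, y2, y3, y4, y5, z1, z2, z3, z4, z5, mul_zero, zero_mul, add_zero, zero_add,
      sub_zero, neg_zero, pderiv_comm10, pderiv_comm20, pderiv_comm21] <;> ring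

theorem schouten_self_of_mem_one {X : Multivector} (hX : X ∈ 𝔛 1) : schouten X X = 0 := by
  obtain ⟨x1, x2, x3, x4, x5⟩ := mem_one hX
  apply mv_ext <;>
    simp only [schouten_apply, wedge_apply, contractL_apply, contractR_apply, coeffDeriv_apply,
      Pi.zero_apply, map_zero, x1, x2, x3, x4, x5, mul_zero, zero_mul, add_zero, zero_add,
      sub_zero, neg_zero] <;> ring

/-- A smooth function as a multivector field of degree `0`. -/
def ofFun (f : SmoothFun) : Multivector := Pi.single ∅ f

theorem ofFun_wedge (f : SmoothFun) (P : Multivector) : ofFun f ⋏ P = f • P := by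
  apply mv_ext <;> simp [ofFun, wedge_apply]

/-- A Poisson structure on `ℝ³`: a bivector field `π` with `[π, π] = 0`. -/
structure PoissonStructure where
  bivector : Multivector
  mem : bivector ∈ 𝔛 2
  jacobi : schouten bivector bivector = 0

theorem parity_ofFun (f : SmoothFun) : parity (ofFun f) = ofFun f := by
  apply mv_ext <;> simp [parity_apply, ofFun]

theorem ofFun_mul (f g : SmoothFun) : ofFun (f * g) = ofFun f ⋏ ofFun g := by
  rw [ofFun_wedge]; funext I; simp [ofFun, Pi.single_apply]

theorem wedge_ofFun (f : SmoothFun) (P : Multivector) : P ⋏ ofFun f = f • P := by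
  apply mv_ext <;> simp [ofFun, wedge_apply, mul_comm]

theorem ofFun_add (f g : SmoothFun) : ofFun (f + g) = ofFun f + ofFun g := Pi.single_add _ _ _

namespace PoissonStructure

/-- The algebra of Casimir functions, `{f | [π, f] = 0}`. -/
def casimir (π : PoissonStructure) : Subalgebra ℝ SmoothFun where
  carrier := {f | schouten π.bivector (ofFun f) = 0}
  mul_mem' := by
    intro f g hf hg
    change schouten _ _ = 0
    rw [ofFun_mul, schouten_wedge_of_mem_two π.mem, show schouten _ (ofFun f) = 0 from hf,
      show schouten _ (ofFun g) = 0 from hg, zero_wedge, wedge_zero, add_zero]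
  add_mem' := by
    intro f g hf hg
    change schouten _ _ = 0
    rw [ofFun_add, schouten_add, show schouten _ (ofFun f) = 0 from hf,
      show schouten _ (ofFun g) = 0 from hg, add_zero]
  algebraMap_mem' := by
    intro c
    have h : ∀ i, coeffDeriv i (ofFun (algebraMap ℝ SmoothFun c)) = 0 := fun i => by
      funext I
      by_cases hI : I = ∅ <;> simp [coeffDeriv, ofFun, hI]
    have h' : ∀ i, contractL i (ofFun (algebraMap ℝ SmoothFun c)) = 0 := fun i => by
      funext I
      simp [contractL, ofFun, Finset.insert_ne_empty]
    change schouten _ _ = 0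
    simp only [schouten, h, h', wedge_zero, sub_zero, Finset.sum_const_zero]

/-- The Poisson differential `d_π = [π, ·]`, which is linear over the Casimir functions. -/
def differential (π : PoissonStructure) : Multivector →ₗ[π.casimir] Multivector where
  toFun := schouten π.bivector
  map_add' := schouten_add _
  map_smul' := by
    intro f P
    change schouten _ ((f : SmoothFun) • P) = (f : SmoothFun) • schouten _ P
    have hf : schouten π.bivector (ofFun f) = 0 := f.2
    rw [← ofFun_wedge, schouten_wedge_of_mem_two π.mem, hf, zero_wedge, zero_add, parity_ofFun,
      ofFun_wedge]

/-- The kernel of `d_π` in degree `k`. -/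
def cocycles (π : PoissonStructure) (k : ℕ) : Submodule π.casimir Multivector :=
  (𝔛 k).restrictScalars π.casimir ⊓ LinearMap.ker π.differential

/-- The image of `d_π` in degree `k`, i.e. `d_π(𝔛^{k-1})`, which is zero for `k = 0`. -/
def coboundaries (π : PoissonStructure) : ℕ → Submodule π.casimir Multivector
  | 0 => ⊥
  | k + 1 => ((𝔛 k).restrictScalars π.casimir).map π.differential

/-- Poisson cohomology in degree `k`: cocycles modulo coboundaries (`coboundaries_le` below shows
that the coboundaries are cocycles), a module over the Casimir functions. -/
abbrev Cohomology (π : PoissonStructure) (k : ℕ) : Type :=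
  π.cocycles k ⧸ (π.coboundaries k).submoduleOf (π.cocycles k)

theorem differential_apply (π : PoissonStructure) (P : Multivector) :
    π.differential P = schouten π.bivector P := rfl

theorem mem_cocycles {π : PoissonStructure} {k : ℕ} {P : Multivector} :
    P ∈ π.cocycles k ↔ P ∈ 𝔛 k ∧ π.differential P = 0 := Iff.rfl

theorem mem_coboundaries {π : PoissonStructure} {k : ℕ} {P : Multivector} :
    P ∈ π.coboundaries k ↔ (k = 0 ∧ P = 0) ∨
      ∃ m, m + 1 = k ∧ ∃ A ∈ 𝔛 m, π.differential A = P := by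
  cases k with
  | zero => simp [coboundaries]
  | succ k => simp [coboundaries, Submodule.mem_map]

/-- `d_π ∘ d_π = 0`. -/
theorem differential_differential (π : PoissonStructure) (P : Multivector) :
    π.differential (π.differential P) = 0 := by
  have h := schouten_schouten_of_mem_two π.mem π.bivector P
  rw [π.jacobi, parity_of_mem π.mem] at h
  simp only [even_two, Even.neg_pow, one_pow, one_smul] at h
  have h0 : schouten 0 P = 0 := by simpa using smul_schouten 0 0 P
  rw [h0, zero_sub, eq_neg_iff_add_eq_zero, ← two_smul ℝ] at h
  exact (smul_eq_zero.1 h).resolve_left two_ne_zero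

theorem differential_wedge (π : PoissonStructure) (P Q : Multivector) :
    π.differential (P ⋏ Q) = π.differential P ⋏ Q + parity P ⋏ π.differential Q :=
  schouten_wedge_of_mem_two π.mem P Q

theorem differential_schouten (π : PoissonStructure) (P Q : Multivector) :
    π.differential (schouten P Q) =
      schouten (π.differential P) Q - schouten (parity P) (π.differential Q) :=
  schouten_schouten_of_mem_two π.mem P Q

theorem coboundaries_le (π : PoissonStructure) (k : ℕ) : π.coboundaries k ≤ π.cocycles k := by
  intro P hP
  rcases mem_coboundaries.1 hP with ⟨_, rfl⟩ | ⟨m, rfl, A, hA, rfl⟩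
  · exact Submodule.zero_mem _
  · have := schouten_mem π.mem hA
    rw [show 2 + m - 1 = m + 1 by omega] at this
    exact mem_cocycles.2 ⟨this, π.differential_differential A⟩

theorem wedge_mem_cocycles {π : PoissonStructure} {i j : ℕ} {P Q : Multivector}
    (hP : P ∈ π.cocycles i) (hQ : Q ∈ π.cocycles j) : P ⋏ Q ∈ π.cocycles (i + j) :=
  mem_cocycles.2 ⟨wedge_mem hP.1 hQ.1, by
    rw [differential_wedge, (mem_cocycles.1 hP).2, (mem_cocycles.1 hQ).2, zero_wedge, wedge_zero,
      add_zero]⟩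

theorem schouten_zero (P : Multivector) : schouten P 0 = 0 := by
  simpa using schouten_smul 0 P 0

theorem zero_schouten (P : Multivector) : schouten 0 P = 0 := by
  simpa using smul_schouten 0 0 P

theorem schouten_mem_cocycles {π : PoissonStructure} {i j : ℕ} {P Q : Multivector}
    (hP : P ∈ π.cocycles i) (hQ : Q ∈ π.cocycles j) :
    schouten P Q ∈ π.cocycles (i + j - 1) :=
  mem_cocycles.2 ⟨schouten_mem hP.1 hQ.1, by
    rw [differential_schouten, (mem_cocycles.1 hP).2, (mem_cocycles.1 hQ).2, schouten_zero,
      zero_schouten, sub_zero]⟩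

theorem coboundary_wedge {π : PoissonStructure} {i j : ℕ} {P Q : Multivector}
    (hP : P ∈ π.coboundaries i) (hQ : Q ∈ π.cocycles j) : P ⋏ Q ∈ π.coboundaries (i + j) := by
  rcases mem_coboundaries.1 hP with ⟨_, rfl⟩ | ⟨m, rfl, A, hA, rfl⟩
  · rw [zero_wedge]; exact Submodule.zero_mem _
  · refine mem_coboundaries.2 (.inr ⟨m + j, by omega, A ⋏ Q, wedge_mem hA hQ.1, ?_⟩)
    rw [differential_wedge, (mem_cocycles.1 hQ).2, wedge_zero, add_zero]

theorem neg_one_pow_sq (i : ℕ) : ((-1 : ℝ) ^ i) * (-1) ^ i = 1 := by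
  rw [← mul_pow]; simp

theorem wedge_coboundary {π : PoissonStructure} {i j : ℕ} {P Q : Multivector}
    (hP : P ∈ π.cocycles i) (hQ : Q ∈ π.coboundaries j) : P ⋏ Q ∈ π.coboundaries (i + j) := by
  rcases mem_coboundaries.1 hQ with ⟨_, rfl⟩ | ⟨m, rfl, A, hA, rfl⟩
  · rw [wedge_zero]; exact Submodule.zero_mem _
  · refine mem_coboundaries.2 (.inr ⟨i + m, by omega, parity P ⋏ A, ?_, ?_⟩)
    · rw [parity_of_mem hP.1, smul_wedge]
      exact ((𝔛 (i + m)).restrictScalars ℝ).smul_mem _ (wedge_mem hP.1 hA)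
    · rw [differential_wedge, parity_parity, parity_of_mem hP.1, differential_apply,
        schouten_smul, ← differential_apply, (mem_cocycles.1 hP).2, smul_zero, zero_wedge, zero_add]

theorem coboundary_schouten {π : PoissonStructure} {i j : ℕ} {P Q : Multivector}
    (hP : P ∈ π.coboundaries i) (hQ : Q ∈ π.cocycles j) :
    schouten P Q ∈ π.coboundaries (i + j - 1) := by
  rcases mem_coboundaries.1 hP with ⟨_, rfl⟩ | ⟨m, rfl, A, hA, rfl⟩
  · rw [zero_schouten]; exact Submodule.zero_mem _
  · have e : π.differential (schouten A Q) = schouten (π.differential A) Q := by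
      rw [differential_schouten, (mem_cocycles.1 hQ).2, schouten_zero, sub_zero]
    rw [← e]
    by_cases h : m + j = 0
    · obtain ⟨rfl, rfl⟩ : m = 0 ∧ j = 0 := by omega
      have : schouten A Q = 0 := by
        simp [schouten, contractL_zero _ hQ.1, contractR_zero _ hA, zero_wedge, wedge_zero]
      rw [this, map_zero]; exact Submodule.zero_mem _
    · exact mem_coboundaries.2 (.inr ⟨m + j - 1, by omega, _, schouten_mem hA hQ.1, rfl⟩)

theorem schouten_coboundary {π : PoissonStructure} {i j : ℕ} {P Q : Multivector}
    (hP : P ∈ π.cocycles i) (hQ : Q ∈ π.coboundaries j) :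
    schouten P Q ∈ π.coboundaries (i + j - 1) := by
  rcases mem_coboundaries.1 hQ with ⟨_, rfl⟩ | ⟨m, rfl, A, hA, rfl⟩
  · rw [schouten_zero]; exact Submodule.zero_mem _
  · have hP' : parity P ∈ 𝔛 i := by
      rw [parity_of_mem hP.1]
      exact ((𝔛 i).restrictScalars ℝ).smul_mem _ hP.1
    have e : π.differential (-schouten (parity P) A) = schouten P (π.differential A) := by
      rw [map_neg, differential_schouten, parity_parity, parity_of_mem hP.1, differential_apply,
        schouten_smul, ← differential_apply, (mem_cocycles.1 hP).2, smul_zero, zero_schouten,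
        zero_sub, neg_neg]
    rw [← e]
    by_cases h : i + m = 0
    · obtain ⟨rfl, rfl⟩ : i = 0 ∧ m = 0 := by omega
      have : schouten (parity P) A = 0 := by
        simp [schouten, contractL_zero _ hA, contractR_zero _ hP', zero_wedge, wedge_zero]
      rw [this, neg_zero, map_zero]; exact Submodule.zero_mem _
    · exact mem_coboundaries.2 (.inr ⟨i + m - 1, by omega, _,
        Submodule.neg_mem _ (schouten_mem hP' hA), rfl⟩)

/-- The class of a cocycle. -/
def cls (π : PoissonStructure) {k : ℕ} (P : π.cocycles k) : π.Cohomology k :=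
  Submodule.Quotient.mk P

theorem cls_eq {π : PoissonStructure} {k : ℕ} {P Q : π.cocycles k} :
    π.cls P = π.cls Q ↔ (P : Multivector) - Q ∈ π.coboundaries k :=
  Submodule.Quotient.eq _

/-- The product on Poisson cohomology induced by the wedge product. -/
def cup {π : PoissonStructure} {i j : ℕ} (a : π.Cohomology i) (b : π.Cohomology j) :
    π.Cohomology (i + j) :=
  Quotient.liftOn₂' a b (fun P Q => π.cls ⟨P ⋏ Q, wedge_mem_cocycles P.2 Q.2⟩) (by
    intro P Q P' Q' hP hQ
    rw [Submodule.quotientRel_def] at hP hQ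
    rw [cls_eq]
    have e : (P : Multivector) ⋏ Q - P' ⋏ Q' = (P - P' : Multivector) ⋏ Q + P' ⋏ (Q - Q') := by
      simp only [sub_eq_add_neg, add_wedge, wedge_add, neg_wedge, wedge_neg]; abel
    exact e ▸ Submodule.add_mem _ (coboundary_wedge hP Q.2) (wedge_coboundary P'.2 hQ))

/-- The bracket on Poisson cohomology induced by the Schouten bracket. For `i = j = 0` it is zero,
so that the truncated subtraction is harmless. -/
def bracket {π : PoissonStructure} {i j : ℕ} (a : π.Cohomology i) (b : π.Cohomology j) :
    π.Cohomology (i + j - 1) :=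
  Quotient.liftOn₂' a b (fun P Q => π.cls ⟨schouten P Q, schouten_mem_cocycles P.2 Q.2⟩) (by
    intro P Q P' Q' hP hQ
    rw [Submodule.quotientRel_def] at hP hQ
    rw [cls_eq]
    have e : schouten (P : Multivector) Q - schouten P' Q' =
        schouten (P - P' : Multivector) Q + schouten P' (Q - Q' : Multivector) := by
      simp only [sub_eq_add_neg, add_schouten, schouten_add, neg_schouten, schouten_neg]; abel
    exact e ▸ Submodule.add_mem _ (coboundary_schouten hP Q.2) (schouten_coboundary P'.2 hQ))

theorem cls_surjective (π : PoissonStructure) (k : ℕ) :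
    Function.Surjective (π.cls (k := k)) := Submodule.Quotient.mk_surjective _

/-- The first Poisson cohomology is a Lie algebra. -/
instance (π : PoissonStructure) : LieRing (π.Cohomology 1) where
  bracket a b := (bracket a b : π.Cohomology (1 + 1 - 1))
  add_lie a b c := by
    obtain ⟨X, rfl⟩ := π.cls_surjective 1 a
    obtain ⟨Y, rfl⟩ := π.cls_surjective 1 b
    obtain ⟨Z, rfl⟩ := π.cls_surjective 1 c
    exact congrArg π.cls (Subtype.ext (add_schouten X.1 Y.1 Z.1))
  lie_add a b c := by
    obtain ⟨X, rfl⟩ := π.cls_surjective 1 a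
    obtain ⟨Y, rfl⟩ := π.cls_surjective 1 b
    obtain ⟨Z, rfl⟩ := π.cls_surjective 1 c
    exact congrArg π.cls (Subtype.ext (schouten_add X.1 Y.1 Z.1))
  lie_self a := by
    obtain ⟨X, rfl⟩ := π.cls_surjective 1 a
    exact congrArg π.cls (Subtype.ext (schouten_self_of_mem_one X.2.1))
  leibniz_lie a b c := by
    obtain ⟨X, rfl⟩ := π.cls_surjective 1 a
    obtain ⟨Y, rfl⟩ := π.cls_surjective 1 b
    obtain ⟨Z, rfl⟩ := π.cls_surjective 1 c
    exact congrArg π.cls (Subtype.ext (schouten_schouten_of_mem_one X.2.1 Y.2.1 Z.2.1))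

instance (π : PoissonStructure) : LieAlgebra ℝ (π.Cohomology 1) where
  lie_smul t a b := by
    obtain ⟨X, rfl⟩ := π.cls_surjective 1 a
    obtain ⟨Y, rfl⟩ := π.cls_surjective 1 b
    exact congrArg π.cls (Subtype.ext (schouten_smul t X.1 Y.1))

/-- `P` is a cocycle whose cohomology class is `a`. -/
def Represents (π : PoissonStructure) {k : ℕ} (P : Multivector) (a : π.Cohomology k) : Prop :=
  ∃ h : P ∈ π.cocycles k, π.cls ⟨P, h⟩ = a

end PoissonStructure

namespace PoissonStructure

/-- `H^k(π)` is a free module over the Casimir functions, and the classes of the given multivector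
fields (which are cocycles) form a basis. -/
def FreeOn (π : PoissonStructure) (k : ℕ) {n : ℕ} (g : Fin n → Multivector) : Prop :=
  ∃ b : Module.Basis (Fin n) π.casimir (π.Cohomology k), ∀ i, π.Represents (g i) (b i)

/-- The algebraic structure of `H^•(π)` with respect to spaces `V k` of representatives in degree
`k`, and spaces `R k` of multivector fields of degree `k`: every element of `R k` is a cocycle with
trivial class, and for any two representatives the wedge product and the Schouten bracket are
representatives up to an element of `R`. These representatives give the product and the bracket of
the two cohomology classes. -/
def StructureDeterminedBy (π : PoissonStructure) (V R : ℕ → Submodule ℝ Multivector) : Prop :=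
  (∀ k, ∀ T ∈ R k, π.Represents T (0 : π.Cohomology k)) ∧
  ∀ (i j : ℕ) (P Q : Multivector), P ∈ V i → Q ∈ V j →
    ∃ (a : π.Cohomology i) (b : π.Cohomology j), π.Represents P a ∧ π.Represents Q b ∧
      (∃ S ∈ V (i + j), P ⋏ Q - S ∈ R (i + j) ∧ π.Represents S (cup a b)) ∧
      (∃ S ∈ V (i + j - 1), schouten P Q - S ∈ R (i + j - 1) ∧ π.Represents S (bracket a b))

end PoissonStructure

/-- The real spans of the representatives: the constants in degree `0`, the given families in the
degrees `1` and `2`, and nothing in higher degrees. -/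
def representatives {m n : ℕ} (g₁ : Fin m → Multivector) (g₂ : Fin n → Multivector) :
    ℕ → Submodule ℝ Multivector
  | 0 => Submodule.span ℝ {ofFun 1}
  | 1 => Submodule.span ℝ (Set.range g₁)
  | 2 => Submodule.span ℝ (Set.range g₂)
  | _ => ⊥

/-- The relations spanned by a set of bivector fields in degree `2`, together with all trivector
fields. -/
def relations (S : Set Multivector) : ℕ → Submodule ℝ Multivector
  | 2 => Submodule.span ℝ S
  | 3 => (𝔛 3).restrictScalars ℝ
  | _ => ⊥

/-! ### The Poisson structures `π_τ` of open book-type -/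

/-- The coordinate vector fields `∂_x`, `∂_y`, `∂_z`. -/
def partialField (i : Fin 3) : Multivector := Pi.single {i} 1

/-- The vector field `E_s = x ∂_x + s y ∂_y`. -/
def eulerField (s : ℝ) : Multivector :=
  coord 0 • partialField 0 + (s • coord 1) • partialField 1

theorem partialField_mem (i : Fin 3) : partialField i ∈ 𝔛 1 := fun I hI => by
  have : I ≠ {i} := by rintro rfl; simp at hI
  simp [partialField, this]

theorem eulerField_mem (s : ℝ) : eulerField s ∈ 𝔛 1 :=
  Submodule.add_mem _ (Submodule.smul_mem _ _ (partialField_mem 0))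
    (Submodule.smul_mem _ _ (partialField_mem 1))

theorem pderiv_coord (i j : Fin 3) : pderiv i (coord j) = if i = j then 1 else 0 := by
  refine SmoothFun.ext fun x => ?_
  change fderiv ℝ (fun x : Fin 3 → ℝ => x j) x (Pi.single i 1) = _
  have : fderiv ℝ (fun x : Fin 3 → ℝ => x j) x = ContinuousLinearMap.proj j :=
    (ContinuousLinearMap.proj (R := ℝ) (φ := fun _ : Fin 3 => ℝ) j).fderiv
  rw [this]
  by_cases h : i = j
  · subst h
    simp only [ContinuousLinearMap.proj_apply, Pi.single_eq_same, if_true]; rfl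
  · simp only [ContinuousLinearMap.proj_apply, h, if_false]
    rw [Pi.single_eq_of_ne (Ne.symm h)]; rfl

/-- The linear Poisson structure `π_τ = E_τ ∧ ∂_z`. -/
def openBook (τ : ℝ) : PoissonStructure where
  bivector := eulerField τ ⋏ partialField 2
  mem := wedge_mem (eulerField_mem τ) (partialField_mem 2)
  jacobi := by
    have e : ∀ I : Finset (Fin 3), (eulerField τ ⋏ partialField 2) I =
        if I = {0, 2} then coord 0 else if I = {1, 2} then τ • coord 1 else 0 := by
      intro I
      rcases fin3_cases I with rfl | rfl | rfl | rfl | rfl | rfl | rfl | rfl <;>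
        simp +decide [wedge_apply, eulerField, partialField]
    apply mv_ext <;>
      simp +decide [schouten_apply, wedge_apply, contractL_apply, contractR_apply,
        coeffDeriv_apply, e, pderiv_coord]

attribute [local instance 100] LieRing.ofAssociativeRing

/-- The Lie algebra `𝔞𝔣𝔣₁(ℝ)` of infinitesimal affine transformations of the line, as the matrices
`(a b; 0 0)`. -/
def aff₁ : LieSubalgebra ℝ (Matrix (Fin 2) (Fin 2) ℝ) where
  carrier := {A | A 1 0 = 0 ∧ A 1 1 = 0}
  add_mem' := by rintro A B ⟨h1, h2⟩ ⟨h3, h4⟩; simp [h1, h2, h3, h4]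
  zero_mem' := by simp
  smul_mem' := by rintro c A ⟨h1, h2⟩; simp [h1, h2]
  lie_mem' := by
    rintro A B ⟨h1, h2⟩ ⟨h3, h4⟩
    simp [Ring.lie_def, Matrix.mul_apply, Fin.sum_univ_two, h1, h2, h3, h4]

end PoissonR3

end

open PoissonR3

attribute [local instance 100] LieRing.ofAssociativeRing

/-! In components the complex is explicit (`differential_ofFun`, `differential_vectorField`,
`differential_bivectorField`): apart from multiplications by `x` and `y` and the derivative `∂_z`,
the only operators are `E_τ`, `E_τ - 1`, `E_τ - τ` and `E_τ - (1 + τ)`. The computation therefore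
rests on two tools: solving equations for `E_τ - l` on smooth functions, and dividing by the regular
sequence `x, y`.

Both come from one analytic fact. For weights `w ≥ 0` and `c > 0` the operator `∑ wᵢ xᵢ ∂ᵢ + c` is
bijective on smooth functions, with inverse `f ↦ ∫₀^∞ e^{-ct} f(φ_t v) dt` along the contracting
flow `φ_t` (`eq_zero_of_weightedEuler_add`, `exists_weightedEuler_add_eq`). A single weight with `c
= 1` gives invertibility of `f ↦ ∂ᵢ(xᵢ f)`, hence primitives, Hadamard's lemma and Koszul division.
The weights `(1, τ, 0)` give invertibility of `E_τ - l` for `l < 0`. For general `l`, Hadamard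
expansion lowers `l` by `1` or `τ` until it is negative. So on functions of `x, y` image and kernel
of `E_τ - l` together span (`exists_euler_decomposition`). Differentiation also lowers the weight,
which shows that the kernels for `l = 1` and `l = τ` consist of polynomials: besides `x` in weight
`1` and `y` in weight `τ`, there is `y^m` in weight `1` exactly when `mτ = 1`, and `x` in weight `τ`
exactly when `τ = 1`. This is the source of the three cases.

Subtracting coboundaries first removes the dependence on `z` and then the image of `E_τ - l`
(`exists_normal_form_one`, `exists_normal_form_two`). What remains is a pair of kernel elements,
plus a constant multiple of `∂_z` in degree one. The multiple of `E_τ` in the pair is exact, being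
produced by `z` or `z ∂_z`; the rest is the listed span. Independence is read off from Taylor
coefficients at the origin (`coefficients_eq_zero_of_coboundary`). In degree three every trivector
field is a coboundary (`exists_normal_form_three`).

The brackets of representatives needed for the Lie algebras close up exactly. The wedge of two
vector representatives leaves the span only by a multiple of `∂_x ∧ ∂_y` whose coefficient is
quadratic or a multiple of `y^{n+1}`; this is exact by an explicit primitive linear in `z`. -/

namespace PoissonR3

noncomputable section

section FlowIntegral

open MeasureTheory Set Filter Topology
open scoped ContDiff

/-! ### Integration along a linear contraction -/

/-- The linear flow `v ↦ (e^{-wᵢt} vᵢ)ᵢ`. -/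
def contraction (w : Fin 3 → ℝ) (t : ℝ) (v : Fin 3 → ℝ) : Fin 3 → ℝ :=
  fun i => Real.exp (-(w i * t)) * v i

/-- The vector field `∑ wᵢ xᵢ ∂ᵢ`, as a derivation. -/
def weightedEuler (w : Fin 3 → ℝ) : Derivation ℝ SmoothFun SmoothFun :=
  ∑ i, (w i • coord i) • pderiv i

theorem SmoothFun.add_eval (f g : SmoothFun) (v : Fin 3 → ℝ) : (f + g) v = f v + g v := rfl
theorem SmoothFun.smul_eval (c : ℝ) (f : SmoothFun) (v : Fin 3 → ℝ) : (c • f) v = c * f v := rfl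
theorem SmoothFun.zero_eval (v : Fin 3 → ℝ) : (0 : SmoothFun) v = 0 := rfl

theorem weightedEuler_apply (w : Fin 3 → ℝ) (f : SmoothFun) : weightedEuler w f =
    w 0 • (coord 0 * pderiv 0 f) + w 1 • (coord 1 * pderiv 1 f) +
      w 2 • (coord 2 * pderiv 2 f) := by
  simp [weightedEuler, Fin.sum_univ_three]

theorem weightedEuler_eval (w : Fin 3 → ℝ) (f : SmoothFun) (v : Fin 3 → ℝ) :
    weightedEuler w f v = ∑ i, w i * (v i * pderiv i f v) := by
  rw [weightedEuler_apply, Fin.sum_univ_three]; rfl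

theorem SmoothFun.hasFDerivAt (f : SmoothFun) (v : Fin 3 → ℝ) :
    HasFDerivAt (f : (Fin 3 → ℝ) → ℝ)
      (∑ i, pderiv i f v • ContinuousLinearMap.proj (R := ℝ) (φ := fun _ : Fin 3 => ℝ) i) v := by
  refine (f.differentiable v).hasFDerivAt.congr_fderiv (ContinuousLinearMap.ext fun u => ?_)
  conv_lhs => rw [pi_eq_sum_univ' u, map_sum]
  rw [sum_apply]
  refine Finset.sum_congr rfl fun i _ => ?_
  rw [map_smul]
  exact mul_comm (u i) (fderiv ℝ f v (Pi.single i 1))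

theorem contraction_zero (w v : Fin 3 → ℝ) : contraction w 0 v = v := by
  ext i; simp [contraction]

theorem norm_contraction_le {w : Fin 3 → ℝ} (hw : ∀ i, 0 ≤ w i) {t : ℝ} (ht : 0 ≤ t)
    (v : Fin 3 → ℝ) : ‖contraction w t v‖ ≤ ‖v‖ := by
  refine (pi_norm_le_iff_of_nonneg (norm_nonneg v)).2 fun i => ?_
  rw [contraction, norm_mul, Real.norm_of_nonneg (Real.exp_pos _).le]
  calc Real.exp (-(w i * t)) * ‖v i‖ ≤ 1 * ‖v i‖ := by
        gcongr
        exact Real.exp_le_one_iff.2 (neg_nonpos.2 (mul_nonneg (hw i) ht))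
    _ ≤ ‖v‖ := by rw [one_mul]; exact norm_le_pi_norm v i

theorem continuous_contraction (w v : Fin 3 → ℝ) : Continuous fun t => contraction w t v := by
  unfold contraction; fun_prop

theorem SmoothFun.continuous (f : SmoothFun) : Continuous (f : (Fin 3 → ℝ) → ℝ) :=
  f.contDiff.continuous

theorem SmoothFun.exists_bound (f : SmoothFun) (R : ℝ) :
    ∃ M, ∀ v : Fin 3 → ℝ, ‖v‖ ≤ R → ‖f v‖ ≤ M := by
  obtain ⟨M, hM⟩ := (isCompact_closedBall (0 : Fin 3 → ℝ) R).exists_bound_of_continuousOn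
    f.continuous.continuousOn
  exact ⟨M, fun v hv => hM v (by simpa using hv)⟩

/-- The integrand `e^{-ct} f(φ_t v)` for the contraction `φ_t`. -/
def flowIntegrand (w : Fin 3 → ℝ) (c : ℝ) (f : SmoothFun) (v : Fin 3 → ℝ) (t : ℝ) : ℝ :=
  Real.exp (-(c * t)) * f (contraction w t v)

/-- The integral `∫₀^∞ e^{-ct} f(φ_t v) dt` for the contraction `φ_t`. -/
def flowIntegral (w : Fin 3 → ℝ) (c : ℝ) (f : SmoothFun) (v : Fin 3 → ℝ) : ℝ :=
  ∫ t in Ioi (0 : ℝ), flowIntegrand w c f v t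

theorem continuous_flowIntegrand (w : Fin 3 → ℝ) (c : ℝ) (f : SmoothFun) (v : Fin 3 → ℝ) :
    Continuous (flowIntegrand w c f v) := by
  unfold flowIntegrand
  exact (by fun_prop : Continuous fun t : ℝ => Real.exp (-(c * t))).mul
    (f.continuous.comp (continuous_contraction w v))

theorem integrableOn_exp_neg_mul {c : ℝ} (hc : 0 < c) (M : ℝ) :
    IntegrableOn (fun t => Real.exp (-(c * t)) * M) (Ioi (0 : ℝ)) := by
  have := exp_neg_integrableOn_Ioi 0 hc
  simp only [neg_mul] at this
  exact this.mul_const M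

theorem norm_flowIntegrand_le {w : Fin 3 → ℝ} (hw : ∀ i, 0 ≤ w i) (c : ℝ) {f : SmoothFun}
    {R M : ℝ} (hM : ∀ v : Fin 3 → ℝ, ‖v‖ ≤ R → ‖f v‖ ≤ M) {v : Fin 3 → ℝ} (hv : ‖v‖ ≤ R) {t : ℝ}
    (ht : 0 ≤ t) : ‖flowIntegrand w c f v t‖ ≤ Real.exp (-(c * t)) * M := by
  rw [flowIntegrand, norm_mul, Real.norm_of_nonneg (Real.exp_pos _).le]
  gcongr
  exact hM _ ((norm_contraction_le hw ht v).trans hv)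

theorem integrableOn_flowIntegrand {w : Fin 3 → ℝ} (hw : ∀ i, 0 ≤ w i) {c : ℝ} (hc : 0 < c)
    (f : SmoothFun) (v : Fin 3 → ℝ) : IntegrableOn (flowIntegrand w c f v) (Ioi 0) := by
  obtain ⟨M, hM⟩ := f.exists_bound ‖v‖
  refine (integrableOn_exp_neg_mul hc M).mono'
    (continuous_flowIntegrand w c f v).aestronglyMeasurable ?_
  filter_upwards [ae_restrict_mem measurableSet_Ioi] with t ht
  exact norm_flowIntegrand_le hw c hM le_rfl (le_of_lt ht)

theorem hasFDerivAt_contraction (w : Fin 3 → ℝ) (t : ℝ) (v : Fin 3 → ℝ) :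
    HasFDerivAt (contraction w t) (ContinuousLinearMap.pi fun i =>
      Real.exp (-(w i * t)) • ContinuousLinearMap.proj (R := ℝ) (φ := fun _ : Fin 3 => ℝ) i) v :=
  (ContinuousLinearMap.pi fun i => Real.exp (-(w i * t)) •
    ContinuousLinearMap.proj (R := ℝ) (φ := fun _ : Fin 3 => ℝ) i).hasFDerivAt

theorem hasFDerivAt_flowIntegrand (w : Fin 3 → ℝ) (c : ℝ) (f : SmoothFun) (t : ℝ)
    (v : Fin 3 → ℝ) : HasFDerivAt (fun v => flowIntegrand w c f v t)
      (∑ i, flowIntegrand w (c + w i) (pderiv i f) v t •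
        ContinuousLinearMap.proj (R := ℝ) (φ := fun _ : Fin 3 => ℝ) i) v := by
  refine (((f.hasFDerivAt _).comp v (hasFDerivAt_contraction w t v)).const_mul
    (Real.exp (-(c * t)))).congr_fderiv (ContinuousLinearMap.ext fun u => ?_)
  simp only [flowIntegrand, add_mul, neg_add, Real.exp_add, sum_apply,
    smul_apply, ContinuousLinearMap.proj_apply, smul_eq_mul,
    ContinuousLinearMap.comp_apply, ContinuousLinearMap.pi_apply, Finset.mul_sum]
  exact Finset.sum_congr rfl fun i _ => by ring

/-- Differentiation under the integral. The chain rule contributes `e^{-wᵢt}` to the `i`-th partial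
derivative, so that derivative is again a flow integral, of `∂ᵢ f` and with `c` raised to `c + wᵢ`.
-/
theorem hasFDerivAt_flowIntegral {w : Fin 3 → ℝ} (hw : ∀ i, 0 ≤ w i) {c : ℝ} (hc : 0 < c)
    (f : SmoothFun) (v : Fin 3 → ℝ) : HasFDerivAt (flowIntegral w c f)
      (∑ i, flowIntegral w (c + w i) (pderiv i f) v •
        ContinuousLinearMap.proj (R := ℝ) (φ := fun _ : Fin 3 => ℝ) i) v := by
  have hc' : ∀ i, 0 < c + w i := fun i => add_pos_of_pos_of_nonneg hc (hw i)
  have key : ∑ i, flowIntegral w (c + w i) (pderiv i f) v •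
        ContinuousLinearMap.proj (R := ℝ) (φ := fun _ : Fin 3 => ℝ) i =
      ∫ t in Ioi (0 : ℝ), ∑ i, flowIntegrand w (c + w i) (pderiv i f) v t •
        ContinuousLinearMap.proj (R := ℝ) (φ := fun _ : Fin 3 => ℝ) i := by
    rw [integral_finsetSum _ fun i _ =>
      (integrableOn_flowIntegrand hw (hc' i) (pderiv i f) v).smul_const _]
    exact Finset.sum_congr rfl fun i _ => by rw [flowIntegral, integral_smul_const]
  rw [key]
  -- The flow does not increase the norm for `t ≥ 0`, so over the unit ball around `v` all arguments
  -- stay in the ball of radius `‖v‖ + 1`. A bound on the partial derivatives there gives an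
  -- integrable dominating function, without any growth condition on `f`.
  choose M hM using fun i => (pderiv i f).exists_bound (‖v‖ + 1)
  refine hasFDerivAt_integral_of_dominated_of_fderiv_le
    (bound := fun t => ∑ i, Real.exp (-((c + w i) * t)) * M i *
      ‖ContinuousLinearMap.proj (R := ℝ) (φ := fun _ : Fin 3 => ℝ) i‖)
    (Metric.ball_mem_nhds v one_pos)
    (.of_forall fun u => (continuous_flowIntegrand w c f u).aestronglyMeasurable)
    (integrableOn_flowIntegrand hw hc f v) ?_ ?_ ?_
    (.of_forall fun t u _ => hasFDerivAt_flowIntegrand w c f t u)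
  · exact (continuous_finsetSum _ fun i _ =>
      (continuous_flowIntegrand w _ _ v).smul continuous_const).aestronglyMeasurable
  · filter_upwards [ae_restrict_mem measurableSet_Ioi] with t ht u hu
    refine (norm_sum_le _ _).trans (Finset.sum_le_sum fun i _ => ?_)
    rw [norm_smul]
    gcongr
    refine norm_flowIntegrand_le hw _ (hM i) ?_ (le_of_lt ht)
    have h1 : ‖u - v‖ < 1 := by rwa [← dist_eq_norm]
    linarith [norm_le_norm_add_norm_sub' u v, norm_sub_rev u v]
  · exact integrable_finsetSum _ fun i _ => (integrableOn_exp_neg_mul (hc' i) (M i)).mul_const _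

/-- Flow integrals are closed under partial differentiation, so the order of smoothness can be
raised by induction, with `c` and `f` varying. -/
theorem contDiff_flowIntegral {w : Fin 3 → ℝ} (hw : ∀ i, 0 ≤ w i) {c : ℝ} (hc : 0 < c)
    (f : SmoothFun) : ContDiff ℝ ∞ (flowIntegral w c f) := by
  refine contDiff_infty.2 fun n => ?_
  induction n generalizing c f with
  | zero =>
    exact contDiff_zero.2 (continuous_iff_continuousAt.2 fun v =>
      (hasFDerivAt_flowIntegral hw hc f v).continuousAt)
  | succ n ih =>
    rw [show ((n + 1 : ℕ) : WithTop ℕ∞) = (n : WithTop ℕ∞) + 1 by norm_cast,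
      contDiff_succ_iff_fderiv]
    refine ⟨fun v => (hasFDerivAt_flowIntegral hw hc f v).differentiableAt, by simp, ?_⟩
    rw [funext fun v => (hasFDerivAt_flowIntegral hw hc f v).fderiv]
    exact ContDiff.sum fun i _ =>
      (ih (add_pos_of_pos_of_nonneg hc (hw i)) (pderiv i f)).smul contDiff_const

theorem hasDerivAt_flowIntegrand (w : Fin 3 → ℝ) (c : ℝ) (f : SmoothFun) (v : Fin 3 → ℝ) (t : ℝ) :
    HasDerivAt (flowIntegrand w c f v)
      (-flowIntegrand w c (weightedEuler w f + c • f) v t) t := by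
  have h1 : HasDerivAt (fun t => Real.exp (-(c * t))) (Real.exp (-(c * t)) * -c) t := by
    simpa using ((hasDerivAt_id t).const_mul c).neg.exp
  have h2 : HasDerivAt (fun t => contraction w t v)
      (fun i => Real.exp (-(w i * t)) * -(w i) * v i) t := by
    refine hasDerivAt_pi.2 fun i => ?_
    have : HasDerivAt (fun t => Real.exp (-(w i * t))) (Real.exp (-(w i * t)) * -(w i)) t := by
      simpa using ((hasDerivAt_id t).const_mul (w i)).neg.exp
    exact this.mul_const _
  refine (h1.mul ((f.hasFDerivAt _).comp_hasDerivAt t h2)).congr_deriv ?_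
  simp only [flowIntegrand, SmoothFun.add_eval, SmoothFun.smul_eval, weightedEuler_eval,
    sum_apply, smul_apply, ContinuousLinearMap.proj_apply, smul_eq_mul, contraction,
    Function.comp_apply]
  simp only [Fin.sum_univ_three]
  ring

theorem tendsto_flowIntegrand {w : Fin 3 → ℝ} (hw : ∀ i, 0 ≤ w i) {c : ℝ} (hc : 0 < c)
    (f : SmoothFun) (v : Fin 3 → ℝ) : Tendsto (flowIntegrand w c f v) atTop (𝓝 0) := by
  obtain ⟨M, hM⟩ := f.exists_bound ‖v‖
  have h : Tendsto (fun t => Real.exp (-(c * t)) * M) atTop (𝓝 0) := by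
    have := (Real.tendsto_exp_neg_atTop_nhds_zero.comp
      (tendsto_id.const_mul_atTop hc)).mul_const M
    simpa using this
  refine squeeze_zero_norm' ?_ h
  filter_upwards [eventually_ge_atTop 0] with t ht
  exact norm_flowIntegrand_le hw c hM le_rfl ht

/-- The integrand for `(E_w + c) f` is minus the `t`-derivative of `e^{-ct} f(φ_t v)`, which runs
from `f v` at `t = 0` to `0` at infinity. The flow integral is thus a left inverse of `E_w + c`. -/
theorem flowIntegral_weightedEuler_add {w : Fin 3 → ℝ} (hw : ∀ i, 0 ≤ w i) {c : ℝ} (hc : 0 < c)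
    (f : SmoothFun) (v : Fin 3 → ℝ) : flowIntegral w c (weightedEuler w f + c • f) v = f v := by
  have := integral_Ioi_of_hasDerivAt_of_tendsto (a := 0)
    (continuous_flowIntegrand w c f v).continuousWithinAt
    (fun t _ => hasDerivAt_flowIntegrand w c f v t)
    (integrableOn_flowIntegrand hw hc _ v).neg (tendsto_flowIntegrand hw hc f v)
  rw [integral_neg, zero_sub, neg_inj] at this
  rw [flowIntegral, this]
  simp [flowIntegrand, contraction_zero]

theorem eq_zero_of_weightedEuler_add {w : Fin 3 → ℝ} (hw : ∀ i, 0 ≤ w i) {c : ℝ} (hc : 0 < c)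
    {f : SmoothFun} (h : weightedEuler w f + c • f = 0) : f = 0 := by
  refine SmoothFun.ext fun v => ?_
  rw [← flowIntegral_weightedEuler_add hw hc f v, h]
  simp [flowIntegral, flowIntegrand, SmoothFun.zero_eval]

/-- The flow integral is also a right inverse: `E_w` commutes with its own flow, so `E_w + c` can be
moved under the integral, where the left-inverse identity applies. -/
theorem exists_weightedEuler_add_eq {w : Fin 3 → ℝ} (hw : ∀ i, 0 ≤ w i) {c : ℝ} (hc : 0 < c)
    (f : SmoothFun) : ∃ g, weightedEuler w g + c • g = f := by
  refine ⟨.of _ (contDiff_flowIntegral hw hc f), SmoothFun.ext fun v => ?_⟩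
  have hd : ∀ i, pderiv i (.of _ (contDiff_flowIntegral hw hc f)) v =
      flowIntegral w (c + w i) (pderiv i f) v := fun i => by
    change fderiv ℝ (flowIntegral w c f) v _ = _
    rw [(hasFDerivAt_flowIntegral hw hc f v).fderiv]
    simp [sum_apply, Pi.single_apply]
  rw [SmoothFun.add_eval, SmoothFun.smul_eval, weightedEuler_eval,
    ← flowIntegral_weightedEuler_add hw hc f v]
  have hi : ∀ i, IntegrableOn (fun t => w i * (v i * flowIntegrand w (c + w i) (pderiv i f) v t))
      (Ioi 0) := fun i => ((integrableOn_flowIntegrand hw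
        (add_pos_of_pos_of_nonneg hc (hw i)) (pderiv i f) v).const_mul _).const_mul _
  -- The `i`-th coordinate of `φ_t v` is `e^{-wᵢt} vᵢ`; its exponential is what turns `c` into `c +
  -- wᵢ`.
  have : ∀ t, flowIntegrand w c (weightedEuler w f + c • f) v t =
      ∑ i, w i * (v i * flowIntegrand w (c + w i) (pderiv i f) v t) +
        c * flowIntegrand w c f v t := fun t => by
    simp only [flowIntegrand, SmoothFun.add_eval, SmoothFun.smul_eval, weightedEuler_eval,
      Fin.sum_univ_three, contraction, add_mul, neg_add, Real.exp_add]
    ring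
  simp only [hd]
  rw [flowIntegral, integral_congr_ae (.of_forall this), integral_add
    (integrable_finsetSum _ fun i _ => hi i)
    ((integrableOn_flowIntegrand hw hc f v).const_mul _), integral_finsetSum _ fun i _ => hi i,
    integral_const_mul]
  simp only [integral_const_mul]
  rfl

end FlowIntegral

/-! ### Division by coordinates and primitives -/

theorem pderiv_coord_mul (i : Fin 3) (f : SmoothFun) :
    pderiv i (coord i * f) = coord i * pderiv i f + f := by
  simp [pderiv_coord]

theorem pderiv_coord_mul_of_ne {i j : Fin 3} (h : i ≠ j) (f : SmoothFun) :
    pderiv i (coord j * f) = coord j * pderiv i f := by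
  simp [pderiv_coord, h]

theorem weightedEuler_single (i : Fin 3) (f : SmoothFun) :
    weightedEuler (Pi.single i 1) f = coord i * pderiv i f := by
  rw [weightedEuler_apply]
  fin_cases i <;> simp

theorem single_one_nonneg (i j : Fin 3) : (0 : ℝ) ≤ (Pi.single i 1 : Fin 3 → ℝ) j := by
  by_cases h : j = i <;> simp [h]

/-- `∂ᵢ(xᵢ f) = (xᵢ ∂ᵢ + 1) f`, which is the invertible operator for the weight vector `eᵢ` and `c =
1`. -/
theorem eq_zero_of_pderiv_coord_mul {i : Fin 3} {f : SmoothFun}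
    (h : pderiv i (coord i * f) = 0) : f = 0 := by
  refine eq_zero_of_weightedEuler_add (single_one_nonneg i) one_pos ?_
  rw [weightedEuler_single, one_smul, ← pderiv_coord_mul, h]

theorem exists_pderiv_coord_mul_eq (i : Fin 3) (g : SmoothFun) :
    ∃ f, pderiv i (coord i * f) = g := by
  obtain ⟨f, hf⟩ := exists_weightedEuler_add_eq (single_one_nonneg i) one_pos g
  exact ⟨f, by rw [pderiv_coord_mul, ← hf, weightedEuler_single, one_smul]⟩

theorem eq_zero_of_coord_mul {i : Fin 3} {f : SmoothFun} (h : coord i * f = 0) : f = 0 :=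
  eq_zero_of_pderiv_coord_mul (i := i) (by rw [h, map_zero])

/-- Hadamard's lemma in one variable. -/
theorem exists_eq_add_coord_mul (i : Fin 3) (f : SmoothFun) :
    ∃ f₀ g, f = f₀ + coord i * g ∧ pderiv i f₀ = 0 ∧
      ∀ j ≠ i, pderiv j f = 0 → pderiv j g = 0 ∧ pderiv j f₀ = 0 := by
  -- The quotient `g` is chosen so that `xᵢ g` and `f` have the same `∂ᵢ`. Uniqueness of such a `g`
  -- then transfers independence of another variable from `f` to `g`.
  obtain ⟨g, hg⟩ := exists_pderiv_coord_mul_eq i (pderiv i f)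
  refine ⟨f - coord i * g, g, by ring, by rw [map_sub, hg, sub_self], fun j hj h => ?_⟩
  have : pderiv j g = 0 := eq_zero_of_pderiv_coord_mul (i := i) (by
    rw [← pderiv_coord_mul_of_ne hj, pderiv_comm, hg, pderiv_comm, h, map_zero])
  exact ⟨this, by rw [map_sub, pderiv_coord_mul_of_ne hj, this, h, mul_zero, sub_zero]⟩

/-- Hadamard's lemma in the variables `x` and `y`. -/
theorem exists_eq_add_coord_mul_add (f : SmoothFun) :
    ∃ f₀ f₁ f₂, f = f₀ + coord 0 * f₁ + coord 1 * f₂ ∧ pderiv 0 f₀ = 0 ∧ pderiv 1 f₀ = 0 ∧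
      (pderiv 2 f = 0 → pderiv 2 f₀ = 0 ∧ pderiv 2 f₁ = 0 ∧ pderiv 2 f₂ = 0) := by
  obtain ⟨h, f₁, rfl, h0, hj⟩ := exists_eq_add_coord_mul 0 f
  obtain ⟨f₀, f₂, rfl, h1, hk⟩ := exists_eq_add_coord_mul 1 h
  refine ⟨f₀, f₁, f₂, by ring, (hk 0 (by decide) h0).2, h1, fun h2 => ?_⟩
  obtain ⟨a, b⟩ := hj 2 (by decide) h2
  obtain ⟨c, d⟩ := hk 2 (by decide) b
  exact ⟨d, a, c⟩

/-- Division in the Koszul complex of the regular sequence `x, y`. -/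
theorem exists_coord_mul_of_coord_mul_eq {p q : SmoothFun}
    (h : coord 0 * q = coord 1 * p) : ∃ g, p = coord 0 * g ∧ q = coord 1 * g := by
  -- With `p = p₀ + x g` and `p₀` free of `x`, the relation becomes `x (q - y g) = y p₀`. The right
  -- side is killed by `∂_x`, which forces `q = y g`, and then `y p₀ = 0`.
  obtain ⟨p₀, g, rfl, hp, -⟩ := exists_eq_add_coord_mul 0 p
  have hq : q - coord 1 * g = 0 := eq_zero_of_pderiv_coord_mul (i := 0) (by
    rw [show coord 0 * (q - coord 1 * g) = coord 1 * p₀ by linear_combination h,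
      pderiv_coord_mul_of_ne (by decide), hp, mul_zero])
  have hp₀ : p₀ = 0 := eq_zero_of_coord_mul (i := 1) (by
    linear_combination coord 0 * hq - h)
  exact ⟨g, by rw [hp₀, zero_add], sub_eq_zero.1 hq⟩

theorem exists_eq_smul_one {f : SmoothFun} (h : ∀ i, pderiv i f = 0) :
    ∃ c : ℝ, f = c • (1 : SmoothFun) := by
  have hf : ∀ v, fderiv ℝ (f : (Fin 3 → ℝ) → ℝ) v = 0 := fun v => by
    rw [(f.hasFDerivAt v).fderiv]
    simp [h, SmoothFun.zero_eval]
  refine ⟨f 0, SmoothFun.ext fun v => ?_⟩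
  rw [is_const_of_fderiv_eq_zero f.differentiable hf v 0]
  exact (mul_one _).symm

/-! ### The operator `E_τ` on functions -/

/-- The commutator `[∂ᵢ, E_w] = wᵢ ∂ᵢ`: differentiating an eigenfunction lowers its weight by `wᵢ`.
The arguments on kernels rely on this. -/
theorem pderiv_weightedEuler (w : Fin 3 → ℝ) (i : Fin 3) (f : SmoothFun) :
    pderiv i (weightedEuler w f) = weightedEuler w (pderiv i f) + w i • pderiv i f := by
  simp only [weightedEuler_apply, map_add, Derivation.map_smul, Derivation.leibniz, smul_eq_mul,
    pderiv_coord, pderiv_comm i]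
  fin_cases i <;> simp <;> module

/-- The vector field `E_τ = x ∂_x + τ y ∂_y` as a derivation. -/
def euler (τ : ℝ) : Derivation ℝ SmoothFun SmoothFun := weightedEuler ![1, τ, 0]

theorem euler_apply (τ : ℝ) (f : SmoothFun) :
    euler τ f = coord 0 * pderiv 0 f + τ • (coord 1 * pderiv 1 f) := by
  simp [euler, weightedEuler_apply]

theorem pderiv_zero_euler (τ : ℝ) (f : SmoothFun) :
    pderiv 0 (euler τ f) = euler τ (pderiv 0 f) + pderiv 0 f := by
  simpa [euler] using pderiv_weightedEuler ![1, τ, 0] 0 f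

theorem pderiv_one_euler (τ : ℝ) (f : SmoothFun) :
    pderiv 1 (euler τ f) = euler τ (pderiv 1 f) + τ • pderiv 1 f := by
  simpa [euler] using pderiv_weightedEuler ![1, τ, 0] 1 f

theorem pderiv_two_euler (τ : ℝ) (f : SmoothFun) :
    pderiv 2 (euler τ f) = euler τ (pderiv 2 f) := by
  simpa [euler] using pderiv_weightedEuler ![1, τ, 0] 2 f

theorem euler_coord_zero (τ : ℝ) : euler τ (coord 0) = coord 0 := by
  simp [euler_apply, pderiv_coord]

theorem euler_coord_one (τ : ℝ) : euler τ (coord 1) = τ • coord 1 := by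
  simp [euler_apply, pderiv_coord]

theorem euler_coord_two (τ : ℝ) : euler τ (coord 2) = 0 := by
  simp [euler_apply, pderiv_coord]

theorem euler_eval_zero (τ : ℝ) (f : SmoothFun) : euler τ f 0 = 0 := by
  rw [euler_apply]
  change (0 : ℝ) * _ + τ * ((0 : ℝ) * _) = 0
  ring

theorem euler_weights_nonneg {τ : ℝ} (hτ : 0 < τ) (i : Fin 3) : 0 ≤ (![1, τ, 0] : Fin 3 → ℝ) i := by
  fin_cases i <;> simp [hτ.le]

/-- `E_τ - l` is the invertible operator with `c = -l > 0`: smooth functions have no negative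
weights. -/
theorem eq_zero_of_euler_eq_smul {τ : ℝ} (hτ : 0 < τ) {l : ℝ} (hl : l < 0) {f : SmoothFun}
    (h : euler τ f = l • f) : f = 0 := by
  refine eq_zero_of_weightedEuler_add (euler_weights_nonneg hτ) (neg_pos.2 hl) ?_
  rw [← euler, h, neg_smul, add_neg_cancel]

theorem exists_euler_sub_smul_eq {τ : ℝ} (hτ : 0 < τ) {l : ℝ} (hl : l < 0) {f : SmoothFun}
    (hf : pderiv 2 f = 0) : ∃ g, pderiv 2 g = 0 ∧ euler τ g - l • g = f := by
  obtain ⟨g, hg⟩ := exists_weightedEuler_add_eq (euler_weights_nonneg hτ) (neg_pos.2 hl) f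
  have hg' : euler τ g - l • g = f := by rw [← hg, neg_smul, sub_eq_add_neg, euler]
  -- `E_τ` commutes with `∂_z`, so `∂_z g` is an eigenfunction of negative weight and vanishes.
  refine ⟨g, eq_zero_of_euler_eq_smul hτ hl ?_, hg'⟩
  rw [← sub_eq_zero, ← pderiv_two_euler, ← Derivation.map_smul, ← map_sub, hg', hf]

/-- For `f` of weight `0`, the derivatives `∂_x f` and `∂_y f` have the negative weights `-1` and
`-τ`. -/
theorem pderiv_eq_zero_of_euler_eq_zero {τ : ℝ} (hτ : 0 < τ) {f : SmoothFun}
    (h : euler τ f = 0) : pderiv 0 f = 0 ∧ pderiv 1 f = 0 := by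
  constructor
  · refine eq_zero_of_euler_eq_smul hτ (l := -1) (by norm_num) ?_
    have := pderiv_zero_euler τ f
    rw [h, map_zero] at this
    rw [neg_one_smul]; exact eq_neg_of_add_eq_zero_left this.symm
  · refine eq_zero_of_euler_eq_smul hτ (l := -τ) (by linarith) ?_
    have := pderiv_one_euler τ f
    rw [h, map_zero] at this
    rw [neg_smul]; exact eq_neg_of_add_eq_zero_left this.symm

theorem exists_eq_smul_one_of_euler_eq_zero {τ : ℝ} (hτ : 0 < τ) {f : SmoothFun}
    (h : euler τ f = 0) (h2 : pderiv 2 f = 0) : ∃ c : ℝ, f = c • (1 : SmoothFun) := by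
  obtain ⟨h0, h1⟩ := pderiv_eq_zero_of_euler_eq_zero hτ h
  refine exists_eq_smul_one fun i => ?_
  fin_cases i <;> assumption

/-- Every function of `x, y` is the sum of an element of the image and one of the kernel of
`E_τ - l`. -/
theorem exists_euler_decomposition {τ : ℝ} (hτ : 0 < τ) (hτ₁ : τ ≤ 1) (l : ℝ) {f : SmoothFun}
    (hf : pderiv 2 f = 0) : ∃ r s, pderiv 2 r = 0 ∧ pderiv 2 s = 0 ∧
      f = euler τ r - l • r + s ∧ euler τ s = l • s := by
  obtain ⟨N, hN⟩ : ∃ N : ℕ, l < N * τ := by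
    obtain ⟨N, hN⟩ := exists_nat_gt (l / τ)
    exact ⟨N, (div_lt_iff₀ hτ).1 hN⟩
  -- `N` counts how many reductions by `τ` make `l` negative. Since `(E_τ - l)(x r) = x (E_τ - (l -
  -- 1)) r` and `(E_τ - l)(y r) = y (E_τ - (l - τ)) r`, the Hadamard quotients are treated with `l -
  -- 1` and `l - τ`; the bound `τ ≤ 1` puts both below `N τ`.
  induction N generalizing l f with
  | zero =>
    obtain ⟨g, hg, h⟩ := exists_euler_sub_smul_eq hτ (l := l) (by simpa using hN) hf
    exact ⟨g, 0, hg, map_zero _, by rw [h, add_zero], by rw [map_zero, smul_zero]⟩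
  | succ N ih =>
    push_cast at hN
    obtain ⟨f₀, f₁, f₂, rfl, h0, h1, h2⟩ := exists_eq_add_coord_mul_add f
    obtain ⟨k0, k1, k2⟩ := h2 hf
    obtain ⟨c, rfl⟩ := exists_eq_smul_one (f := f₀) (fun i => by fin_cases i <;> assumption)
    obtain ⟨r₁, s₁, a1, b1, rfl, e1⟩ := ih (l - 1) k1 (by linarith)
    obtain ⟨r₂, s₂, a2, b2, rfl, e2⟩ := ih (l - τ) k2 (by linarith)
    -- A constant lies in the kernel if `l = 0`; otherwise it is the image of itself divided by
    -- `-l`.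
    obtain ⟨r₀, s₀, a0, b0, hc, e0⟩ : ∃ r s, pderiv 2 r = 0 ∧ pderiv 2 s = 0 ∧
        c • (1 : SmoothFun) = euler τ r - l • r + s ∧ euler τ s = l • s := by
      by_cases hl : l = 0
      · exact ⟨0, c • 1, by simp, by simp, by simp, by simp [hl]⟩
      · exact ⟨(-(c / l)) • 1, 0, by simp, by simp, by
          simp [smul_smul, mul_div_cancel₀ _ hl], by simp⟩
    refine ⟨r₀ + coord 0 * r₁ + coord 1 * r₂, s₀ + coord 0 * s₁ + coord 1 * s₂, ?_, ?_, ?_, ?_⟩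
    · simp [pderiv_coord, a0, a1, a2]
    · simp [pderiv_coord, b0, b1, b2]
    · rw [hc]
      simp only [map_add, Derivation.leibniz, euler_coord_zero, euler_coord_one, smul_eq_mul,
        Algebra.smul_def, map_sub, map_one]
      ring
    · simp only [map_add, Derivation.leibniz, euler_coord_zero, euler_coord_one, smul_eq_mul,
        e0, e1, e2, Algebra.smul_def, map_sub, map_one]
      ring

theorem euler_eq_of_pderiv_eq {τ l : ℝ} (hl : l ≠ 0) {f : SmoothFun} (h : euler τ f = l • f) :
    f = l⁻¹ • (coord 0 * pderiv 0 f + τ • (coord 1 * pderiv 1 f)) := by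
  rw [← euler_apply, h, inv_smul_smul₀ hl]

/-- Quasi-homogeneous functions of weight less than `1` are monomials in `y`. -/
theorem eq_smul_pow_of_euler_eq_smul {τ : ℝ} (hτ : 0 < τ) {l : ℝ} (hl : l < 1) {f : SmoothFun}
    (hf : pderiv 2 f = 0) (h : euler τ f = l • f) :
    f = 0 ∨ ∃ (m : ℕ) (b : ℝ), m * τ = l ∧ f = b • coord 1 ^ m := by
  obtain ⟨N, hN⟩ : ∃ N : ℕ, l < N * τ := by
    obtain ⟨N, hN⟩ := exists_nat_gt (l / τ)
    exact ⟨N, (div_lt_iff₀ hτ).1 hN⟩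
  induction N generalizing l f with
  | zero => exact .inl (eq_zero_of_euler_eq_smul hτ (by simpa using hN) h)
  | succ N ih =>
    push_cast at hN
    by_cases hl0 : l = 0
    · subst hl0
      obtain ⟨c, rfl⟩ := exists_eq_smul_one_of_euler_eq_zero hτ (by rw [h, zero_smul]) hf
      exact .inr ⟨0, c, by simp, by simp⟩
    -- `∂_x f` has the negative weight `l - 1`, so `f` depends on `y` alone. `∂_y f` has weight `l -
    -- τ` and falls under the induction hypothesis; Euler's formula recovers `f` from its
    -- derivatives.
    have h0 : pderiv 0 f = 0 := by
      refine eq_zero_of_euler_eq_smul hτ (l := l - 1) (by linarith) ?_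
      have := pderiv_zero_euler τ f
      rw [h, Derivation.map_smul] at this
      rw [sub_smul, one_smul, this, add_sub_cancel_right]
    have h1 : euler τ (pderiv 1 f) = (l - τ) • pderiv 1 f := by
      have := pderiv_one_euler τ f
      rw [h, Derivation.map_smul] at this
      rw [sub_smul, this, add_sub_cancel_right]
    have e := euler_eq_of_pderiv_eq hl0 h
    rcases ih (by linarith) (by rw [pderiv_comm, hf, map_zero]) h1 (by linarith) with
      h1 | ⟨m, b, hm, h1⟩
    · exact .inl (by rw [e, h0, h1]; simp)
    · refine .inr ⟨m + 1, l⁻¹ * τ * b, by push_cast; linarith, ?_⟩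
      rw [e, h0, h1]
      simp only [Algebra.smul_def, map_mul]
      ring

/-- Quasi-homogeneous functions of weight `1`. -/
theorem eq_of_euler_eq_self {τ : ℝ} (hτ : 0 < τ) {f : SmoothFun}
    (hf : pderiv 2 f = 0) (h : euler τ f = f) :
    ∃ (a b : ℝ) (m : ℕ), (b = 0 ∨ m * τ = 1) ∧ f = a • coord 0 + b • coord 1 ^ m := by
  -- `∂_x f` has weight `0`, so it is a constant. `∂_y f` has weight `1 - τ < 1`, so it is a
  -- monomial in `y`. Euler's formula then assembles `f`.
  have h0 : euler τ (pderiv 0 f) = 0 := by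
    have := pderiv_zero_euler τ f
    rw [h] at this
    exact (right_eq_add).1 this
  have h1 : euler τ (pderiv 1 f) = (1 - τ) • pderiv 1 f := by
    have := pderiv_one_euler τ f
    rw [h] at this
    rw [sub_smul, one_smul, ← sub_eq_of_eq_add this]
  obtain ⟨a, ha⟩ := exists_eq_smul_one_of_euler_eq_zero hτ h0 (by rw [pderiv_comm, hf, map_zero])
  have e := euler_eq_of_pderiv_eq (τ := τ) one_ne_zero (h.trans (one_smul ℝ f).symm)
  rcases eq_smul_pow_of_euler_eq_smul hτ (by linarith)
    (by rw [pderiv_comm, hf, map_zero]) h1 with h1 | ⟨m, b, hm, h1⟩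
  · exact ⟨a, 0, 0, .inl rfl, by rw [e, ha, h1]; simp⟩
  · refine ⟨a, τ * b, m + 1, .inr (by push_cast; linarith), ?_⟩
    rw [e, ha, h1]
    simp only [Algebra.smul_def, map_mul, inv_one, map_one]
    ring

/-- Quasi-homogeneous functions of the weight of `y`, if that is less than `1`. -/
theorem eq_of_euler_eq_smul_self {τ : ℝ} (hτ : 0 < τ) (hτ₁ : τ < 1) {f : SmoothFun}
    (hf : pderiv 2 f = 0) (h : euler τ f = τ • f) : ∃ b : ℝ, f = b • coord 1 := by
  rcases eq_smul_pow_of_euler_eq_smul hτ hτ₁ hf h with rfl | ⟨m, b, hm, rfl⟩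
  · exact ⟨0, by simp⟩
  · have : m = 1 := by exact_mod_cast mul_right_cancel₀ hτ.ne' (hm.trans (one_mul τ).symm)
    exact ⟨b, by rw [this, pow_one]⟩

/-! ### The cocycle equations -/

theorem exists_pderiv_two_eq (g : SmoothFun) : ∃ f, pderiv 2 f = g :=
  let ⟨f, hf⟩ := exists_pderiv_coord_mul_eq 2 g
  ⟨coord 2 * f, hf⟩

theorem euler_coord_zero_mul (τ : ℝ) (f : SmoothFun) :
    euler τ (coord 0 * f) = coord 0 * euler τ f + coord 0 * f := by
  simp only [Derivation.leibniz, euler_coord_zero, smul_eq_mul]; ring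

theorem euler_coord_one_mul (τ : ℝ) (f : SmoothFun) :
    euler τ (coord 1 * f) = coord 1 * euler τ f + τ • (coord 1 * f) := by
  simp only [Derivation.leibniz, euler_coord_one, smul_eq_mul, Algebra.smul_def]; ring

theorem euler_coord_two_mul (τ : ℝ) (f : SmoothFun) :
    euler τ (coord 2 * f) = coord 2 * euler τ f := by
  simp only [Derivation.leibniz, euler_coord_two, smul_eq_mul]; ring

/-- The eigenvalue `0` has no Jordan block: the derivatives of `E_τ u` are `(E_τ + 1) ∂_x u` and
`(E_τ + τ) ∂_y u`, and both operators are injective. -/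
theorem euler_eq_zero_of_euler_euler {τ : ℝ} (hτ : 0 < τ) {u : SmoothFun}
    (h : euler τ (euler τ u) = 0) : euler τ u = 0 := by
  obtain ⟨h0, h1⟩ := pderiv_eq_zero_of_euler_eq_zero hτ h
  have k0 : pderiv 0 u = 0 := eq_zero_of_euler_eq_smul hτ (l := -1) (by norm_num) (by
    rw [pderiv_zero_euler] at h0
    rw [neg_one_smul]; exact eq_neg_of_add_eq_zero_left h0)
  have k1 : pderiv 1 u = 0 := eq_zero_of_euler_eq_smul hτ (l := -τ) (by linarith) (by
    rw [pderiv_one_euler] at h1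
    rw [neg_smul]; exact eq_neg_of_add_eq_zero_left h1)
  rw [euler_apply, k0, k1]; simp

theorem exists_euler_add_smul_eq {τ : ℝ} (hτ : 0 < τ) {c : ℝ} (hc : 0 < c) (f : SmoothFun) :
    ∃ g, euler τ g + c • g = f :=
  exists_weightedEuler_add_eq (euler_weights_nonneg hτ) hc f

/-- A function of `z` in the ideal `(x, y)` vanishes. -/
theorem eq_zero_of_eq_coord_mul_add {τ : ℝ} (hτ : 0 < τ) {f p q : SmoothFun}
    (h : f = coord 0 * p + coord 1 * q) (hf : euler τ f = 0) : f = 0 := by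
  -- The ideal `(x, y)` lies in the image of `E_τ`: `x (E_τ + 1) u = E_τ (x u)` and `y (E_τ + τ) v =
  -- E_τ (y v)`. A kernel element in the image vanishes by `euler_eq_zero_of_euler_euler`.
  obtain ⟨u, rfl⟩ := exists_euler_add_smul_eq hτ one_pos p
  obtain ⟨v, rfl⟩ := exists_euler_add_smul_eq hτ hτ q
  have e : f = euler τ (coord 0 * u + coord 1 * v) := by
    rw [h, map_add, euler_coord_zero_mul, euler_coord_one_mul]
    simp only [Algebra.smul_def, map_one]
    ring
  rw [e] at hf ⊢
  exact euler_eq_zero_of_euler_euler hτ hf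

theorem algebraMap_mul_inv {τ : ℝ} (hτ : τ ≠ 0) :
    algebraMap ℝ SmoothFun τ * algebraMap ℝ SmoothFun τ⁻¹ = 1 := by
  rw [← map_mul, mul_inv_cancel₀ hτ, map_one]

/-- Normal form of the solutions of the cocycle equations in degree `1`. -/
theorem exists_normal_form_one {τ : ℝ} (hτ : 0 < τ) (hτ₁ : τ ≤ 1) {a b c : SmoothFun}
    (h1 : coord 0 * pderiv 2 b = τ • (coord 1 * pderiv 2 a))
    (h2 : euler τ a - a + coord 0 * pderiv 2 c = 0)
    (h3 : euler τ b - τ • b + τ • (coord 1 * pderiv 2 c) = 0) :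
    ∃ (f s t : SmoothFun) (r : ℝ), pderiv 2 s = 0 ∧ pderiv 2 t = 0 ∧ euler τ s = s ∧
      euler τ t = τ • t ∧ a = coord 0 * pderiv 2 f + s ∧
      b = τ • (coord 1 * pderiv 2 f) + t ∧ c = -euler τ f + r • 1 := by
  have hC := algebraMap_mul_inv hτ.ne'
  rw [← mul_smul_comm] at h1
  -- Koszul division gives `τ ∂_z a = x g` and `∂_z b = y g`. With `∂_z² f = τ⁻¹ g`, subtracting the
  -- coboundary of `f` makes the first two components independent of `z`.
  obtain ⟨g, ha, hb⟩ := exists_coord_mul_of_coord_mul_eq h1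
  obtain ⟨F, hF⟩ := exists_pderiv_two_eq (τ⁻¹ • g)
  obtain ⟨f, rfl⟩ := exists_pderiv_two_eq F
  set F := pderiv 2 f
  have ha' : pderiv 2 (a - coord 0 * F) = 0 := by
    rw [map_sub, pderiv_coord_mul_of_ne (by decide), hF]
    simp only [Algebra.smul_def] at ha ⊢
    linear_combination algebraMap ℝ SmoothFun τ⁻¹ * ha - pderiv 2 a * hC
  have hb' : pderiv 2 (b - τ • (coord 1 * F)) = 0 := by
    rw [map_sub, Derivation.map_smul, pderiv_coord_mul_of_ne (by decide), hF]
    simp only [Algebra.smul_def] at hb ⊢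
    linear_combination hb - coord 1 * g * hC
  obtain ⟨h, hh⟩ : ∃ h, h = pderiv 2 (c + euler τ f) := ⟨_, rfl⟩
  have hh' : h = pderiv 2 c + euler τ F := by rw [hh, map_add, pderiv_two_euler]
  -- The second cocycle equation after this correction. Its right side does not depend on `z`, hence
  -- neither does `h`.
  have e : coord 0 * h = (a - coord 0 * F) - euler τ (a - coord 0 * F) := by
    rw [hh', map_sub, euler_coord_zero_mul]
    linear_combination h2
  have h_two : pderiv 2 h = 0 := eq_zero_of_coord_mul (i := 0) (by
    rw [← pderiv_coord_mul_of_ne (by decide), e, map_sub, pderiv_two_euler, ha', map_zero,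
      sub_zero])
  -- Up to a constant `d`, `h` is `E_τ k` with `k` independent of `z`; this part is removed by the
  -- correction `z k` to the potential `f`.
  obtain ⟨k, s₀, hk, hs₀, hks, es₀⟩ := exists_euler_decomposition hτ hτ₁ 0 h_two
  obtain ⟨d, rfl⟩ := exists_eq_smul_one_of_euler_eq_zero hτ (by rw [es₀, zero_smul]) hs₀
  rw [zero_smul, sub_zero] at hks
  set s := a - coord 0 * (F - k) with hs
  have es : euler τ s = s - d • coord 0 := by
    have : s = a - coord 0 * F + coord 0 * k := by rw [hs]; ring
    rw [this, map_add, euler_coord_zero_mul]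
    rw [hks] at e
    simp only [Algebra.smul_def] at e ⊢
    linear_combination e
  -- The resonant term `d x` cannot occur: applying `∂_x` to `E_τ s = s - d x` leaves `E_τ (∂_x s) =
  -- -d`, and the left side vanishes at the origin.
  have hd : d = 0 := by
    have e0 := pderiv_zero_euler τ s
    rw [es, map_sub, Derivation.map_smul, pderiv_coord, if_pos rfl] at e0
    have e1 : euler τ (pderiv 0 s) = (-d) • (1 : SmoothFun) := by
      rw [neg_smul]
      linear_combination (exp := 1) -e0
    have e2 := euler_eval_zero τ (pderiv 0 s)
    rw [e1] at e2
    have e3 : -d * 1 = 0 := e2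
    linarith
  subst hd
  rw [zero_smul, sub_zero] at es
  rw [zero_smul, add_zero] at hks
  have hc : pderiv 2 (c + euler τ f - coord 2 * euler τ k) = 0 := by
    rw [map_sub, ← hh, pderiv_coord_mul, pderiv_two_euler, hk, hks]; simp
  -- What is left of the third component is independent of `z`, so it is `E_τ m` plus the constant
  -- `r`. The final potential is `f - z k - m`.
  obtain ⟨m, s₁, hm, hs₁, hms, es₁⟩ := exists_euler_decomposition hτ hτ₁ 0 hc
  obtain ⟨r, rfl⟩ := exists_eq_smul_one_of_euler_eq_zero hτ (by rw [es₁, zero_smul]) hs₁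
  have hf : pderiv 2 (f - coord 2 * k - m) = F - k := by
    rw [map_sub, map_sub, pderiv_coord_mul, hk, hm]; ring
  refine ⟨f - coord 2 * k - m, s, b - τ • (coord 1 * (F - k)), r, ?_, ?_, es, ?_, ?_, ?_, ?_⟩
  · rw [show s = a - coord 0 * F + coord 0 * k by rw [hs]; ring, map_add, ha',
      pderiv_coord_mul_of_ne (by decide), hk, mul_zero, add_zero]
  · rw [show b - τ • (coord 1 * (F - k)) = b - τ • (coord 1 * F) + τ • (coord 1 * k) by
      rw [mul_sub, smul_sub]; abel, map_add, hb', Derivation.map_smul,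
      pderiv_coord_mul_of_ne (by decide), hk, mul_zero, smul_zero, add_zero]
  · rw [map_sub, Derivation.map_smul, euler_coord_one_mul, map_sub]
    rw [hh'] at hks
    simp only [Algebra.smul_def] at h3 ⊢
    linear_combination h3 - algebraMap ℝ SmoothFun τ * coord 1 * hks
  · rw [hf, hs]; ring
  · rw [hf]; abel
  · rw [map_sub, map_sub, euler_coord_two_mul]
    rw [zero_smul, sub_zero] at hms
    linear_combination (exp := 1) hms

/-- Normal form of the solutions of the cocycle equation in degree `2`. -/
theorem exists_normal_form_two {τ : ℝ} (hτ : 0 < τ) (hτ₁ : τ ≤ 1) {W p q : SmoothFun}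
    (h : coord 0 * pderiv 2 q - τ • (coord 1 * pderiv 2 p) = euler τ W - W - τ • W) :
    ∃ a b c s t : SmoothFun, pderiv 2 s = 0 ∧ pderiv 2 t = 0 ∧ euler τ s = s ∧
      euler τ t = τ • t ∧ W = coord 0 * pderiv 2 b - τ • (coord 1 * pderiv 2 a) ∧
      p = euler τ a - a + coord 0 * pderiv 2 c + s ∧
      q = euler τ b - τ • b + τ • (coord 1 * pderiv 2 c) + t := by
  have hC := algebraMap_mul_inv hτ.ne'
  obtain ⟨W₀, w₁, w₂, rfl, k0, k1, -⟩ := exists_eq_add_coord_mul_add W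
  have eW₀ : euler τ W₀ = 0 := by rw [euler_apply, k0, k1]; simp
  -- Modulo `(x, y)` the cocycle equation reads `(1 + τ) W₀ = 0`; the witnesses are the Hadamard
  -- quotients of the remaining terms.
  have hW₀ : W₀ + τ • W₀ = 0 := by
    refine eq_zero_of_eq_coord_mul_add hτ (p := euler τ w₁ - τ • w₁ - pderiv 2 q)
      (q := euler τ w₂ - w₂ + τ • pderiv 2 p) ?_ ?_
    · rw [map_add, map_add, euler_coord_zero_mul, euler_coord_one_mul, eW₀] at h
      simp only [Algebra.smul_def] at h ⊢
      linear_combination h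
    · rw [map_add, Derivation.map_smul, eW₀, smul_zero, add_zero]
  have hW₀' : W₀ = 0 := by
    have : (1 + τ) • W₀ = 0 := by rw [add_smul, one_smul, hW₀]
    exact (smul_eq_zero.1 this).resolve_left (by linarith)
  subst hW₀'
  -- Primitives in `z` are chosen so that `a ∂_x + b ∂_y` produces the whole `∂_x ∧ ∂_y` component.
  -- Afterwards Koszul division supplies `c`, as in degree one.
  obtain ⟨b, hb⟩ := exists_pderiv_two_eq w₁
  obtain ⟨a, ha⟩ := exists_pderiv_two_eq ((-τ⁻¹) • w₂)
  have ha' : w₂ = -(τ • pderiv 2 a) := by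
    rw [ha, smul_smul, mul_neg, mul_inv_cancel₀ hτ.ne', neg_one_smul, neg_neg]
  set p' := p - (euler τ a - a) with hp'
  set q' := q - (euler τ b - τ • b) with hq'
  have h' : coord 0 * pderiv 2 q' = coord 1 * (τ • pderiv 2 p') := by
    rw [hp', hq']
    simp only [map_sub, Derivation.map_smul, pderiv_two_euler]
    rw [map_add, map_add, euler_coord_zero_mul, euler_coord_one_mul, eW₀, ← hb, ha', map_neg,
      Derivation.map_smul] at h
    simp only [Algebra.smul_def] at h ⊢
    linear_combination h
  obtain ⟨g, hp, hq⟩ := exists_coord_mul_of_coord_mul_eq h'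
  obtain ⟨F, hF⟩ := exists_pderiv_two_eq (τ⁻¹ • g)
  obtain ⟨c, rfl⟩ := exists_pderiv_two_eq F
  have h4 : pderiv 2 (p' - coord 0 * pderiv 2 c) = 0 := by
    rw [map_sub, pderiv_coord_mul_of_ne (by decide), hF]
    simp only [Algebra.smul_def] at hp ⊢
    linear_combination algebraMap ℝ SmoothFun τ⁻¹ * hp - pderiv 2 p' * hC
  have h5 : pderiv 2 (q' - τ • (coord 1 * pderiv 2 c)) = 0 := by
    rw [map_sub, Derivation.map_smul, pderiv_coord_mul_of_ne (by decide), hF]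
    simp only [Algebra.smul_def] at hq ⊢
    linear_combination hq - coord 1 * g * hC
  -- The image parts `r₁` and `r₂` are absorbed into `a` and `b`. Being independent of `z`, they
  -- leave the `∂_x ∧ ∂_y` component unchanged.
  obtain ⟨r₁, s, a1, b1, e1, es⟩ := exists_euler_decomposition hτ hτ₁ 1 h4
  obtain ⟨r₂, t, a2, b2, e2, et⟩ := exists_euler_decomposition hτ hτ₁ τ h5
  rw [one_smul] at es e1
  refine ⟨a + r₁, b + r₂, c, s, t, b1, b2, es, et, ?_, ?_, ?_⟩
  · rw [map_add, map_add, a1, a2, add_zero, add_zero, hb, ha']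
    simp only [Algebra.smul_def]
    ring
  · rw [map_add]
    linear_combination (exp := 1) e1
  · rw [map_add, smul_add]
    linear_combination (exp := 1) e2

/-- In `t = t₀(z) + x t₁ + y t₂`, the last two terms are hit by taking `z`-primitives. The first is
hit because `E_τ - (1 + τ)` acts on functions of `z` as the nonzero scalar `-(1 + τ)`. -/
theorem exists_normal_form_three {τ : ℝ} (hτ : 0 < τ) (t : SmoothFun) :
    ∃ W p q : SmoothFun, coord 0 * pderiv 2 q - τ • (coord 1 * pderiv 2 p) -
      (euler τ W - W - τ • W) = t := by
  have hC := algebraMap_mul_inv hτ.ne'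
  obtain ⟨t₀, t₁, t₂, rfl, k0, k1, -⟩ := exists_eq_add_coord_mul_add t
  obtain ⟨q, hq⟩ := exists_pderiv_two_eq t₁
  obtain ⟨p, hp⟩ := exists_pderiv_two_eq ((-τ⁻¹) • t₂)
  refine ⟨(1 + τ)⁻¹ • t₀, p, q, ?_⟩
  have e : (1 + τ)⁻¹ • t₀ + τ • (1 + τ)⁻¹ • t₀ = t₀ := by
    rw [smul_smul, ← add_smul, show (1 + τ)⁻¹ + τ * (1 + τ)⁻¹ = 1 by
      have : 1 + τ ≠ 0 := by linarith
      field_simp, one_smul]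
  rw [Derivation.map_smul, euler_apply, k0, k1, hq, hp]
  simp only [Algebra.smul_def, map_neg] at e ⊢
  linear_combination e + coord 1 * t₂ * hC

/-! ### The differential of `π_τ` in components -/

/-- The vector field `a ∂_x + b ∂_y + c ∂_z`. -/
def vectorField (a b c : SmoothFun) : Multivector := fun I =>
  if I = {0} then a else if I = {1} then b else if I = {2} then c else 0

/-- The bivector field `w ∂_x ∧ ∂_y + p ∂_x ∧ ∂_z + q ∂_y ∧ ∂_z`. -/
def bivectorField (w p q : SmoothFun) : Multivector := fun I =>
  if I = {0, 1} then w else if I = {0, 2} then p else if I = {1, 2} then q else 0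

/-- The trivector field `t ∂_x ∧ ∂_y ∧ ∂_z`. -/
def trivectorField (t : SmoothFun) : Multivector := fun I => if I = {0, 1, 2} then t else 0

theorem vectorField_mem (a b c : SmoothFun) : vectorField a b c ∈ multivectorFields 1 := by
  intro I
  rcases fin3_cases I with rfl | rfl | rfl | rfl | rfl | rfl | rfl | rfl <;>
    simp +decide [vectorField]

theorem bivectorField_mem (w p q : SmoothFun) : bivectorField w p q ∈ multivectorFields 2 := by
  intro I
  rcases fin3_cases I with rfl | rfl | rfl | rfl | rfl | rfl | rfl | rfl <;>
    simp +decide [bivectorField]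

theorem ofFun_mem (f : SmoothFun) : ofFun f ∈ multivectorFields 0 := by
  intro I
  rcases fin3_cases I with rfl | rfl | rfl | rfl | rfl | rfl | rfl | rfl <;>
    simp +decide [ofFun]

theorem eq_ofFun_of_mem {P : Multivector} (h : P ∈ multivectorFields 0) : P = ofFun (P ∅) := by
  apply mv_ext <;> first | exact h _ (by decide) | simp [ofFun]

theorem eq_vectorField_of_mem {P : Multivector} (h : P ∈ multivectorFields 1) :
    P = vectorField (P {0}) (P {1}) (P {2}) := by
  apply mv_ext <;> first | exact h _ (by decide) | simp +decide [vectorField]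

theorem eq_bivectorField_of_mem {P : Multivector} (h : P ∈ multivectorFields 2) :
    P = bivectorField (P {0, 1}) (P {0, 2}) (P {1, 2}) := by
  apply mv_ext <;> first | exact h _ (by decide) | simp +decide [bivectorField]

theorem eq_trivectorField_of_mem {P : Multivector} (h : P ∈ multivectorFields 3) :
    P = trivectorField (P {0, 1, 2}) := by
  apply mv_ext <;> first | exact h _ (by decide) | simp +decide [trivectorField]

theorem eq_zero_of_mem {k : ℕ} (hk : 3 < k) {P : Multivector} (h : P ∈ multivectorFields k) :
    P = 0 :=
  funext fun I => h I ((I.card_le_univ.trans_lt (by simpa using hk)).ne)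

theorem vectorField_inj {a b c a' b' c' : SmoothFun} :
    vectorField a b c = vectorField a' b' c' ↔ a = a' ∧ b = b' ∧ c = c' := by
  refine ⟨fun h => ⟨?_, ?_, ?_⟩, by rintro ⟨rfl, rfl, rfl⟩; rfl⟩
  · simpa +decide [vectorField] using congrFun h {0}
  · simpa +decide [vectorField] using congrFun h {1}
  · simpa +decide [vectorField] using congrFun h {2}

theorem bivectorField_inj {a b c a' b' c' : SmoothFun} :
    bivectorField a b c = bivectorField a' b' c' ↔ a = a' ∧ b = b' ∧ c = c' := by
  refine ⟨fun h => ⟨?_, ?_, ?_⟩, by rintro ⟨rfl, rfl, rfl⟩; rfl⟩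
  · simpa +decide [bivectorField] using congrFun h {0, 1}
  · simpa +decide [bivectorField] using congrFun h {0, 2}
  · simpa +decide [bivectorField] using congrFun h {1, 2}

theorem trivectorField_inj {t t' : SmoothFun} :
    trivectorField t = trivectorField t' ↔ t = t' :=
  ⟨fun h => by simpa +decide [trivectorField] using congrFun h {0, 1, 2}, by rintro rfl; rfl⟩

theorem vectorField_zero : vectorField 0 0 0 = 0 := by
  funext I; simp [vectorField]

theorem bivectorField_zero : bivectorField 0 0 0 = 0 := by
  funext I; simp [bivectorField]

theorem trivectorField_zero : trivectorField 0 = 0 := by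
  funext I; simp [trivectorField]

theorem vectorField_sub (a b c a' b' c' : SmoothFun) :
    vectorField a b c - vectorField a' b' c' = vectorField (a - a') (b - b') (c - c') := by
  apply mv_ext <;> simp +decide [vectorField]

theorem bivectorField_sub (a b c a' b' c' : SmoothFun) :
    bivectorField a b c - bivectorField a' b' c' = bivectorField (a - a') (b - b') (c - c') := by
  apply mv_ext <;> simp +decide [bivectorField]

theorem openBook_apply (τ : ℝ) (I : Finset (Fin 3)) : (openBook τ).bivector I =
    if I = {0, 2} then coord 0 else if I = {1, 2} then τ • coord 1 else 0 := by
  change (eulerField τ ⋏ partialField 2) I = _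
  rcases fin3_cases I with rfl | rfl | rfl | rfl | rfl | rfl | rfl | rfl <;>
    simp +decide [wedge_apply, eulerField, partialField]

theorem differential_ofFun (τ : ℝ) (f : SmoothFun) : (openBook τ).differential (ofFun f) =
    vectorField (coord 0 * pderiv 2 f) (τ • (coord 1 * pderiv 2 f)) (-euler τ f) := by
  rw [PoissonStructure.differential_apply]
  apply mv_ext <;> simp +decide [schouten_apply, wedge_apply, contractL_apply, contractR_apply,
    coeffDeriv_apply, openBook_apply, pderiv_coord, ofFun, vectorField, euler_apply]
  ring

theorem differential_vectorField (τ : ℝ) (a b c : SmoothFun) :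
    (openBook τ).differential (vectorField a b c) =
      bivectorField (coord 0 * pderiv 2 b - τ • (coord 1 * pderiv 2 a))
        (euler τ a - a + coord 0 * pderiv 2 c)
        (euler τ b - τ • b + τ • (coord 1 * pderiv 2 c)) := by
  rw [PoissonStructure.differential_apply]
  apply mv_ext <;> simp +decide [schouten_apply, wedge_apply, contractL_apply, contractR_apply,
    coeffDeriv_apply, openBook_apply, pderiv_coord, bivectorField, vectorField, euler_apply] <;>
  ring

theorem differential_bivectorField (τ : ℝ) (w p q : SmoothFun) :
    (openBook τ).differential (bivectorField w p q) =
      trivectorField (coord 0 * pderiv 2 q - τ • (coord 1 * pderiv 2 p) -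
        (euler τ w - w - τ • w)) := by
  rw [PoissonStructure.differential_apply]
  apply mv_ext <;> simp +decide [schouten_apply, wedge_apply, contractL_apply, contractR_apply,
    coeffDeriv_apply, openBook_apply, pderiv_coord, bivectorField, trivectorField,
    euler_apply]
  ring

theorem mem_coboundaries_one {τ : ℝ} {P : Multivector} : P ∈ (openBook τ).coboundaries 1 ↔
    ∃ f, P = vectorField (coord 0 * pderiv 2 f) (τ • (coord 1 * pderiv 2 f)) (-euler τ f) := by
  constructor
  · rintro ⟨A, hA, rfl⟩
    exact ⟨A ∅, by rw [eq_ofFun_of_mem hA, differential_ofFun]; simp [ofFun]⟩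
  · rintro ⟨f, rfl⟩
    exact ⟨ofFun f, ofFun_mem f, differential_ofFun τ f⟩

theorem mem_coboundaries_two {τ : ℝ} {P : Multivector} : P ∈ (openBook τ).coboundaries 2 ↔
    ∃ a b c, P = bivectorField (coord 0 * pderiv 2 b - τ • (coord 1 * pderiv 2 a))
        (euler τ a - a + coord 0 * pderiv 2 c)
        (euler τ b - τ • b + τ • (coord 1 * pderiv 2 c)) := by
  constructor
  · rintro ⟨A, hA, rfl⟩
    exact ⟨A {0}, A {1}, A {2}, by rw [← differential_vectorField, ← eq_vectorField_of_mem hA]⟩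
  · rintro ⟨a, b, c, rfl⟩
    exact ⟨vectorField a b c, vectorField_mem a b c, differential_vectorField τ a b c⟩

theorem vectorField_mem_cocycles {τ : ℝ} {a b c : SmoothFun} :
    vectorField a b c ∈ (openBook τ).cocycles 1 ↔
      coord 0 * pderiv 2 b = τ • (coord 1 * pderiv 2 a) ∧
      euler τ a - a + coord 0 * pderiv 2 c = 0 ∧
      euler τ b - τ • b + τ • (coord 1 * pderiv 2 c) = 0 := by
  rw [PoissonStructure.mem_cocycles, differential_vectorField, ← bivectorField_zero,
    bivectorField_inj, sub_eq_zero]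
  exact and_iff_right (vectorField_mem a b c)

theorem bivectorField_mem_cocycles {τ : ℝ} {w p q : SmoothFun} :
    bivectorField w p q ∈ (openBook τ).cocycles 2 ↔
      coord 0 * pderiv 2 q - τ • (coord 1 * pderiv 2 p) = euler τ w - w - τ • w := by
  rw [PoissonStructure.mem_cocycles, differential_bivectorField, ← trivectorField_zero,
    trivectorField_inj, sub_eq_zero]
  exact and_iff_right (bivectorField_mem w p q)

/-- The first component of the differential forces `∂_z f = 0`, the last one `E_τ f = 0`; a function
of `x, y` of weight zero is constant. -/
theorem casimir_openBook {τ : ℝ} (hτ : 0 < τ) : (openBook τ).casimir = ⊥ := by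
  refine eq_bot_iff.2 fun f hf => ?_
  have h : (openBook τ).differential (ofFun f) = 0 := hf
  rw [differential_ofFun, ← vectorField_zero, vectorField_inj] at h
  obtain ⟨c, rfl⟩ := exists_eq_smul_one_of_euler_eq_zero hτ (neg_eq_zero.1 h.2.2)
    (eq_zero_of_coord_mul h.1)
  rw [← Algebra.algebraMap_eq_smul_one]
  exact Subalgebra.algebraMap_mem _ c

theorem mem_coboundaries_three {τ : ℝ} (hτ : 0 < τ) {P : Multivector}
    (hP : P ∈ multivectorFields 3) : P ∈ (openBook τ).coboundaries 3 := by
  obtain ⟨W, p, q, h⟩ := exists_normal_form_three hτ (P {0, 1, 2})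
  exact ⟨bivectorField W p q, bivectorField_mem W p q, by
    rw [differential_bivectorField, h, ← eq_trivectorField_of_mem hP]⟩

/-! ### From real spans of cocycles to cohomology. -/

namespace PoissonStructure

theorem represents_zero_iff {π : PoissonStructure} {k : ℕ} {P : Multivector} :
    π.Represents P (0 : π.Cohomology k) ↔ P ∈ π.coboundaries k := by
  constructor
  · rintro ⟨h, e⟩
    exact (Submodule.Quotient.mk_eq_zero ((π.coboundaries k).submoduleOf (π.cocycles k))).1 e
  · intro h
    exact ⟨π.coboundaries_le k h, (Submodule.Quotient.mk_eq_zero _).2 h⟩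

theorem casimir_smul_eq {π : PoissonStructure} (hπ : π.casimir = ⊥) (f : π.casimir) :
    ∃ r : ℝ, algebraMap ℝ π.casimir r = f := by
  have : (f : SmoothFun) ∈ (⊥ : Subalgebra ℝ SmoothFun) := hπ ▸ f.2
  obtain ⟨r, hr⟩ := Algebra.mem_bot.1 this
  exact ⟨r, Subtype.ext hr⟩

/-- The class of a linear combination of cocycles. -/
def classMap (π : PoissonStructure) {k n : ℕ} {g : Fin n → Multivector}
    (hg : ∀ i, g i ∈ π.cocycles k) : (Fin n → ℝ) →ₗ[ℝ] π.Cohomology k :=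
  Fintype.linearCombination ℝ fun i => π.cls ⟨g i, hg i⟩

theorem sum_smul_mem_cocycles {π : PoissonStructure} {k n : ℕ} {g : Fin n → Multivector}
    (hg : ∀ i, g i ∈ π.cocycles k) (c : Fin n → ℝ) : ∑ i, c i • g i ∈ π.cocycles k :=
  Submodule.sum_mem _ fun i _ => Submodule.smul_of_tower_mem _ (c i) (hg i)

theorem classMap_apply (π : PoissonStructure) {k n : ℕ} {g : Fin n → Multivector}
    (hg : ∀ i, g i ∈ π.cocycles k) (c : Fin n → ℝ) :
    π.classMap hg c = π.cls ⟨∑ i, c i • g i, sum_smul_mem_cocycles hg c⟩ := by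
  rw [classMap, Fintype.linearCombination_apply]
  let T : π.cocycles k →ₗ[ℝ] π.Cohomology k := (Submodule.mkQ _).restrictScalars ℝ
  change ∑ i, c i • T ⟨g i, hg i⟩ = T _
  simp only [← map_smul, ← map_sum]
  congr 1
  ext1
  simp

theorem classMap_bijective (π : PoissonStructure) {k n : ℕ} {g : Fin n → Multivector}
    (hg : ∀ i, g i ∈ π.cocycles k)
    (hspan : ∀ P ∈ π.cocycles k, ∃ c : Fin n → ℝ, P - ∑ i, c i • g i ∈ π.coboundaries k)
    (hind : ∀ c : Fin n → ℝ, ∑ i, c i • g i ∈ π.coboundaries k → c = 0) :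
    Function.Bijective (π.classMap hg) := by
  constructor
  · refine (injective_iff_map_eq_zero _).2 fun c hc => hind c ?_
    rw [classMap_apply] at hc
    exact represents_zero_iff.1 ⟨_, hc⟩
  · intro a
    obtain ⟨⟨P, hP⟩, rfl⟩ := π.cls_surjective k a
    obtain ⟨c, hc⟩ := hspan P hP
    exact ⟨c, by rw [classMap_apply]; exact (cls_eq.2 hc).symm⟩

/-- When all Casimir functions are constants, a real basis of the cohomology is a basis over the
Casimir functions. -/
theorem freeOn_of_bijective {π : PoissonStructure} (hπ : π.casimir = ⊥) {k n : ℕ}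
    {g : Fin n → Multivector} (hg : ∀ i, g i ∈ π.cocycles k)
    (h : Function.Bijective (π.classMap hg)) : π.FreeOn k g := by
  have hs : ∀ c : Fin n → ℝ, π.classMap hg c =
      ∑ i, algebraMap ℝ π.casimir (c i) • π.cls ⟨g i, hg i⟩ := fun c => by
    simp only [classMap, Fintype.linearCombination_apply, algebraMap_smul]
  refine ⟨Module.Basis.mk (v := fun i => π.cls ⟨g i, hg i⟩) ?_ ?_,
    fun i => ⟨hg i, by rw [Module.Basis.mk_apply]⟩⟩
  · refine Fintype.linearIndependent_iff.2 fun c hc => ?_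
    choose r hr using fun i => casimir_smul_eq hπ (c i)
    simp only [← hr, ← hs] at hc
    intro i
    rw [← hr, (injective_iff_map_eq_zero _).1 h.1 r hc, Pi.zero_apply, map_zero]
  · intro a _
    obtain ⟨c, rfl⟩ := h.2 a
    rw [hs]
    exact Submodule.sum_mem _ fun i _ => Submodule.smul_mem _ _ (Submodule.subset_span ⟨i, rfl⟩)

/-- A criterion for `StructureDeterminedBy` on the level of multivector fields. -/
theorem structureDeterminedBy_of_mem_sup {π : PoissonStructure}
    {V R : ℕ → Submodule ℝ Multivector} (hV : ∀ k, ∀ P ∈ V k, P ∈ π.cocycles k)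
    (hR : ∀ k, ∀ T ∈ R k, T ∈ π.coboundaries k)
    (hw : ∀ i j, ∀ P ∈ V i, ∀ Q ∈ V j, P ⋏ Q ∈ V (i + j) ⊔ R (i + j))
    (hs : ∀ i j, ∀ P ∈ V i, ∀ Q ∈ V j, schouten P Q ∈ V (i + j - 1) ⊔ R (i + j - 1)) :
    π.StructureDeterminedBy V R := by
  refine ⟨fun k T hT => represents_zero_iff.2 (hR k T hT), fun i j P Q hP hQ =>
    ⟨π.cls ⟨P, hV i P hP⟩, π.cls ⟨Q, hV j Q hQ⟩, ⟨_, rfl⟩, ⟨_, rfl⟩, ?_, ?_⟩⟩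
  · obtain ⟨S, hS, T, hT, e⟩ := Submodule.mem_sup.1 (hw i j P hP Q hQ)
    refine ⟨S, hS, by rw [← e, add_sub_cancel_left]; exact hT, hV _ S hS, cls_eq.2 ?_⟩
    change S - P ⋏ Q ∈ _
    rw [← e, sub_add_cancel_left]
    exact Submodule.neg_mem _ (hR _ T hT)
  · obtain ⟨S, hS, T, hT, e⟩ := Submodule.mem_sup.1 (hs i j P hP Q hQ)
    refine ⟨S, hS, by rw [← e, add_sub_cancel_left]; exact hT, hV _ S hS, cls_eq.2 ?_⟩
    change S - schouten P Q ∈ _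
    rw [← e, sub_add_cancel_left]
    exact Submodule.neg_mem _ (hR _ T hT)

end PoissonStructure

theorem subsingleton_cohomology_three {τ : ℝ} (hτ : 0 < τ) :
    Subsingleton ((openBook τ).Cohomology 3) := by
  refine subsingleton_of_forall_eq 0 fun a => ?_
  obtain ⟨⟨P, hP⟩, rfl⟩ := (openBook τ).cls_surjective 3 a
  exact (PoissonStructure.represents_zero_iff.2 (mem_coboundaries_three hτ hP.1)).2

/-! ### Representatives of the cohomology classes -/

/-- The vector field `u E_{-1} + b y^m ∂_x + g x ∂_y + r ∂_z`. -/
def representativeOne (m : ℕ) (u b g r : ℝ) : Multivector :=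
  vectorField (u • coord 0 + b • coord 1 ^ m) (g • coord 0 - u • coord 1) (r • 1)

/-- The bivector field `(u E_{-1} + b y^m ∂_x + g x ∂_y) ∧ ∂_z`. -/
def representativeTwo (m : ℕ) (u b g : ℝ) : Multivector :=
  bivectorField 0 (u • coord 0 + b • coord 1 ^ m) (g • coord 0 - u • coord 1)

theorem pderiv_one_pow (m : ℕ) : coord 1 * pderiv 1 (coord 1 ^ m) = m • coord 1 ^ m := by
  cases m with
  | zero => simp
  | succ m => simp [Derivation.leibniz_pow, pderiv_coord]; ring

theorem pderiv_pow_of_ne {i j : Fin 3} (h : i ≠ j) (m : ℕ) : pderiv i (coord j ^ m) = 0 := by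
  simp [Derivation.leibniz_pow, pderiv_coord, h]

theorem euler_pow {τ : ℝ} (m : ℕ) : euler τ (coord 1 ^ m) = (m * τ) • coord 1 ^ m := by
  rw [euler_apply, pderiv_one_pow, pderiv_pow_of_ne (by decide), mul_zero, zero_add,
    ← Nat.cast_smul_eq_nsmul ℝ, smul_smul, mul_comm]

theorem euler_smul_add {τ u b : ℝ} {m : ℕ} (h : b = 0 ∨ m * τ = 1) :
    euler τ (u • coord 0 + b • coord 1 ^ m) = u • coord 0 + b • coord 1 ^ m := by
  rw [map_add, Derivation.map_smul, Derivation.map_smul, euler_coord_zero, euler_pow]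
  rcases h with rfl | h
  · simp
  · rw [h, one_smul]

theorem euler_smul_sub {τ u g : ℝ} (h : g = 0 ∨ τ = 1) :
    euler τ (g • coord 0 - u • coord 1) = τ • (g • coord 0 - u • coord 1) := by
  rw [map_sub, Derivation.map_smul, Derivation.map_smul, euler_coord_zero, euler_coord_one]
  rcases h with rfl | rfl
  · simp [smul_comm u τ]
  · simp

theorem pderiv_two_smul_add (u b : ℝ) (m : ℕ) :
    pderiv 2 (u • coord 0 + b • coord 1 ^ m) = 0 := by
  simp [pderiv_coord]

theorem pderiv_two_smul_sub (u g : ℝ) : pderiv 2 (g • coord 0 - u • coord 1) = 0 := by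
  simp [pderiv_coord]

theorem representativeOne_mem_cocycles {τ : ℝ} {m : ℕ} {u b g r : ℝ} (hb : b = 0 ∨ m * τ = 1)
    (hg : g = 0 ∨ τ = 1) : representativeOne m u b g r ∈ (openBook τ).cocycles 1 := by
  refine vectorField_mem_cocycles.2 ⟨?_, ?_, ?_⟩
  · rw [pderiv_two_smul_add, pderiv_two_smul_sub]; simp
  · rw [euler_smul_add hb]; simp
  · rw [euler_smul_sub hg]; simp

theorem representativeTwo_mem_cocycles (τ : ℝ) (m : ℕ) (u b g : ℝ) :
    representativeTwo m u b g ∈ (openBook τ).cocycles 2 := by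
  refine bivectorField_mem_cocycles.2 ?_
  rw [pderiv_two_smul_add, pderiv_two_smul_sub]; simp

/-- The kernels of `E_τ - 1` and `E_τ - τ`, with the Euler field `E_τ` split off. -/
theorem exists_coefficients {τ : ℝ} (hτ : 0 < τ) (hτ₁ : τ ≤ 1) {s t : SmoothFun}
    (hs : pderiv 2 s = 0) (ht : pderiv 2 t = 0) (es : euler τ s = s) (et : euler τ t = τ • t) :
    ∃ (m : ℕ) (u v b g : ℝ), (b = 0 ∨ m * τ = 1) ∧ (g = 0 ∨ τ = 1) ∧
      s = v • coord 0 + (u • coord 0 + b • coord 1 ^ m) ∧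
      t = (τ * v) • coord 1 + (g • coord 0 - u • coord 1) := by
  obtain ⟨a, b, m, hb, rfl⟩ := eq_of_euler_eq_self hτ hs es
  obtain ⟨g, d, hg, rfl⟩ : ∃ g d : ℝ, (g = 0 ∨ τ = 1) ∧ t = g • coord 0 + d • coord 1 := by
    rcases hτ₁.lt_or_eq with h | rfl
    · obtain ⟨d, rfl⟩ := eq_of_euler_eq_smul_self hτ h ht et
      exact ⟨0, d, .inl rfl, by simp⟩
    · rw [one_smul] at et
      obtain ⟨g, d, k, hk, rfl⟩ := eq_of_euler_eq_self hτ ht et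
      refine ⟨g, d, .inr rfl, ?_⟩
      rcases hk with rfl | hk
      · simp
      · rw [show k = 1 by exact_mod_cast (mul_one (k : ℝ)).symm.trans hk, pow_one]
  have h0 : 1 + τ ≠ 0 := by linarith
  -- Here `u` and `v` solve `u + v = a` and `τ v - u = d`, which splits the diagonal field `a x ∂_x
  -- + d y ∂_y` as `u E_{-1} + v E_τ`.
  refine ⟨m, a - (a + d) / (1 + τ), (a + d) / (1 + τ), b, g, hb, hg, by module, ?_⟩
  rw [show d = τ * ((a + d) / (1 + τ)) - (a - (a + d) / (1 + τ)) by field_simp; ring]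
  have : ∀ e : ℝ, a + (τ * ((a + d) / (1 + τ)) - (a - (a + d) / (1 + τ))) = a + d := fun _ => by
    field_simp; ring
  rw [this 0]
  module

theorem exists_sub_representativeOne_mem {τ : ℝ} (hτ : 0 < τ) (hτ₁ : τ ≤ 1) {P : Multivector}
    (hP : P ∈ (openBook τ).cocycles 1) :
    ∃ (m : ℕ) (u b g r : ℝ), (b = 0 ∨ m * τ = 1) ∧ (g = 0 ∨ τ = 1) ∧
      P - representativeOne m u b g r ∈ (openBook τ).coboundaries 1 := by
  have e := eq_vectorField_of_mem hP.1
  rw [e] at hP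
  obtain ⟨h1, h2, h3⟩ := vectorField_mem_cocycles.1 hP
  obtain ⟨f, s, t, r, hs, ht, es, et, ea, eb, ec⟩ := exists_normal_form_one hτ hτ₁ h1 h2 h3
  obtain ⟨m, u, v, b, g, hb, hg, rfl, rfl⟩ := exists_coefficients hτ hτ₁ hs ht es et
  -- The function `v z` has differential `v E_τ`, which removes the Euler part.
  refine ⟨m, u, b, g, r, hb, hg, mem_coboundaries_one.2 ⟨f + v • coord 2, ?_⟩⟩
  rw [e, ea, eb, ec, representativeOne, vectorField_sub, vectorField_inj]
  have h2 : pderiv 2 (f + v • coord 2) = pderiv 2 f + v • 1 := by simp [pderiv_coord]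
  have hE : euler τ (f + v • coord 2) = euler τ f := by simp [euler_coord_two]
  rw [h2, hE]
  simp only [Algebra.smul_def, map_mul]
  refine ⟨by ring, by ring, by ring⟩

theorem exists_sub_representativeTwo_mem {τ : ℝ} (hτ : 0 < τ) (hτ₁ : τ ≤ 1) {P : Multivector}
    (hP : P ∈ (openBook τ).cocycles 2) :
    ∃ (m : ℕ) (u b g : ℝ), (b = 0 ∨ m * τ = 1) ∧ (g = 0 ∨ τ = 1) ∧
      P - representativeTwo m u b g ∈ (openBook τ).coboundaries 2 := by
  have e := eq_bivectorField_of_mem hP.1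
  rw [e] at hP
  obtain ⟨a, b', c, s, t, hs, ht, es, et, ew, ep, eq⟩ :=
    exists_normal_form_two hτ hτ₁ (bivectorField_mem_cocycles.1 hP)
  obtain ⟨m, u, v, b, g, hb, hg, rfl, rfl⟩ := exists_coefficients hτ hτ₁ hs ht es et
  -- The differential of `v z ∂_z` is `v E_τ ∧ ∂_z`, which removes the Euler part.
  refine ⟨m, u, b, g, hb, hg, mem_coboundaries_two.2 ⟨a, b', c + v • coord 2, ?_⟩⟩
  rw [e, ew, ep, eq, representativeTwo, bivectorField_sub, bivectorField_inj]
  have h2 : pderiv 2 (c + v • coord 2) = pderiv 2 c + v • 1 := by simp [pderiv_coord]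
  rw [h2]
  simp only [Algebra.smul_def, map_mul]
  refine ⟨by ring, by ring, by ring⟩

/-! ### Independence of the representatives -/

/-- `E_τ - mτ` annihilates the Taylor coefficient of `y^m`, and the ideal `(x)` does not contribute
to it. Each `∂_y` lowers the weight by `τ` and preserves `(x)`; after `m` of them the equation is
evaluated at the origin. -/
theorem eq_zero_of_smul_pow_eq {τ b : ℝ} (m : ℕ) {a c : SmoothFun}
    (h : b • coord 1 ^ m = euler τ a - (m * τ) • a + coord 0 * c) : b = 0 := by
  induction m generalizing b a c with
  | zero =>
    rw [pow_zero, Nat.cast_zero] at h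
    have h0 : b * 1 = euler τ a 0 - (0 * τ) * a 0 + (0 : ℝ) * c 0 :=
      congrArg (fun f : SmoothFun => f 0) h
    rw [euler_eval_zero] at h0
    linarith
  | succ m ih =>
    have h1 := congrArg (pderiv 1) h
    rw [map_add, map_sub, Derivation.map_smul, Derivation.map_smul, pderiv_one_euler,
      pderiv_coord_mul_of_ne (by decide), Derivation.leibniz_pow, pderiv_coord, if_pos rfl] at h1
    have := ih (b := (m + 1) * b) (a := pderiv 1 a) (c := pderiv 1 c) (by
      simp only [Algebra.smul_def, map_mul, map_add, map_one, map_natCast,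
        Nat.add_sub_cancel] at h1 ⊢
      push_cast at h1 ⊢
      linear_combination h1)
    exact (mul_eq_zero.1 this).resolve_left (by positivity)

/-- One statement serves both degrees: in degree one it is used with `p = q = 0`. The Taylor
coefficients of `y^m` in the first equation and, when `τ = 1`, of `x` in the second give `b = g =
0`. The diagonal coefficients give `u = c(0)` and `-u = τ c(0)`, hence `(1 + τ) u = 0`. -/
theorem coefficients_eq_zero_of_coboundary {τ : ℝ} (hτ : 0 < τ) {m : ℕ} {u b g : ℝ}
    {p q c : SmoothFun} (hb : b = 0 ∨ m * τ = 1) (hg : g = 0 ∨ τ = 1)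
    (h1 : u • coord 0 + b • coord 1 ^ m = euler τ p - p + coord 0 * c)
    (h2 : g • coord 0 - u • coord 1 = euler τ q - τ • q + τ • (coord 1 * c)) :
    u = 0 ∧ b = 0 ∧ g = 0 := by
  have hb0 : b = 0 := by
    rcases hb with h | h
    · exact h
    -- The term `u x` is moved into the multiple of `x`.
    · refine eq_zero_of_smul_pow_eq (τ := τ) m (a := p) (c := c - u • 1) ?_
      rw [h, one_smul]
      simp only [Algebra.smul_def] at h1 ⊢
      linear_combination h1
  have hg0 : g = 0 := by
    rcases hg with h | h
    · exact h
    · subst h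
      have := congrArg (pderiv 0) h2
      have e := congrArg (fun f : SmoothFun => f 0) (show g • (1 : SmoothFun) =
        euler 1 (pderiv 0 q) + coord 1 * pderiv 0 c by
          simp [pderiv_coord, pderiv_zero_euler] at this
          rw [this])
      have e' : g * 1 = euler 1 (pderiv 0 q) 0 + (0 : ℝ) * pderiv 0 c 0 := e
      rw [euler_eval_zero] at e'
      linarith
  subst hb0 hg0
  have e1 : u * 1 = euler τ (pderiv 0 p) 0 + ((0 : ℝ) * pderiv 0 c 0 + c 0) := by
    refine congrArg (fun f : SmoothFun => f 0) (show u • (1 : SmoothFun) =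
        euler τ (pderiv 0 p) + (coord 0 * pderiv 0 c + c) from ?_)
    have := congrArg (pderiv 0) h1
    simpa [pderiv_coord, pderiv_zero_euler] using this
  have e2 : -u * 1 = euler τ (pderiv 1 q) 0 + τ * ((0 : ℝ) * pderiv 1 c 0 + c 0) := by
    refine congrArg (fun f : SmoothFun => f 0) (show (-u) • (1 : SmoothFun) =
        euler τ (pderiv 1 q) + τ • (coord 1 * pderiv 1 c + c) from ?_)
    have := congrArg (pderiv 1) h2
    simpa [pderiv_coord, pderiv_one_euler] using this
  rw [euler_eval_zero] at e1 e2
  refine ⟨?_, rfl, rfl⟩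
  have : u * (1 + τ) = 0 := by
    have : u = c 0 := by linarith
    rw [← this] at e2
    linarith
  exact (mul_eq_zero.1 this).resolve_right (by linarith)

theorem eq_zero_of_representativeTwo_mem {τ : ℝ} (hτ : 0 < τ) {m : ℕ} {u b g : ℝ}
    (hb : b = 0 ∨ m * τ = 1) (hg : g = 0 ∨ τ = 1)
    (h : representativeTwo m u b g ∈ (openBook τ).coboundaries 2) : u = 0 ∧ b = 0 ∧ g = 0 := by
  obtain ⟨p, q, c, h⟩ := mem_coboundaries_two.1 h
  obtain ⟨-, h1, h2⟩ := bivectorField_inj.1 h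
  exact coefficients_eq_zero_of_coboundary hτ hb hg h1 h2

theorem eq_zero_of_representativeOne_mem {τ : ℝ} (hτ : 0 < τ) {m : ℕ} {u b g r : ℝ}
    (hb : b = 0 ∨ m * τ = 1) (hg : g = 0 ∨ τ = 1)
    (h : representativeOne m u b g r ∈ (openBook τ).coboundaries 1) :
    u = 0 ∧ b = 0 ∧ g = 0 ∧ r = 0 := by
  obtain ⟨f, h⟩ := mem_coboundaries_one.1 h
  obtain ⟨h1, h2, h3⟩ := vectorField_inj.1 h
  obtain ⟨hu, hb, hg⟩ := coefficients_eq_zero_of_coboundary hτ hb hg (p := 0) (q := 0)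
    (by simpa using h1) (by simpa using h2)
  refine ⟨hu, hb, hg, ?_⟩
  have e : r * 1 = -euler τ f 0 := congrArg (fun f : SmoothFun => f 0) h3
  rw [euler_eval_zero] at e
  linarith

/-! ### Products and brackets of the representatives -/

theorem schouten_ofFun_one_left (P : Multivector) : schouten (ofFun 1) P = 0 := by
  apply mv_ext <;> simp +decide [schouten_apply, wedge_apply, contractL_apply, contractR_apply,
    coeffDeriv_apply, ofFun]

theorem schouten_ofFun_one_right (P : Multivector) : schouten P (ofFun 1) = 0 := by
  apply mv_ext <;> simp +decide [schouten_apply, wedge_apply, contractL_apply, contractR_apply,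
    coeffDeriv_apply, ofFun]

theorem smul_partialField_wedge (f : SmoothFun) :
    f • (partialField 0 ⋏ partialField 1) = bivectorField f 0 0 := by
  apply mv_ext <;> simp +decide [wedge_apply, partialField, bivectorField]

theorem vectorField_wedge_vectorField (a b c a' b' c' : SmoothFun) :
    vectorField a b c ⋏ vectorField a' b' c' =
      bivectorField 0 (a * c' - c * a') (b * c' - c * b') +
        (a * b' - b * a') • (partialField 0 ⋏ partialField 1) := by
  rw [smul_partialField_wedge]
  apply mv_ext <;> simp +decide [wedge_apply, vectorField, bivectorField]

/-- The only part outside the span in degree two is the `∂_x ∧ ∂_y` term: a quadratic form for `m =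
1`, and `(u b' - b u') y^{m+1}` when `g = g' = 0`. These are the terms that the degree-two relations
must kill. -/
theorem representativeOne_wedge (m : ℕ) (u b g r u' b' g' r' : ℝ) :
    representativeOne m u b g r ⋏ representativeOne m u' b' g' r' =
      representativeTwo m (u * r' - u' * r) (b * r' - b' * r) (g * r' - g' * r) +
      ((u • coord 0 + b • coord 1 ^ m) * (g' • coord 0 - u' • coord 1) -
        (g • coord 0 - u • coord 1) * (u' • coord 0 + b' • coord 1 ^ m)) •
      (partialField 0 ⋏ partialField 1) := by
  rw [representativeOne, representativeOne, vectorField_wedge_vectorField, representativeTwo]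
  congr 2 <;> simp only [Algebra.smul_def, map_mul, map_sub] <;> ring

theorem algebraMap_two : algebraMap ℝ SmoothFun 2 = 2 := map_ofNat _ 2

theorem schouten_representativeOne_one (u b g r u' b' g' r' : ℝ) :
    schouten (representativeOne 1 u b g r) (representativeOne 1 u' b' g' r') =
      representativeOne 1 (b' * g - b * g') (2 * (u' * b - u * b'))
        (2 * (u * g' - u' * g)) 0 := by
  apply mv_ext <;>
    simp +decide [schouten_apply, wedge_apply, contractL_apply, contractR_apply,
      coeffDeriv_apply, representativeOne, vectorField, pderiv_coord, Algebra.smul_def,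
      algebraMap_two]
  all_goals ring

theorem schouten_representativeOne_representativeTwo_one (u b g r u' b' g' : ℝ) :
    schouten (representativeOne 1 u b g r) (representativeTwo 1 u' b' g') =
      representativeTwo 1 (b' * g - b * g') (2 * (u' * b - u * b'))
        (2 * (u * g' - u' * g)) := by
  apply mv_ext <;>
    simp +decide [schouten_apply, wedge_apply, contractL_apply, contractR_apply,
      coeffDeriv_apply, representativeOne, representativeTwo, bivectorField, vectorField,
      pderiv_coord, Algebra.smul_def, algebraMap_two]
  all_goals ring

theorem schouten_representativeTwo_representativeOne_one (u b g u' b' g' r' : ℝ) :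
    schouten (representativeTwo 1 u b g) (representativeOne 1 u' b' g' r') =
      representativeTwo 1 (b' * g - b * g') (2 * (u' * b - u * b'))
        (2 * (u * g' - u' * g)) := by
  apply mv_ext <;>
    simp +decide [schouten_apply, wedge_apply, contractL_apply, contractR_apply,
      coeffDeriv_apply, representativeOne, representativeTwo, bivectorField, vectorField,
      pderiv_coord, Algebra.smul_def, algebraMap_two]
  all_goals ring

theorem schouten_representativeOne (m : ℕ) (u b r u' b' r' : ℝ) :
    schouten (representativeOne m u b 0 r) (representativeOne m u' b' 0 r') =
      representativeOne m 0 ((m + 1) * (u' * b - u * b')) 0 0 := by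
  have h0 := pderiv_pow_of_ne (show (0 : Fin 3) ≠ 1 by decide) m
  have h2 := pderiv_pow_of_ne (show (2 : Fin 3) ≠ 1 by decide) m
  have h1 := pderiv_one_pow m
  unfold representativeOne
  -- The power `y^m` enters only through `∂_x Y = ∂_z Y = 0` and `y ∂_y Y = m Y`.
  generalize coord 1 ^ m = Y at *
  rw [nsmul_eq_mul] at h1
  apply mv_ext <;>
    simp +decide [schouten_apply, wedge_apply, contractL_apply, contractR_apply,
      coeffDeriv_apply, vectorField, pderiv_coord, Algebra.smul_def, h0, h2]
  · linear_combination (algebraMap ℝ SmoothFun u' * algebraMap ℝ SmoothFun b -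
      algebraMap ℝ SmoothFun u * algebraMap ℝ SmoothFun b') * h1
  · ring

theorem schouten_representativeOne_representativeTwo (m : ℕ) (u b r u' b' : ℝ) :
    schouten (representativeOne m u b 0 r) (representativeTwo m u' b' 0) =
      representativeTwo m 0 ((m + 1) * (u' * b - u * b')) 0 := by
  have h0 := pderiv_pow_of_ne (show (0 : Fin 3) ≠ 1 by decide) m
  have h2 := pderiv_pow_of_ne (show (2 : Fin 3) ≠ 1 by decide) m
  have h1 := pderiv_one_pow m
  unfold representativeOne representativeTwo
  generalize coord 1 ^ m = Y at *
  rw [nsmul_eq_mul] at h1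
  apply mv_ext <;>
    simp +decide [schouten_apply, wedge_apply, contractL_apply, contractR_apply,
      coeffDeriv_apply, vectorField, bivectorField, pderiv_coord, Algebra.smul_def, h0, h2]
  · linear_combination (algebraMap ℝ SmoothFun u' * algebraMap ℝ SmoothFun b -
      algebraMap ℝ SmoothFun u * algebraMap ℝ SmoothFun b') * h1
  · ring

theorem schouten_representativeTwo_representativeOne (m : ℕ) (u b u' b' r' : ℝ) :
    schouten (representativeTwo m u b 0) (representativeOne m u' b' 0 r') =
      representativeTwo m 0 ((m + 1) * (u' * b - u * b')) 0 := by
  have h0 := pderiv_pow_of_ne (show (0 : Fin 3) ≠ 1 by decide) m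
  have h2 := pderiv_pow_of_ne (show (2 : Fin 3) ≠ 1 by decide) m
  have h1 := pderiv_one_pow m
  unfold representativeOne representativeTwo
  generalize coord 1 ^ m = Y at *
  rw [nsmul_eq_mul] at h1
  apply mv_ext <;>
    simp +decide [schouten_apply, wedge_apply, contractL_apply, contractR_apply,
      coeffDeriv_apply, vectorField, bivectorField, pderiv_coord, Algebra.smul_def, h0, h2]
  · linear_combination (algebraMap ℝ SmoothFun u' * algebraMap ℝ SmoothFun b -
      algebraMap ℝ SmoothFun u * algebraMap ℝ SmoothFun b') * h1
  · ring

/-- For generic `τ` there are no relations, so products in degree three must vanish identically: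
each repeats `E_{-1}` or `∂_z`. -/
theorem representativeOne_wedge_representativeTwo_eq_zero (u r u' : ℝ) :
    representativeOne 0 u 0 0 r ⋏ representativeTwo 0 u' 0 0 = 0 ∧
      representativeTwo 0 u' 0 0 ⋏ representativeOne 0 u 0 0 r = 0 := by
  constructor <;> apply mv_ext <;>
    simp +decide [wedge_apply, representativeOne, representativeTwo, vectorField, bivectorField,
      Algebra.smul_def]
  all_goals ring

theorem schouten_representativeTwo_eq_zero (u u' : ℝ) :
    schouten (representativeTwo 0 u 0 0) (representativeTwo 0 u' 0 0) = 0 := by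
  apply mv_ext <;>
    simp +decide [schouten_apply, wedge_apply, contractL_apply, contractR_apply,
      coeffDeriv_apply, representativeTwo, bivectorField, pderiv_coord, Algebra.smul_def]

/-! ### The relations in degree `2` -/

/-- The primitive is `z ∂_z`. -/
theorem eulerField_wedge_mem (τ : ℝ) :
    eulerField τ ⋏ partialField 2 ∈ (openBook τ).coboundaries 2 := by
  refine mem_coboundaries_two.2 ⟨0, 0, coord 2, ?_⟩
  apply mv_ext <;>
    simp +decide [wedge_apply, eulerField, partialField, bivectorField, pderiv_coord]

/-- The primitive is `z f ∂_y`: since `f` has weight `τ`, the `∂_y ∧ ∂_z` component of its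
differential vanishes. -/
theorem coord_zero_mul_mem {τ : ℝ} {f : SmoothFun} (hf : pderiv 2 f = 0)
    (ef : euler τ f = τ • f) :
    (coord 0 * f) • (partialField 0 ⋏ partialField 1) ∈ (openBook τ).coboundaries 2 := by
  rw [smul_partialField_wedge]
  refine mem_coboundaries_two.2 ⟨0, coord 2 * f, 0, bivectorField_inj.2 ⟨?_, ?_, ?_⟩⟩
  · rw [pderiv_coord_mul, hf, map_zero]; simp
  · simp only [map_zero, mul_zero, sub_zero, add_zero]
  · rw [euler_coord_two_mul, ef, mul_smul_comm, sub_self, map_zero, mul_zero, smul_zero, add_zero]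

/-- The primitive is `-τ⁻¹ z f ∂_x`: since `f` has weight `1`, the `∂_x ∧ ∂_z` component of its
differential vanishes. -/
theorem coord_one_mul_mem {τ : ℝ} (hτ : τ ≠ 0) {f : SmoothFun} (hf : pderiv 2 f = 0)
    (ef : euler τ f = f) :
    (coord 1 * f) • (partialField 0 ⋏ partialField 1) ∈ (openBook τ).coboundaries 2 := by
  rw [smul_partialField_wedge]
  refine mem_coboundaries_two.2 ⟨(-τ⁻¹) • (coord 2 * f), 0, 0, bivectorField_inj.2 ⟨?_, ?_, ?_⟩⟩
  · rw [Derivation.map_smul, pderiv_coord_mul, hf, mul_zero, zero_add, mul_smul_comm, smul_smul,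
      mul_neg, mul_inv_cancel₀ hτ, map_zero, mul_zero, zero_sub, neg_one_smul, neg_neg]
  · rw [Derivation.map_smul, euler_coord_two_mul, ef, sub_self, map_zero, mul_zero, add_zero]
  · simp only [map_zero, mul_zero, smul_zero, sub_zero, add_zero]

theorem pow_mul_pow_smul_mem {i j : ℕ} (h : i + j = 2) :
    (coord 0 ^ i * coord 1 ^ j) • (partialField 0 ⋏ partialField 1) ∈
      (openBook 1).coboundaries 2 := by
  have h0 : pderiv 2 (coord 0) = 0 := by simp [pderiv_coord]
  have h1 : pderiv 2 (coord 1) = 0 := by simp [pderiv_coord]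
  have e1 : euler 1 (coord 1) = coord 1 := by simp [euler_coord_one]
  obtain ⟨rfl, rfl⟩ | ⟨rfl, rfl⟩ | ⟨rfl, rfl⟩ : (i = 0 ∧ j = 2) ∨ (i = 1 ∧ j = 1) ∨
    (i = 2 ∧ j = 0) := by omega
  · simpa [pow_two] using coord_one_mul_mem one_ne_zero h1 e1
  · simpa using coord_zero_mul_mem h1 (e1.trans (one_smul ℝ _).symm)
  · simpa [pow_two] using coord_zero_mul_mem h0 ((euler_coord_zero 1).trans (one_smul ℝ _).symm)

theorem aeval_smul_mem {p : MvPolynomial (Fin 2) ℝ} (hp : p.IsHomogeneous 2) :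
    MvPolynomial.aeval ![coord 0, coord 1] p • (partialField 0 ⋏ partialField 1) ∈
      (openBook 1).coboundaries 2 := by
  rw [p.as_sum, map_sum, Finset.sum_smul]
  refine Submodule.sum_mem _ fun d hd => ?_
  have hd' : d 0 + d 1 = 2 := by
    have := hp (MvPolynomial.mem_support_iff.1 hd)
    rw [Finsupp.weight_apply, Finsupp.sum_fintype _ _ (by simp)] at this
    simpa [Fin.sum_univ_two] using this
  rw [MvPolynomial.aeval_monomial, Finsupp.prod_fintype _ _ (by simp),
    Fin.prod_univ_two, ← Algebra.smul_def, smul_assoc]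
  exact Submodule.smul_of_tower_mem _ _ (pow_mul_pow_smul_mem hd')

theorem pow_smul_mem {τ : ℝ} {n : ℕ} (h : n * τ = 1) :
    coord 1 ^ (n + 1) • (partialField 0 ⋏ partialField 1) ∈ (openBook τ).coboundaries 2 := by
  have hτ : τ ≠ 0 := by rintro rfl; simp at h
  rw [pow_succ']
  exact coord_one_mul_mem hτ (pderiv_pow_of_ne (by decide) n) (by rw [euler_pow, h, one_smul])

/-! ### The algebraic structure of the cohomology -/

theorem representatives_le_multivectorFields {n₁ n₂ : ℕ} {g₁ : Fin n₁ → Multivector}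
    {g₂ : Fin n₂ → Multivector} (h₁ : ∀ P ∈ Submodule.span ℝ (Set.range g₁), P ∈ multivectorFields 1)
    (h₂ : ∀ P ∈ Submodule.span ℝ (Set.range g₂), P ∈ multivectorFields 2) {k : ℕ}
    {P : Multivector} (hP : P ∈ representatives g₁ g₂ k) : P ∈ multivectorFields k := by
  match k, hP with
  | 0, hP =>
    obtain ⟨c, rfl⟩ := Submodule.mem_span_singleton.1 hP
    exact ((multivectorFields 0).restrictScalars ℝ).smul_mem c (ofFun_mem 1)
  | 1, hP => exact h₁ P hP
  | 2, hP => exact h₂ P hP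
  | k + 3, hP =>
    rw [(Submodule.mem_bot ℝ).1 hP]
    exact Submodule.zero_mem _

/-- Only degrees one and two require computation. Constants act by scalars under the wedge and have
zero bracket, representatives of degree at least three are zero, and the product of two bivector
fields has degree four. -/
theorem structureDeterminedBy_representatives {π : PoissonStructure} {n₁ n₂ : ℕ}
    {g₁ : Fin n₁ → Multivector} {g₂ : Fin n₂ → Multivector} {R : ℕ → Submodule ℝ Multivector}
    (hR : ∀ k, ∀ T ∈ R k, T ∈ π.coboundaries k)
    (h₁ : ∀ P ∈ Submodule.span ℝ (Set.range g₁), P ∈ π.cocycles 1)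
    (h₂ : ∀ P ∈ Submodule.span ℝ (Set.range g₂), P ∈ π.cocycles 2)
    (w₁₁ : ∀ P ∈ Submodule.span ℝ (Set.range g₁), ∀ Q ∈ Submodule.span ℝ (Set.range g₁),
      P ⋏ Q ∈ Submodule.span ℝ (Set.range g₂) ⊔ R 2)
    (w₁₂ : ∀ P ∈ Submodule.span ℝ (Set.range g₁), ∀ Q ∈ Submodule.span ℝ (Set.range g₂),
      P ⋏ Q ∈ R 3 ∧ Q ⋏ P ∈ R 3)
    (s₁₁ : ∀ P ∈ Submodule.span ℝ (Set.range g₁), ∀ Q ∈ Submodule.span ℝ (Set.range g₁),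
      schouten P Q ∈ Submodule.span ℝ (Set.range g₁))
    (s₁₂ : ∀ P ∈ Submodule.span ℝ (Set.range g₁), ∀ Q ∈ Submodule.span ℝ (Set.range g₂),
      schouten P Q ∈ Submodule.span ℝ (Set.range g₂) ∧
      schouten Q P ∈ Submodule.span ℝ (Set.range g₂))
    (s₂₂ : ∀ P ∈ Submodule.span ℝ (Set.range g₂), ∀ Q ∈ Submodule.span ℝ (Set.range g₂),
      schouten P Q ∈ R 3) :
    π.StructureDeterminedBy (representatives g₁ g₂) R := by
  have hd {k : ℕ} {P : Multivector} (hP : P ∈ representatives g₁ g₂ k) :=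
    representatives_le_multivectorFields (fun P hP => (h₁ P hP).1) (fun P hP => (h₂ P hP).1) hP
  have h₀ : ofFun 1 ∈ π.cocycles 0 :=
    PoissonStructure.mem_cocycles.2 ⟨ofFun_mem 1, schouten_ofFun_one_right _⟩
  have hz {k : ℕ} {P : Multivector} (hP : P ∈ representatives g₁ g₂ (k + 3)) : P = 0 := hP
  refine PoissonStructure.structureDeterminedBy_of_mem_sup ?_ hR ?_ ?_
  · intro k P hP
    match k, hP with
    | 0, hP =>
      obtain ⟨c, rfl⟩ := Submodule.mem_span_singleton.1 hP
      exact Submodule.smul_of_tower_mem _ c h₀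
    | 1, hP => exact h₁ P hP
    | 2, hP => exact h₂ P hP
    | k + 3, hP =>
      rw [hz hP]
      exact Submodule.zero_mem _
  · intro i j P hP Q hQ
    match i, j, hP, hQ with
    | 0, j, hP, hQ =>
      obtain ⟨c, rfl⟩ := Submodule.mem_span_singleton.1 hP
      rw [smul_wedge, ofFun_wedge, one_smul, zero_add]
      exact Submodule.mem_sup_left (Submodule.smul_mem _ c hQ)
    | i + 1, 0, hP, hQ =>
      obtain ⟨c, rfl⟩ := Submodule.mem_span_singleton.1 hQ
      rw [wedge_smul, wedge_ofFun, one_smul, add_zero]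
      exact Submodule.mem_sup_left (Submodule.smul_mem _ c hP)
    | 1, 1, hP, hQ => exact w₁₁ P hP Q hQ
    | 1, 2, hP, hQ => exact Submodule.mem_sup_right (w₁₂ P hP Q hQ).1
    | 2, 1, hP, hQ => exact Submodule.mem_sup_right (w₁₂ Q hQ P hP).2
    | 2, 2, hP, hQ =>
      rw [eq_zero_of_mem (by decide) (wedge_mem (hd hP) (hd hQ))]
      exact Submodule.zero_mem _
    | i + 3, j, hP, hQ =>
      rw [hz hP, zero_wedge]
      exact Submodule.zero_mem _
    | i + 1, j + 3, hP, hQ =>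
      rw [hz hQ, wedge_zero]
      exact Submodule.zero_mem _
  · intro i j P hP Q hQ
    match i, j, hP, hQ with
    | 0, j, hP, hQ =>
      obtain ⟨c, rfl⟩ := Submodule.mem_span_singleton.1 hP
      rw [smul_schouten, schouten_ofFun_one_left, smul_zero]
      exact Submodule.zero_mem _
    | i + 1, 0, hP, hQ =>
      obtain ⟨c, rfl⟩ := Submodule.mem_span_singleton.1 hQ
      rw [schouten_smul, schouten_ofFun_one_right, smul_zero]
      exact Submodule.zero_mem _
    | 1, 1, hP, hQ => exact Submodule.mem_sup_left (s₁₁ P hP Q hQ)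
    | 1, 2, hP, hQ => exact Submodule.mem_sup_left (s₁₂ P hP Q hQ).1
    | 2, 1, hP, hQ => exact Submodule.mem_sup_left (s₁₂ Q hQ P hP).2
    | 2, 2, hP, hQ => exact Submodule.mem_sup_right (s₂₂ P hP Q hQ)
    | i + 3, j, hP, hQ =>
      rw [hz hP, PoissonStructure.zero_schouten]
      exact Submodule.zero_mem _
    | i + 1, j + 3, hP, hQ =>
      rw [hz hQ, PoissonStructure.schouten_zero]
      exact Submodule.zero_mem _

theorem relations_le_coboundaries {τ : ℝ} (hτ : 0 < τ) {S : Set Multivector}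
    (hS : ∀ T ∈ S, T ∈ (openBook τ).coboundaries 2) (k : ℕ) :
    ∀ T ∈ relations S k, T ∈ (openBook τ).coboundaries k := by
  intro T hT
  match k, hT with
  | 0, hT | 1, hT | k + 4, hT =>
    rw [show T = 0 from hT]
    exact Submodule.zero_mem _
  | 2, hT =>
    exact (Submodule.span_le (p := ((openBook τ).coboundaries 2).restrictScalars ℝ)).2 hS hT
  | 3, hT => exact mem_coboundaries_three hτ hT

/-! ### The Lie algebra structure of the first cohomology. -/

/-- The bracket identity is required of the vector fields themselves, with no coboundary correction;
this suffices because the representatives span a Lie subalgebra of the vector fields. -/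
theorem nonempty_lieEquiv {π : PoissonStructure} {n : ℕ} {g : Fin n → Multivector}
    (hg : ∀ i, g i ∈ π.cocycles 1) (h : Function.Bijective (π.classMap hg))
    {L : Type*} [LieRing L] [LieAlgebra ℝ L] (e : L ≃ₗ[ℝ] (Fin n → ℝ))
    (he : ∀ A B, ∑ i, e ⁅A, B⁆ i • g i = schouten (∑ i, e A i • g i) (∑ i, e B i • g i)) :
    Nonempty (π.Cohomology 1 ≃ₗ⁅ℝ⁆ L) := by
  let f : L →ₗ[ℝ] π.Cohomology 1 := (π.classMap hg).comp e.toLinearMap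
  have hf : Function.Bijective f := h.comp e.bijective
  let F : L →ₗ⁅ℝ⁆ π.Cohomology 1 :=
    { f with
      map_lie' := by
        intro A B
        change π.classMap hg (e ⁅A, B⁆) = ⁅π.classMap hg (e A), π.classMap hg (e B)⁆
        simp only [PoissonStructure.classMap_apply]
        exact congrArg π.cls (Subtype.ext (he A B)) }
  exact ⟨(LieEquiv.ofBijective F hf).symm⟩

/-- The coordinates on `𝔰𝔩₂(ℝ) ⊕ ℝ` corresponding to `y ∂_x, x ∂_y, E_{-1}, ∂_z`. -/
def slProdEquiv : (LieAlgebra.SpecialLinear.sl (Fin 2) ℝ × ℝ) ≃ₗ[ℝ] (Fin 4 → ℝ) where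
  -- A matrix is sent to minus its linear vector field, since sending `A` to the field `v ↦ A v`
  -- reverses brackets.
  toFun A := ![-(A.1.1 0 1), -(A.1.1 1 0), -(A.1.1 0 0), A.2]
  map_add' A B := by ext i; fin_cases i <;> simp [add_comm]
  map_smul' c A := by ext i; fin_cases i <;> simp
  invFun c := (⟨!![-c 2, -c 0; -c 1, c 2], by
    change Matrix.trace (!![-c 2, -c 0; -c 1, c 2] : Matrix (Fin 2) (Fin 2) ℝ) = 0
    simp [Matrix.trace]⟩, c 3)
  left_inv A := by
    have h : Matrix.trace A.1.1 = 0 := A.1.2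
    rw [Matrix.trace, Fin.sum_univ_two] at h
    refine Prod.ext (Subtype.ext (Matrix.ext fun i j => ?_)) rfl
    fin_cases i <;> fin_cases j <;> simp
    exact (eq_neg_of_add_eq_zero_right h).symm
  right_inv c := by ext i; fin_cases i <;> simp

/-- The coordinates on `𝔞𝔣𝔣₁(ℝ) ⊕ ℝ` corresponding to `y^n ∂_x, E_{-1}, ∂_z`. -/
def affProdEquiv (n : ℕ) : (aff₁ × ℝ) ≃ₗ[ℝ] (Fin 3 → ℝ) where
  -- Since `[E_{-1}, y^n ∂_x] = -(n + 1) y^n ∂_x`, the field `-E_{-1} / (n + 1)` acts on `y^n ∂_x`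
  -- with eigenvalue `1`, as the diagonal matrix unit does on the off-diagonal one.
  toFun A := ![A.1.1 0 1, -(A.1.1 0 0) / (n + 1), A.2]
  map_add' A B := by
    ext i; fin_cases i <;> simp
    ring
  map_smul' c A := by ext i; fin_cases i <;> simp; ring
  invFun c := (⟨!![-(c 1) * (n + 1), c 0; 0, 0], by simp [aff₁]⟩, c 2)
  left_inv A := by
    have h : A.1.1 1 0 = 0 ∧ A.1.1 1 1 = 0 := A.1.2
    have hn : (n : ℝ) + 1 ≠ 0 := by positivity
    refine Prod.ext (Subtype.ext (Matrix.ext fun i j => ?_)) rfl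
    fin_cases i <;> fin_cases j <;> simp [h.1, h.2]
    field_simp
  right_inv c := by
    have hn : (n : ℝ) + 1 ≠ 0 := by positivity
    ext i; fin_cases i <;> simp
    field_simp

/-- The coordinates on `ℝ ⊕ ℝ` corresponding to `E_{-1}, ∂_z`. -/
def prodEquiv : (ℝ × ℝ) ≃ₗ[ℝ] (Fin 2 → ℝ) := (LinearEquiv.finTwoArrow ℝ ℝ).symm

/-- If `b = 0`, the exponent carries no information; this replaces the arbitrary exponent supplied
by the kernel computation with the one fixed in each case. -/
theorem representativeOne_zero (m m' : ℕ) (u g r : ℝ) :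
    representativeOne m u 0 g r = representativeOne m' u 0 g r := by
  simp [representativeOne]

theorem representativeTwo_zero (m m' : ℕ) (u g : ℝ) :
    representativeTwo m u 0 g = representativeTwo m' u 0 g := by
  simp [representativeTwo]

theorem mem_of_mem_span_range {n : ℕ} {g : Fin n → Multivector} (i : Fin n) :
    g i ∈ Submodule.span ℝ (Set.range g) := Submodule.subset_span ⟨i, rfl⟩

/-! ### The three ranges of the parameter. -/

theorem openBook_one :
    let g₁ : Fin 4 → Multivector := ![coord 1 • partialField 0, coord 0 • partialField 1,
      eulerField (-1), partialField 2]
    let g₂ : Fin 3 → Multivector := ![(coord 1 • partialField 0) ⋏ partialField 2,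
      (coord 0 • partialField 1) ⋏ partialField 2, eulerField (-1) ⋏ partialField 2]
    (openBook 1).FreeOn 1 g₁ ∧
    (openBook 1).FreeOn 2 g₂ ∧
    (openBook 1).StructureDeterminedBy (representatives g₁ g₂)
      (relations ({eulerField 1 ⋏ partialField 2} ∪
        {T | ∃ p : MvPolynomial (Fin 2) ℝ, p.IsHomogeneous 2 ∧ T =
          MvPolynomial.aeval ![coord 0, coord 1] p • (partialField 0 ⋏ partialField 1)})) ∧
    Nonempty ((openBook 1).Cohomology 1 ≃ₗ⁅ℝ⁆
      (LieAlgebra.SpecialLinear.sl (Fin 2) ℝ × ℝ)) := by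
  intro g₁ g₂
  have e₁ (c : Fin 4 → ℝ) : ∑ i, c i • g₁ i = representativeOne 1 (c 2) (c 0) (c 1) (c 3) := by
    rw [Fin.sum_univ_four]
    apply mv_ext <;> simp +decide [g₁, representativeOne, vectorField, partialField, eulerField,
      Algebra.smul_def] <;> ring
  have e₂ (c : Fin 3 → ℝ) : ∑ i, c i • g₂ i = representativeTwo 1 (c 2) (c 0) (c 1) := by
    rw [Fin.sum_univ_three]
    apply mv_ext <;> simp +decide [g₂, representativeTwo, bivectorField, partialField, eulerField,
      wedge_apply, Algebra.smul_def] <;> ring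
  have s₁ (u b g r : ℝ) : representativeOne 1 u b g r ∈ Submodule.span ℝ (Set.range g₁) :=
    Submodule.mem_span_range_iff_exists_fun ℝ |>.2 ⟨![b, g, u, r], e₁ _⟩
  have s₂ (u b g : ℝ) : representativeTwo 1 u b g ∈ Submodule.span ℝ (Set.range g₂) :=
    Submodule.mem_span_range_iff_exists_fun ℝ |>.2 ⟨![b, g, u], e₂ _⟩
  have t₁ {P : Multivector} (hP : P ∈ Submodule.span ℝ (Set.range g₁)) :
      ∃ u b g r, P = representativeOne 1 u b g r := by
    obtain ⟨c, rfl⟩ := (Submodule.mem_span_range_iff_exists_fun ℝ).1 hP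
    exact ⟨_, _, _, _, e₁ c⟩
  have t₂ {P : Multivector} (hP : P ∈ Submodule.span ℝ (Set.range g₂)) :
      ∃ u b g, P = representativeTwo 1 u b g := by
    obtain ⟨c, rfl⟩ := (Submodule.mem_span_range_iff_exists_fun ℝ).1 hP
    exact ⟨_, _, _, e₂ c⟩
  have c₁ : ∀ P ∈ Submodule.span ℝ (Set.range g₁), P ∈ (openBook 1).cocycles 1 := fun P hP => by
    obtain ⟨u, b, g, r, rfl⟩ := t₁ hP
    exact representativeOne_mem_cocycles (.inr (by simp)) (.inr rfl)
  have c₂ : ∀ P ∈ Submodule.span ℝ (Set.range g₂), P ∈ (openBook 1).cocycles 2 := fun P hP => by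
    obtain ⟨u, b, g, rfl⟩ := t₂ hP
    exact representativeTwo_mem_cocycles ..
  have hg₁ (i : Fin 4) := c₁ _ (mem_of_mem_span_range (g := g₁) i)
  have hg₂ (i : Fin 3) := c₂ _ (mem_of_mem_span_range (g := g₂) i)
  have b₁ : Function.Bijective ((openBook 1).classMap hg₁) := by
    refine PoissonStructure.classMap_bijective _ _ (fun P hP => ?_) fun c hc => ?_
    · obtain ⟨m, u, b, g, r, hb, -, h⟩ := exists_sub_representativeOne_mem one_pos le_rfl hP
      refine ⟨![b, g, u, r], ?_⟩
      rw [e₁]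
      rcases hb with rfl | hm
      · exact representativeOne_zero m 1 u g r ▸ h
      · obtain rfl : m = 1 := by simpa using hm
        exact h
    · rw [e₁] at hc
      obtain ⟨h2, h0, h1, h3⟩ :=
        eq_zero_of_representativeOne_mem one_pos (.inr (by simp)) (.inr rfl) hc
      ext i; fin_cases i <;> assumption
  have b₂ : Function.Bijective ((openBook 1).classMap hg₂) := by
    refine PoissonStructure.classMap_bijective _ _ (fun P hP => ?_) fun c hc => ?_
    · obtain ⟨m, u, b, g, hb, -, h⟩ := exists_sub_representativeTwo_mem one_pos le_rfl hP
      refine ⟨![b, g, u], ?_⟩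
      rw [e₂]
      rcases hb with rfl | hm
      · exact representativeTwo_zero m 1 u g ▸ h
      · obtain rfl : m = 1 := by simpa using hm
        exact h
    · rw [e₂] at hc
      obtain ⟨h2, h0, h1⟩ :=
        eq_zero_of_representativeTwo_mem one_pos (.inr (by simp)) (.inr rfl) hc
      ext i; fin_cases i <;> assumption
  refine ⟨PoissonStructure.freeOn_of_bijective (casimir_openBook one_pos) hg₁ b₁,
    PoissonStructure.freeOn_of_bijective (casimir_openBook one_pos) hg₂ b₂,
    structureDeterminedBy_representatives (relations_le_coboundaries one_pos ?_) c₁ c₂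
    ?_ ?_ ?_ ?_ ?_, nonempty_lieEquiv hg₁ b₁ slProdEquiv fun A B => ?_⟩
  · rintro T (rfl | ⟨p, hp, rfl⟩)
    · exact eulerField_wedge_mem 1
    · exact aeval_smul_mem hp
  · intro P hP Q hQ
    obtain ⟨u, b, g, r, rfl⟩ := t₁ hP
    obtain ⟨u', b', g', r', rfl⟩ := t₁ hQ
    rw [representativeOne_wedge]
    -- The `∂_x ∧ ∂_y` coefficient is a difference of products of linear forms, written here as a
    -- polynomial so that its homogeneity of degree two is visible.
    refine Submodule.add_mem_sup (s₂ _ _ _) (Submodule.subset_span (.inr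
      ⟨(u • .X 0 + b • .X 1) * (g' • .X 0 - u' • .X 1) -
        (g • .X 0 - u • .X 1) * (u' • .X 0 + b' • .X 1), ?_, by simp⟩))
    have hX (i : Fin 2) (c : ℝ) : (c • (MvPolynomial.X i : MvPolynomial (Fin 2) ℝ)).IsHomogeneous 1 :=
      (MvPolynomial.homogeneousSubmodule (Fin 2) ℝ 1).smul_mem c (MvPolynomial.isHomogeneous_X ℝ i)
    exact (((hX 0 u).add (hX 1 b)).mul ((hX 0 g').sub (hX 1 u'))).sub
      (((hX 0 g).sub (hX 1 u)).mul ((hX 0 u').add (hX 1 b')))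
  · intro P hP Q hQ
    exact ⟨wedge_mem (c₁ P hP).1 (c₂ Q hQ).1, wedge_mem (c₂ Q hQ).1 (c₁ P hP).1⟩
  · intro P hP Q hQ
    obtain ⟨u, b, g, r, rfl⟩ := t₁ hP
    obtain ⟨u', b', g', r', rfl⟩ := t₁ hQ
    rw [schouten_representativeOne_one]
    exact s₁ _ _ _ _
  · intro P hP Q hQ
    obtain ⟨u, b, g, r, rfl⟩ := t₁ hP
    obtain ⟨u', b', g', rfl⟩ := t₂ hQ
    rw [schouten_representativeOne_representativeTwo_one,
      schouten_representativeTwo_representativeOne_one]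
    exact ⟨s₂ _ _ _, s₂ _ _ _⟩
  · intro P hP Q hQ
    exact schouten_mem (c₂ P hP).1 (c₂ Q hQ).1
  · rw [e₁, e₁, e₁, schouten_representativeOne_one]
    have hA : Matrix.trace A.1.1 = 0 := A.1.2
    have hB : Matrix.trace B.1.1 = 0 := B.1.2
    rw [Matrix.trace, Fin.sum_univ_two] at hA hB
    have hA' : A.1.1 1 1 = -A.1.1 0 0 := eq_neg_of_add_eq_zero_right hA
    have hB' : B.1.1 1 1 = -B.1.1 0 0 := eq_neg_of_add_eq_zero_right hB
    have hl : (⁅A, B⁆ : LieAlgebra.SpecialLinear.sl (Fin 2) ℝ × ℝ) = (⁅A.1, B.1⁆, ⁅A.2, B.2⁆) := rfl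
    rw [hl]
    congr 1 <;> simp [slProdEquiv, Matrix.mul_apply,
      Fin.sum_univ_two, hA', hB', Ring.lie_def] <;> ring

theorem openBook_inv {τ : ℝ} (hτ₀ : 0 < τ) (hτ₁ : τ ≤ 1) {n : ℕ} (hn : 2 ≤ n) (hτ : n * τ = 1) :
    let g₁ : Fin 3 → Multivector := ![coord 1 ^ n • partialField 0, eulerField (-1),
      partialField 2]
    let g₂ : Fin 2 → Multivector := ![(coord 1 ^ n • partialField 0) ⋏ partialField 2,
      eulerField (-1) ⋏ partialField 2]
    (openBook τ).FreeOn 1 g₁ ∧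
    (openBook τ).FreeOn 2 g₂ ∧
    (openBook τ).StructureDeterminedBy (representatives g₁ g₂)
      (relations {coord 1 ^ (n + 1) • (partialField 0 ⋏ partialField 1)}) ∧
    Nonempty ((openBook τ).Cohomology 1 ≃ₗ⁅ℝ⁆ (aff₁ × ℝ)) := by
  intro g₁ g₂
  have hτ' : τ ≠ 1 := by
    rintro rfl
    have : n = 1 := by simpa using hτ
    omega
  have e₁ (c : Fin 3 → ℝ) : ∑ i, c i • g₁ i = representativeOne n (c 1) (c 0) 0 (c 2) := by
    rw [Fin.sum_univ_three]
    apply mv_ext <;> simp +decide [g₁, representativeOne, vectorField, partialField, eulerField,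
      Algebra.smul_def]
    ring
  have e₂ (c : Fin 2 → ℝ) : ∑ i, c i • g₂ i = representativeTwo n (c 1) (c 0) 0 := by
    rw [Fin.sum_univ_two]
    apply mv_ext <;> simp +decide [g₂, representativeTwo, bivectorField, partialField, eulerField,
      wedge_apply, Algebra.smul_def]
    ring
  have s₁ (u b r : ℝ) : representativeOne n u b 0 r ∈ Submodule.span ℝ (Set.range g₁) :=
    Submodule.mem_span_range_iff_exists_fun ℝ |>.2 ⟨![b, u, r], e₁ _⟩
  have s₂ (u b : ℝ) : representativeTwo n u b 0 ∈ Submodule.span ℝ (Set.range g₂) :=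
    Submodule.mem_span_range_iff_exists_fun ℝ |>.2 ⟨![b, u], e₂ _⟩
  have t₁ {P : Multivector} (hP : P ∈ Submodule.span ℝ (Set.range g₁)) :
      ∃ u b r, P = representativeOne n u b 0 r := by
    obtain ⟨c, rfl⟩ := (Submodule.mem_span_range_iff_exists_fun ℝ).1 hP
    exact ⟨_, _, _, e₁ c⟩
  have t₂ {P : Multivector} (hP : P ∈ Submodule.span ℝ (Set.range g₂)) :
      ∃ u b, P = representativeTwo n u b 0 := by
    obtain ⟨c, rfl⟩ := (Submodule.mem_span_range_iff_exists_fun ℝ).1 hP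
    exact ⟨_, _, e₂ c⟩
  have c₁ : ∀ P ∈ Submodule.span ℝ (Set.range g₁), P ∈ (openBook τ).cocycles 1 := fun P hP => by
    obtain ⟨u, b, r, rfl⟩ := t₁ hP
    exact representativeOne_mem_cocycles (.inr hτ) (.inl rfl)
  have c₂ : ∀ P ∈ Submodule.span ℝ (Set.range g₂), P ∈ (openBook τ).cocycles 2 := fun P hP => by
    obtain ⟨u, b, rfl⟩ := t₂ hP
    exact representativeTwo_mem_cocycles ..
  have hg₁ (i : Fin 3) := c₁ _ (mem_of_mem_span_range (g := g₁) i)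
  have hg₂ (i : Fin 2) := c₂ _ (mem_of_mem_span_range (g := g₂) i)
  -- The resonance `mτ = 1` determines the exponent, so the kernel element of weight one is a
  -- multiple of `y^n` modulo `x`.
  have hm {m : ℕ} (hm : m * τ = 1) : m = n := by
    exact_mod_cast mul_right_cancel₀ hτ₀.ne' (hm.trans hτ.symm)
  have b₁ : Function.Bijective ((openBook τ).classMap hg₁) := by
    refine PoissonStructure.classMap_bijective _ _ (fun P hP => ?_) fun c hc => ?_
    · obtain ⟨m, u, b, g, r, hb, hg, h⟩ := exists_sub_representativeOne_mem hτ₀ hτ₁ hP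
      refine ⟨![b, u, r], ?_⟩
      rw [e₁]
      obtain rfl := hg.resolve_right hτ'
      rcases hb with rfl | hb
      · exact representativeOne_zero m n u 0 r ▸ h
      · exact hm hb ▸ h
    · rw [e₁] at hc
      obtain ⟨h1, h0, -, h2⟩ := eq_zero_of_representativeOne_mem hτ₀ (.inr hτ) (.inl rfl) hc
      ext i; fin_cases i <;> assumption
  have b₂ : Function.Bijective ((openBook τ).classMap hg₂) := by
    refine PoissonStructure.classMap_bijective _ _ (fun P hP => ?_) fun c hc => ?_
    · obtain ⟨m, u, b, g, hb, hg, h⟩ := exists_sub_representativeTwo_mem hτ₀ hτ₁ hP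
      refine ⟨![b, u], ?_⟩
      rw [e₂]
      obtain rfl := hg.resolve_right hτ'
      rcases hb with rfl | hb
      · exact representativeTwo_zero m n u 0 ▸ h
      · exact hm hb ▸ h
    · rw [e₂] at hc
      obtain ⟨h1, h0, -⟩ := eq_zero_of_representativeTwo_mem hτ₀ (.inr hτ) (.inl rfl) hc
      ext i; fin_cases i <;> assumption
  refine ⟨PoissonStructure.freeOn_of_bijective (casimir_openBook hτ₀) hg₁ b₁,
    PoissonStructure.freeOn_of_bijective (casimir_openBook hτ₀) hg₂ b₂,
    structureDeterminedBy_representatives (relations_le_coboundaries hτ₀ ?_) c₁ c₂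
    ?_ ?_ ?_ ?_ ?_, nonempty_lieEquiv hg₁ b₁ (affProdEquiv n) fun A B => ?_⟩
  · rintro T rfl
    exact pow_smul_mem hτ
  · intro P hP Q hQ
    obtain ⟨u, b, r, rfl⟩ := t₁ hP
    obtain ⟨u', b', r', rfl⟩ := t₁ hQ
    rw [representativeOne_wedge, zero_mul, zero_mul, sub_zero]
    -- The `x y` terms of the two diagonal parts cancel, leaving `(u b' - b u') y^{n+1}`.
    refine Submodule.add_mem_sup (s₂ _ _) (Submodule.mem_span_singleton.2 ⟨u * b' - b * u', ?_⟩)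
    rw [← smul_assoc]
    congr 1
    simp only [Algebra.smul_def, map_sub, map_mul, map_zero]
    ring
  · intro P hP Q hQ
    exact ⟨wedge_mem (c₁ P hP).1 (c₂ Q hQ).1, wedge_mem (c₂ Q hQ).1 (c₁ P hP).1⟩
  · intro P hP Q hQ
    obtain ⟨u, b, r, rfl⟩ := t₁ hP
    obtain ⟨u', b', r', rfl⟩ := t₁ hQ
    rw [schouten_representativeOne]
    exact s₁ _ _ _
  · intro P hP Q hQ
    obtain ⟨u, b, r, rfl⟩ := t₁ hP
    obtain ⟨u', b', rfl⟩ := t₂ hQ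
    rw [schouten_representativeOne_representativeTwo,
      schouten_representativeTwo_representativeOne]
    exact ⟨s₂ _ _, s₂ _ _⟩
  · intro P hP Q hQ
    exact schouten_mem (c₂ P hP).1 (c₂ Q hQ).1
  · rw [e₁, e₁, e₁, schouten_representativeOne]
    have hA : A.1.1 1 0 = 0 ∧ A.1.1 1 1 = 0 := A.1.2
    have hB : B.1.1 1 0 = 0 ∧ B.1.1 1 1 = 0 := B.1.2
    have hn' : (n : ℝ) + 1 ≠ 0 := by positivity
    have hl : (⁅A, B⁆ : aff₁ × ℝ) = (⁅A.1, B.1⁆, ⁅A.2, B.2⁆) := rfl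
    rw [hl]
    congr 1 <;> simp [affProdEquiv, Matrix.mul_apply, Fin.sum_univ_two, hA.1, hA.2, hB.1, hB.2,
      Ring.lie_def] <;> field_simp
    · exact .inl (by ring)
    · ring
    · ring

/-- Without resonances both `b` and `g` vanish, so all representatives are built from the commuting
fields `E_{-1}` and `∂_z`. The exponent is set to `0` as a dummy. -/
theorem openBook_generic {τ : ℝ} (hτ₀ : 0 < τ) (hτ₁ : τ ≤ 1) (hτ : ∀ m : ℕ, m * τ ≠ 1) :
    let g₁ : Fin 2 → Multivector := ![eulerField (-1), partialField 2]
    let g₂ : Fin 1 → Multivector := ![eulerField (-1) ⋏ partialField 2]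
    (openBook τ).FreeOn 1 g₁ ∧
    (openBook τ).FreeOn 2 g₂ ∧
    (openBook τ).StructureDeterminedBy (representatives g₁ g₂) (fun _ => ⊥) ∧
    Nonempty ((openBook τ).Cohomology 1 ≃ₗ⁅ℝ⁆ (ℝ × ℝ)) := by
  intro g₁ g₂
  have hτ' : τ ≠ 1 := by simpa using hτ 1
  have e₁ (c : Fin 2 → ℝ) : ∑ i, c i • g₁ i = representativeOne 0 (c 0) 0 0 (c 1) := by
    rw [Fin.sum_univ_two]
    apply mv_ext <;> simp +decide [g₁, representativeOne, vectorField, partialField, eulerField,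
      Algebra.smul_def]
  have e₂ (c : Fin 1 → ℝ) : ∑ i, c i • g₂ i = representativeTwo 0 (c 0) 0 0 := by
    rw [Fin.sum_univ_one]
    apply mv_ext <;> simp +decide [g₂, representativeTwo, bivectorField, partialField, eulerField,
      wedge_apply, Algebra.smul_def]
  have s₁ (u r : ℝ) : representativeOne 0 u 0 0 r ∈ Submodule.span ℝ (Set.range g₁) :=
    Submodule.mem_span_range_iff_exists_fun ℝ |>.2 ⟨![u, r], e₁ _⟩
  have s₂ (u : ℝ) : representativeTwo 0 u 0 0 ∈ Submodule.span ℝ (Set.range g₂) :=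
    Submodule.mem_span_range_iff_exists_fun ℝ |>.2 ⟨![u], e₂ _⟩
  have t₁ {P : Multivector} (hP : P ∈ Submodule.span ℝ (Set.range g₁)) :
      ∃ u r, P = representativeOne 0 u 0 0 r := by
    obtain ⟨c, rfl⟩ := (Submodule.mem_span_range_iff_exists_fun ℝ).1 hP
    exact ⟨_, _, e₁ c⟩
  have t₂ {P : Multivector} (hP : P ∈ Submodule.span ℝ (Set.range g₂)) :
      ∃ u, P = representativeTwo 0 u 0 0 := by
    obtain ⟨c, rfl⟩ := (Submodule.mem_span_range_iff_exists_fun ℝ).1 hP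
    exact ⟨_, e₂ c⟩
  have c₁ : ∀ P ∈ Submodule.span ℝ (Set.range g₁), P ∈ (openBook τ).cocycles 1 := fun P hP => by
    obtain ⟨u, r, rfl⟩ := t₁ hP
    exact representativeOne_mem_cocycles (.inl rfl) (.inl rfl)
  have c₂ : ∀ P ∈ Submodule.span ℝ (Set.range g₂), P ∈ (openBook τ).cocycles 2 := fun P hP => by
    obtain ⟨u, rfl⟩ := t₂ hP
    exact representativeTwo_mem_cocycles ..
  have hg₁ (i : Fin 2) := c₁ _ (mem_of_mem_span_range (g := g₁) i)
  have hg₂ (i : Fin 1) := c₂ _ (mem_of_mem_span_range (g := g₂) i)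
  have b₁ : Function.Bijective ((openBook τ).classMap hg₁) := by
    refine PoissonStructure.classMap_bijective _ _ (fun P hP => ?_) fun c hc => ?_
    · obtain ⟨m, u, b, g, r, hb, hg, h⟩ := exists_sub_representativeOne_mem hτ₀ hτ₁ hP
      refine ⟨![u, r], ?_⟩
      rw [e₁]
      obtain rfl := hg.resolve_right hτ'
      obtain rfl := hb.resolve_right (hτ m)
      exact representativeOne_zero m 0 u 0 r ▸ h
    · rw [e₁] at hc
      obtain ⟨h0, -, -, h1⟩ := eq_zero_of_representativeOne_mem hτ₀ (.inl rfl) (.inl rfl) hc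
      ext i; fin_cases i <;> assumption
  have b₂ : Function.Bijective ((openBook τ).classMap hg₂) := by
    refine PoissonStructure.classMap_bijective _ _ (fun P hP => ?_) fun c hc => ?_
    · obtain ⟨m, u, b, g, hb, hg, h⟩ := exists_sub_representativeTwo_mem hτ₀ hτ₁ hP
      refine ⟨![u], ?_⟩
      rw [e₂]
      obtain rfl := hg.resolve_right hτ'
      obtain rfl := hb.resolve_right (hτ m)
      exact representativeTwo_zero m 0 u 0 ▸ h
    · rw [e₂] at hc
      obtain ⟨h0, -, -⟩ := eq_zero_of_representativeTwo_mem hτ₀ (.inl rfl) (.inl rfl) hc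
      ext i; fin_cases i; assumption
  refine ⟨PoissonStructure.freeOn_of_bijective (casimir_openBook hτ₀) hg₁ b₁,
    PoissonStructure.freeOn_of_bijective (casimir_openBook hτ₀) hg₂ b₂,
    structureDeterminedBy_representatives ?_ c₁ c₂ ?_ ?_ ?_ ?_ ?_,
    nonempty_lieEquiv hg₁ b₁ prodEquiv fun A B => ?_⟩
  · rintro k T rfl
    exact Submodule.zero_mem _
  · intro P hP Q hQ
    obtain ⟨u, r, rfl⟩ := t₁ hP
    obtain ⟨u', r', rfl⟩ := t₁ hQ
    refine Submodule.mem_sup_left ?_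
    rw [representativeOne_wedge, zero_mul, zero_mul, sub_zero]
    convert s₂ (u * r' - u' * r) using 1
    rw [add_eq_left]
    -- The `∂_x ∧ ∂_y` part is a multiple of `E_{-1} ∧ E_{-1}`, so its coefficient is zero.
    convert zero_smul SmoothFun _
    simp only [Algebra.smul_def, map_zero]
    ring
  · intro P hP Q hQ
    obtain ⟨u, r, rfl⟩ := t₁ hP
    obtain ⟨u', rfl⟩ := t₂ hQ
    exact representativeOne_wedge_representativeTwo_eq_zero u r u'
  · intro P hP Q hQ
    obtain ⟨u, r, rfl⟩ := t₁ hP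
    obtain ⟨u', r', rfl⟩ := t₁ hQ
    rw [schouten_representativeOne, mul_zero, mul_zero, sub_zero, mul_zero]
    exact s₁ _ _
  · intro P hP Q hQ
    obtain ⟨u, r, rfl⟩ := t₁ hP
    obtain ⟨u', rfl⟩ := t₂ hQ
    rw [schouten_representativeOne_representativeTwo,
      schouten_representativeTwo_representativeOne, mul_zero, mul_zero, sub_zero, mul_zero]
    exact ⟨s₂ _, s₂ _⟩
  · intro P hP Q hQ
    obtain ⟨u, rfl⟩ := t₂ hP
    obtain ⟨u', rfl⟩ := t₂ hQ
    exact schouten_representativeTwo_eq_zero u u'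
  · have hl : (⁅A, B⁆ : ℝ × ℝ) = 0 := by
      change (⁅A.1, B.1⁆, ⁅A.2, B.2⁆) = (0 : ℝ × ℝ)
      rw [Ring.lie_def, Ring.lie_def, mul_comm, sub_self, mul_comm, sub_self]; rfl
    rw [e₁, e₁, e₁, schouten_representativeOne, hl, map_zero, mul_zero, mul_zero, sub_zero,
      mul_zero]
    rfl

end

end PoissonR3

/-! ### The main theorem. -/

theorem mainTheorem1 (τ : ℝ) (hτ₀ : 0 < τ) (hτ₁ : τ ≤ 1) :
    (openBook τ).casimir = ⊥ ∧
    Subsingleton ((openBook τ).Cohomology 3) ∧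
    -- the case `τ = 1`
    (τ = 1 →
      let g₁ : Fin 4 → Multivector := ![coord 1 • partialField 0, coord 0 • partialField 1,
        eulerField (-1), partialField 2]
      let g₂ : Fin 3 → Multivector := ![(coord 1 • partialField 0) ⋏ partialField 2,
        (coord 0 • partialField 1) ⋏ partialField 2, eulerField (-1) ⋏ partialField 2]
      (openBook τ).FreeOn 1 g₁ ∧
      (openBook τ).FreeOn 2 g₂ ∧
      (openBook τ).Represents (eulerField 1 ⋏ partialField 2) (0 : (openBook τ).Cohomology 2) ∧
      (∀ p : MvPolynomial (Fin 2) ℝ, p.IsHomogeneous 2 →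
        (openBook τ).Represents
          (MvPolynomial.aeval ![coord 0, coord 1] p • (partialField 0 ⋏ partialField 1))
          (0 : (openBook τ).Cohomology 2)) ∧
      (openBook τ).StructureDeterminedBy (representatives g₁ g₂)
        (relations ({eulerField 1 ⋏ partialField 2} ∪
          {T | ∃ p : MvPolynomial (Fin 2) ℝ, p.IsHomogeneous 2 ∧ T =
            MvPolynomial.aeval ![coord 0, coord 1] p • (partialField 0 ⋏ partialField 1)})) ∧
      Nonempty ((openBook τ).Cohomology 1 ≃ₗ⁅ℝ⁆
        (LieAlgebra.SpecialLinear.sl (Fin 2) ℝ × ℝ))) ∧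
    -- the case `τ = 1 / n` with `n ≥ 2`
    (∀ n : ℕ, 2 ≤ n → τ = 1 / n →
      let g₁ : Fin 3 → Multivector := ![coord 1 ^ n • partialField 0, eulerField (-1),
        partialField 2]
      let g₂ : Fin 2 → Multivector := ![(coord 1 ^ n • partialField 0) ⋏ partialField 2,
        eulerField (-1) ⋏ partialField 2]
      (openBook τ).FreeOn 1 g₁ ∧
      (openBook τ).FreeOn 2 g₂ ∧
      (openBook τ).Represents (coord 1 ^ (n + 1) • (partialField 0 ⋏ partialField 1))
        (0 : (openBook τ).Cohomology 2) ∧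
      (openBook τ).StructureDeterminedBy (representatives g₁ g₂)
        (relations {coord 1 ^ (n + 1) • (partialField 0 ⋏ partialField 1)}) ∧
      Nonempty ((openBook τ).Cohomology 1 ≃ₗ⁅ℝ⁆ (aff₁ × ℝ))) ∧
    -- the remaining values of `τ`
    ((∀ n : ℕ, 1 ≤ n → τ ≠ 1 / n) →
      let g₁ : Fin 2 → Multivector := ![eulerField (-1), partialField 2]
      let g₂ : Fin 1 → Multivector := ![eulerField (-1) ⋏ partialField 2]
      (openBook τ).FreeOn 1 g₁ ∧
      (openBook τ).FreeOn 2 g₂ ∧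
      (openBook τ).StructureDeterminedBy (representatives g₁ g₂) (fun _ => ⊥) ∧
      Nonempty ((openBook τ).Cohomology 1 ≃ₗ⁅ℝ⁆ (ℝ × ℝ))) := by
  refine ⟨casimir_openBook hτ₀, subsingleton_cohomology_three hτ₀, ?_, ?_, ?_⟩
  · rintro rfl
    obtain ⟨h₁, h₂, h₃, h₄⟩ := openBook_one
    exact ⟨h₁, h₂, PoissonStructure.represents_zero_iff.2 (eulerField_wedge_mem 1),
      fun p hp => PoissonStructure.represents_zero_iff.2 (aeval_smul_mem hp), h₃, h₄⟩
  · intro n hn hτ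
    have hτ' : n * τ = 1 := by
      rw [hτ, mul_one_div_cancel]
      exact_mod_cast (by omega : n ≠ 0)
    obtain ⟨h₁, h₂, h₃, h₄⟩ := openBook_inv hτ₀ hτ₁ hn hτ'
    exact ⟨h₁, h₂, PoissonStructure.represents_zero_iff.2 (pow_smul_mem hτ'), h₃, h₄⟩
  · intro hτ
    refine openBook_generic hτ₀ hτ₁ fun m hm => ?_
    -- The generic case must exclude `mτ = 1` for every natural `m`, while the hypothesis covers
    -- only `m ≥ 1`; the value `m = 0` is impossible anyway.
    have hm0 : m ≠ 0 := by rintro rfl; simp at hm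
    exact hτ m (by omega) (eq_one_div_of_mul_eq_one_right hm)
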